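/- **Calculus (ESC).** Variables are of two disjoint kinds, multiplicative ($m,n,\dots$) and exponential ($e,f,\dots$); $x,y$ range over both. *Values* $v$ and *terms* $t$ are given by $$v ::= x \mid \lambda x.t \mid\, !t, \qquad t ::= v \mid [v{\to}x]t \mid [m\triangleright v,x]t \mid [e?x]t ,$$ where $\lambda x.t$, the *cut* $[v{\to}x]t$, the *subtraction* $[m\triangleright v,x]t$ and the *dereliction* $[e?x]t$ bind $x$ in $t$. Pre-terms are these expressions with concrete bound names; terms are pre-terms up to $\alpha$-equivalence. $v_{\mathsf m}$ denotes a multiplicative value ($m$ or $\lambda x.t$) and $v_{\mathsf e}$ an exponential one ($e$ or $!t$). *Left contexts* are $L ::= \langle\cdot\rangle \mid [v{\to}x]L \mid [m\triangleright v,x]L \mid [e?x]L$; every term is uniquely $L\langle v\rangle$. A *context* $C$ is a term in which one sub-term (or sub-value) is replaced by a hole; plugging may capture variables. A term is *proper* if: in every $\lambda x.t$, $[v{\to}x]t$, $[m\triangleright v,x]t$, $[e?x]t$ with $x$ multiplicative, $x$ is free in $t$; in every $[v{\to}x]t$ and $[m\triangleright v,x]t$, no multiplicative variable is free both in $v$ and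 in $t$ (apart from $x$ in $t$); in every $[m\triangleright v,x]t$, $m$ is free neither in $v$ nor in $t$; and in every $!t$, no multiplicative variable is free in $t$. The root rules, where $C$ does not bind the cut variable and no variable is captured, are - $\mathsf{axm}_1$: $[v_{\mathsf m}{\to}m]C\langle m\rangle\mapsto C\langle v_{\mathsf m}\rangle$; - $\mathsf{axm}_2$: $[n{\to}m]C\langle[m\triangleright v,x]t\rangle\mapsto C\langle[n\triangleright v,x]t\rangle$; - $\multimap$: $[\lambda y.L\langle v'\rangle{\to}m]C\langle[m\triangleright v,x]t\rangle\mapsto C\langle[v{\to}y]L\langle[v'{\to}x]t\rangle\rangle$; - $\mathsf{axe}_1$: $[v_{\mathsf e}{\to}e]C\langle e\rangle\mapsto[v_{\mathsf e}{\to}e]C\langle v_{\mathsf e}\rangle$; - $\mathsf{axe}_2$: $[f{\to}e]C\langle[e?x]t\rangle\mapsto[f{\to}e]C\langle[f?x]t\rangle$; - $!$: $[!L\langle v\rangle{\to}e]C\langle[e?x]t\rangle\mapsto[!L\langle v\rangle{\to}e]C\langle L\langle[v{\to}x]t\rangle\rangle$; - $\mathsf w$: $[v_{\mathsf e}{\to}e]t\mapsto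 t$ if $e$ is not free in $t$; and they are closed under all contexts. The *position* of a non-erasing step contracting $[v{\to}x]D\langle t_x\rangle$ inside an outer context $C'$, where $t_x$ is the occurrence of $x$ acted upon, is the context $C'\langle[v{\to}x]D\rangle$. A term is *clashing* if it has a sub-term $[v_{\mathsf m}{\to}e]t$ or $[v_{\mathsf e}{\to}m]t$; it is *clash-free* if none of its reducts (itself included) is clashing. **Non-erasing good strategy.** The dominating free variables of a context are: $\mathrm{dfv}(\langle\cdot\rangle)=\emptyset$; $\mathrm{dfv}(!C)=\mathrm{dfv}(C)$; $\mathrm{dfv}(\lambda x.C)=\mathrm{dfv}([v{\to}x]C)=\mathrm{dfv}(C)\setminus\{x\}$; $\mathrm{dfv}([V{\to}x]t)=\mathrm{dfv}(V)$; $\mathrm{dfv}([m\triangleright V,x]t)=\{m\}\cup\mathrm{dfv}(V)$; $\mathrm{dfv}([m\triangleright v,x]C)$ (resp. $\mathrm{dfv}([e?x]C)$) is $\{m\}$ (resp. $\{e\}$) $\cup\,(\mathrm{dfv}(C)\setminus\{x\})$ if $x\in\mathrm{dfv}(C)$, and $\mathrm{dfv}(C)$ otherwise. A context is *good* if its hole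 is not in the left sub-term of a cut and, for each of its sub-contexts $[v{\to}x]C$, $x\notin\mathrm{dfv}(C)$. The *non-erasing good strategy* $\to_{\mathsf G\neg\mathsf w}$ consists of the steps of good position that are not $\mathsf w$-steps. **SESAME.** A *multi-context* $\mathbb C$ is a pre-term in which holes $\langle\cdot\rangle_a$, indexed by names, may occur as values; $\mathbb C\langle u\rangle_a$ is the capture-allowing plugging of $u$ for $\langle\cdot\rangle_a$ (keeping cuts and subtractions split: plugging $L\langle v\rangle$ in $[\langle\cdot\rangle_a{\to}x]t$ gives $L\langle[v{\to}x]t\rangle$, and similarly for subtractions). Its domain $\mathrm{dom}(\mathbb C)$ is the set of the variables $x$ of the cuts $[\cdot{\to}x]\mathbb C'$ of $\mathbb C$, not inside the left sub-term of a cut, such that $\mathbb C'$ has holes. A *state* is a pair $(\mathbb C\mid P)$ of a multi-context and a pool, i.e. a list $P$ of jobs $\langle t\rangle_a$ ($t$ a pre-term, $a$ a name), used in LIFO order. Initial states for $t$: $(\langle\cdot\rangle_a\mid\langle p\rangle_a)$ with $p$ a well-bound representative of $t$ (bound names pairwise distinct, and distinct from the free ones). Read-back: plug every job of the pool in the hole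 of its name. *Search transitions*: 1. $(\mathbb C\mid\langle[v{\to}x]t\rangle_a{:}P)\to(\mathbb C\langle[v{\to}x]\langle\cdot\rangle_a\rangle_a\mid\langle t\rangle_a{:}P)$; 2. $(\mathbb C\mid\langle[m\triangleright v,x]t\rangle_a{:}P)\to(\mathbb C\langle[m\triangleright\langle\cdot\rangle_b,x]\langle\cdot\rangle_a\rangle_a\mid\langle v\rangle_b{:}\langle t\rangle_a{:}P)$ if $m\notin\mathrm{dom}(\mathbb C)$, $b$ fresh; 3. $(\mathbb C\mid\langle[e?x]t\rangle_a{:}P)\to(\mathbb C\langle[e?x]\langle\cdot\rangle_a\rangle_a\mid\langle t\rangle_a{:}P)$ if $e\notin\mathrm{dom}(\mathbb C)$; 4. $(\mathbb C\mid\langle\lambda x.t\rangle_a{:}P)\to(\mathbb C\langle\lambda x.\langle\cdot\rangle_a\rangle_a\mid\langle t\rangle_a{:}P)$; 5. $(\mathbb C\mid\langle !t\rangle_a{:}P)\to(\mathbb C\langle !\langle\cdot\rangle_a\rangle_a\mid\langle t\rangle_a{:}P)$; 6. $(\mathbb C\mid\langle x\rangle_a{:}P)\to(\mathbb C\langle x\rangle_a\mid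 P)$ if $x\notin\mathrm{dom}(\mathbb C)$. *Principal transitions*, where $\mathbb K$ is a multi-context with one distinguished hole and $(\cdot)^\rho$ is a well-bound $\alpha$-renaming with bound names fresh for the whole state: - $\mathsf{axm}_2$: $(\mathbb K\langle[n{\to}m]\mathbb D\rangle\mid\langle[m\triangleright v,x]t\rangle_a{:}P)\to(\mathbb K\langle\mathbb D\rangle\mid\langle[n\triangleright v,x]t\rangle_a{:}P)$; - $\multimap$: $(\mathbb K\langle[\lambda y.L\langle v'\rangle{\to}m]\mathbb D\rangle\mid\langle[m\triangleright v,x]t\rangle_a{:}P)\to(\mathbb K\langle\mathbb D\rangle\mid\langle[v{\to}y]L\langle[v'{\to}x]t\rangle\rangle_a{:}P)$; - $\mathsf{axe}_2$: $(\mathbb K\langle[f{\to}e]\mathbb D\rangle\mid\langle[e?x]t\rangle_a{:}P)\to(\mathbb K\langle[f{\to}e]\mathbb D\rangle\mid\langle[f?x]t\rangle_a{:}P)$; - $!$: $(\mathbb K\langle[!s{\to}e]\mathbb D\rangle\mid\langle[e?x]t\rangle_a{:}P)\to(\mathbb K\langle[!s{\to}e]\mathbb D\rangle\mid\langle L'\langle[v'{\to}x]t\rangle\rangle_a{:}P)$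 with $L'\langle v'\rangle=s^\rho$; - $\mathsf{axm}_1$: $(\mathbb K\langle[v_{\mathsf m}{\to}m]\mathbb D\rangle\mid\langle m\rangle_a{:}P)\to(\mathbb K\langle\mathbb D\rangle\mid\langle v_{\mathsf m}\rangle_a{:}P)$; - $\mathsf{axe}_1$: $(\mathbb K\langle[v_{\mathsf e}{\to}e]\mathbb D\rangle\mid\langle e\rangle_a{:}P)\to(\mathbb K\langle[v_{\mathsf e}{\to}e]\mathbb D\rangle\mid\langle v_{\mathsf e}^\rho\rangle_a{:}P)$. A state is *final* if no transition applies to it. **Theorem (SESAME is good).** SESAME is a big-step implementation of $\to_{\mathsf G\neg\mathsf w}$. That is, for every proper and clash-free term $t$: 1. *Runs to evaluations*: for every run from an initial state for $t$ to a state $Q$, with $k$ principal transitions, the read-back $\underline Q$ of $Q$ is a (defined, hole-free) term and there is an evaluation $t\to_{\mathsf G\neg\mathsf w}^{k}\underline Q$. 2. *Normalizing evaluations to runs*: if $t\to_{\mathsf G\neg\mathsf w}^{k}s$ with $s$ normal for $\to_{\mathsf G\neg\mathsf w}$, then initial states for $t$ exist, and from each of them there is a run with exactly $k$ principal transitions to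 a final state $Q$ such that $\underline Q=s$. 3. *Diverging evaluations to runs*: if there is an infinite $\to_{\mathsf G\neg\mathsf w}$-evaluation from $t$, then from every initial state $Q$ for $t$ SESAME diverges with infinitely many principal transitions: no run from $Q$ reaches a final state, there is an infinite run from $Q$, and every infinite run from $Q$ has infinitely many principal transitions. -/

import Mathlib

namespace ESC

/-! ## Variables, pre-terms and multi-contexts -/

/-- Variables are of two disjoint kinds, multiplicative and exponential. -/
inductive VKind where
  | mul
  | exp
  deriving DecidableEq

/-- Variables of unspecified kind: a kind together with a name. -/
structure Var where
  kind : VKind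
  name : ℕ
  deriving DecidableEq

/-- The multiplicative variable of name `m`. -/
abbrev mv (m : ℕ) : Var := ⟨VKind.mul, m⟩

/-- The exponential variable of name `e`. -/
abbrev ev (e : ℕ) : Var := ⟨VKind.exp, e⟩

/-- The two syntactic categories: values and terms. -/
inductive Cat where
  | val
  | tm

/-- Syntax without implicit renaming of bound variables, with holes labelled in `H`.
For `H = Empty` these are the values and the terms of the calculus, as pre-terms
(concrete bound names); for `H = ℕ` these are the (value) multi-contexts.
* `cut v x t` is the cut `[v → x] t`, binding `x` in `t`;
* `sub m v x t` is the subtraction `[m ▷ v, x] t` on the multiplicative variable `m`,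
  binding `x` in `t`;
* `der e x t` is the dereliction `[e ? x] t` on the exponential variable `e`, binding `x`
  in `t`;
* `val` is the inclusion of values into terms. -/
inductive Expr (H : Type) : Cat → Type where
  | hole (a : H) : Expr H .val
  | var (x : Var) : Expr H .val
  | lam (x : Var) (t : Expr H .tm) : Expr H .val
  | bang (t : Expr H .tm) : Expr H .val
  | val (v : Expr H .val) : Expr H .tm
  | cut (v : Expr H .val) (x : Var) (t : Expr H .tm) : Expr H .tm
  | sub (m : ℕ) (v : Expr H .val) (x : Var) (t : Expr H .tm) : Expr H .tm
  | der (e : ℕ) (x : Var) (t : Expr H .tm) : Expr H .tm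

/-- Values, as pre-terms. -/
abbrev PreValue := Expr Empty .val

/-- Pre-terms. -/
abbrev PreTerm := Expr Empty .tm

/-- Names of holes and of jobs. -/
abbrev Name := ℕ

/-- Multi-contexts with named holes. -/
abbrev MCtx := Expr Name .tm

namespace Expr

variable {H : Type}

/-- Free variables. -/
def fv : {τ : Cat} → Expr H τ → Finset Var
  | _, .hole _ => ∅
  | _, .var x => {x}
  | _, .lam x t => t.fv.erase x
  | _, .bang t => t.fv
  | _, .val v => v.fv
  | _, .cut v x t => v.fv ∪ t.fv.erase x
  | _, .sub m v x t => insert (mv m) (v.fv ∪ t.fv.erase x)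
  | _, .der e x t => insert (ev e) (t.fv.erase x)

/-- The list, with repetitions, of the names of the binders. -/
def binders : {τ : Cat} → Expr H τ → List Var
  | _, .hole _ => []
  | _, .var _ => []
  | _, .lam x t => x :: t.binders
  | _, .bang t => t.binders
  | _, .val v => v.binders
  | _, .cut v x t => x :: (v.binders ++ t.binders)
  | _, .sub _ v x t => x :: (v.binders ++ t.binders)
  | _, .der _ x t => x :: t.binders

/-- All the variables that occur, free, bound or binding. -/
def vars {τ : Cat} (t : Expr H τ) : Finset Var := t.fv ∪ t.binders.toFinset

/-- The list, with repetitions, of the labels of the holes. -/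
def holes : {τ : Cat} → Expr H τ → List H
  | _, .hole a => [a]
  | _, .var _ => []
  | _, .lam _ t => t.holes
  | _, .bang t => t.holes
  | _, .val v => v.holes
  | _, .cut v _ t => v.holes ++ t.holes
  | _, .sub _ v _ t => v.holes ++ t.holes
  | _, .der _ _ t => t.holes

/-- Multiplicative values: multiplicative variables and abstractions. -/
def IsMul : {τ : Cat} → Expr H τ → Prop
  | _, .var x => x.kind = VKind.mul
  | _, .lam _ _ => True
  | _, _ => False

/-- Exponential values: exponential variables and promotions. -/
def IsExp : {τ : Cat} → Expr H τ → Prop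
  | _, .var x => x.kind = VKind.exp
  | _, .bang _ => True
  | _, _ => False

end Expr

/-! ## Renaming of bound variables and terms -/

/-- Exchange of the names `i` and `j` for the variables of kind `κ`. -/
def Var.swap (κ : VKind) (i j : ℕ) (z : Var) : Var :=
  ⟨z.kind, if z.kind = κ then Equiv.swap i j z.name else z.name⟩

/-- Exchange of the names `i` and `j` of kind `κ` everywhere, binders included. -/
def Expr.swap {H : Type} (κ : VKind) (i j : ℕ) : {τ : Cat} → Expr H τ → Expr H τ
  | _, .hole a => .hole a
  | _, .var x => .var (x.swap κ i j)
  | _, .lam x t => .lam (x.swap κ i j) (t.swap κ i j)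
  | _, .bang t => .bang (t.swap κ i j)
  | _, .val v => .val (v.swap κ i j)
  | _, .cut v x t => .cut (v.swap κ i j) (x.swap κ i j) (t.swap κ i j)
  | _, .sub m v x t =>
      .sub ((mv m).swap κ i j).name (v.swap κ i j) (x.swap κ i j) (t.swap κ i j)
  | _, .der e x t => .der ((ev e).swap κ i j).name (x.swap κ i j) (t.swap κ i j)

/-- α-equivalence: the least congruence that allows one to replace the name of a binder
by a name of the same kind that is not free in its scope. -/
inductive Alpha {H : Type} : {τ : Cat} → Expr H τ → Expr H τ → Prop where
  | refl {τ : Cat} (t : Expr H τ) : Alpha t t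
  | symm {τ : Cat} {t s : Expr H τ} : Alpha t s → Alpha s t
  | trans {τ : Cat} {t s u : Expr H τ} : Alpha t s → Alpha s u → Alpha t u
  | lam (x : Var) {t t' : Expr H .tm} : Alpha t t' → Alpha (.lam x t) (.lam x t')
  | bang {t t' : Expr H .tm} : Alpha t t' → Alpha (.bang t) (.bang t')
  | val {v v' : Expr H .val} : Alpha v v' → Alpha (.val v) (.val v')
  | cut (x : Var) {v v' : Expr H .val} {t t' : Expr H .tm} :
      Alpha v v' → Alpha t t' → Alpha (.cut v x t) (.cut v' x t')
  | sub (m : ℕ) (x : Var) {v v' : Expr H .val} {t t' : Expr H .tm} :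
      Alpha v v' → Alpha t t' → Alpha (.sub m v x t) (.sub m v' x t')
  | der (e : ℕ) (x : Var) {t t' : Expr H .tm} :
      Alpha t t' → Alpha (.der e x t) (.der e x t')
  | lam_rename (κ : VKind) (i j : ℕ) (t : Expr H .tm) : (⟨κ, j⟩ : Var) ∉ t.fv →
      Alpha (.lam ⟨κ, i⟩ t) (.lam ⟨κ, j⟩ (t.swap κ i j))
  | cut_rename (κ : VKind) (i j : ℕ) (v : Expr H .val) (t : Expr H .tm) :
      (⟨κ, j⟩ : Var) ∉ t.fv → Alpha (.cut v ⟨κ, i⟩ t) (.cut v ⟨κ, j⟩ (t.swap κ i j))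
  | sub_rename (κ : VKind) (i j m : ℕ) (v : Expr H .val) (t : Expr H .tm) :
      (⟨κ, j⟩ : Var) ∉ t.fv → Alpha (.sub m v ⟨κ, i⟩ t) (.sub m v ⟨κ, j⟩ (t.swap κ i j))
  | der_rename (κ : VKind) (i j e : ℕ) (t : Expr H .tm) :
      (⟨κ, j⟩ : Var) ∉ t.fv → Alpha (.der e ⟨κ, i⟩ t) (.der e ⟨κ, j⟩ (t.swap κ i j))

instance alphaSetoid : Setoid PreTerm where
  r := Alpha
  iseqv := ⟨Alpha.refl, Alpha.symm, Alpha.trans⟩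

/-- The terms of the calculus: pre-terms up to α-equivalence. -/
def Term : Type := Quotient alphaSetoid

/-- The term represented by a pre-term. -/
def PreTerm.toTerm (p : PreTerm) : Term := Quotient.mk alphaSetoid p

/-! ## Contexts -/

/-- General contexts with one hole. `Ctx H σ τ` is the type of contexts of category `τ`
whose hole stands for a sub-expression of category `σ`, so that plugging is exactly the
replacement of a sub-expression. (For `H = ℕ` these are the multi-contexts with one
further distinguished hole, of an irrelevant name that occurs exactly once.) -/
inductive Ctx (H : Type) (σ : Cat) : Cat → Type where
  | hole : Ctx H σ σ
  | lam (x : Var) (C : Ctx H σ .tm) : Ctx H σ .val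
  | bang (C : Ctx H σ .tm) : Ctx H σ .val
  | val (V : Ctx H σ .val) : Ctx H σ .tm
  | cutL (V : Ctx H σ .val) (x : Var) (t : Expr H .tm) : Ctx H σ .tm
  | cutR (v : Expr H .val) (x : Var) (C : Ctx H σ .tm) : Ctx H σ .tm
  | subL (m : ℕ) (V : Ctx H σ .val) (x : Var) (t : Expr H .tm) : Ctx H σ .tm
  | subR (m : ℕ) (v : Expr H .val) (x : Var) (C : Ctx H σ .tm) : Ctx H σ .tm
  | der (e : ℕ) (x : Var) (C : Ctx H σ .tm) : Ctx H σ .tm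

namespace Ctx

variable {H : Type} {σ ρ : Cat}

/-- Plugging of an expression in a context; it may capture variables. -/
def plug : {τ : Cat} → Ctx H σ τ → Expr H σ → Expr H τ
  | _, .hole, s => s
  | _, .lam x C, s => .lam x (C.plug s)
  | _, .bang C, s => .bang (C.plug s)
  | _, .val V, s => .val (V.plug s)
  | _, .cutL V x t, s => .cut (V.plug s) x t
  | _, .cutR v x C, s => .cut v x (C.plug s)
  | _, .subL m V x t, s => .sub m (V.plug s) x t
  | _, .subR m v x C, s => .sub m v x (C.plug s)
  | _, .der e x C, s => .der e x (C.plug s)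

/-- Plugging of a context in a context. -/
def comp : {τ : Cat} → Ctx H σ τ → Ctx H ρ σ → Ctx H ρ τ
  | _, .hole, D => D
  | _, .lam x C, D => .lam x (C.comp D)
  | _, .bang C, D => .bang (C.comp D)
  | _, .val V, D => .val (V.comp D)
  | _, .cutL V x t, D => .cutL (V.comp D) x t
  | _, .cutR v x C, D => .cutR v x (C.comp D)
  | _, .subL m V x t, D => .subL m (V.comp D) x t
  | _, .subR m v x C, D => .subR m v x (C.comp D)
  | _, .der e x C, D => .der e x (C.comp D)

/-- The variables that a context captures in its hole. -/
def captured : {τ : Cat} → Ctx H σ τ → Finset Var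
  | _, .hole => ∅
  | _, .lam x C => insert x C.captured
  | _, .bang C => C.captured
  | _, .val V => V.captured
  | _, .cutL V _ _ => V.captured
  | _, .cutR _ x C => insert x C.captured
  | _, .subL _ V _ _ => V.captured
  | _, .subR _ _ x C => insert x C.captured
  | _, .der _ x C => insert x C.captured

/-- Dominating free variables of a context. -/
def dfv : {τ : Cat} → Ctx H σ τ → Finset Var
  | _, .hole => ∅
  | _, .lam x C => C.dfv.erase x
  | _, .bang C => C.dfv
  | _, .val V => V.dfv
  | _, .cutL V _ _ => V.dfv
  | _, .cutR _ x C => C.dfv.erase x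
  | _, .subL m V _ _ => insert (mv m) V.dfv
  | _, .subR m _ x C => if x ∈ C.dfv then insert (mv m) (C.dfv.erase x) else C.dfv
  | _, .der e x C => if x ∈ C.dfv then insert (ev e) (C.dfv.erase x) else C.dfv

/-- Good contexts. -/
def Good : {τ : Cat} → Ctx H σ τ → Prop
  | _, .hole => True
  | _, .lam _ C => C.Good
  | _, .bang C => C.Good
  | _, .val V => V.Good
  | _, .cutL _ _ _ => False
  | _, .cutR _ x C => C.Good ∧ x ∉ C.dfv
  | _, .subL _ V _ _ => V.Good
  | _, .subR _ _ _ C => C.Good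
  | _, .der _ _ C => C.Good

end Ctx

/-- Left contexts. -/
inductive LCtx (H : Type) : Type where
  | hole : LCtx H
  | cut (v : Expr H .val) (x : Var) (L : LCtx H) : LCtx H
  | sub (m : ℕ) (v : Expr H .val) (x : Var) (L : LCtx H) : LCtx H
  | der (e : ℕ) (x : Var) (L : LCtx H) : LCtx H

/-- Plugging of a term in a left context. -/
def LCtx.plug {H : Type} : LCtx H → Expr H .tm → Expr H .tm
  | .hole, s => s
  | .cut v x L, s => .cut v x (L.plug s)
  | .sub m v x L, s => .sub m v x (L.plug s)
  | .der e x L, s => .der e x (L.plug s)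

/-- The variables that a left context captures. -/
def LCtx.captured {H : Type} : LCtx H → Finset Var
  | .hole => ∅
  | .cut _ x L => insert x L.captured
  | .sub _ _ x L => insert x L.captured
  | .der _ x L => insert x L.captured

/-- The unique splitting `t = L⟨v⟩` of a term as a left context and a value. -/
def Expr.split {H : Type} : {τ : Cat} → Expr H τ → LCtx H × Expr H .val
  | _, .hole a => (.hole, .hole a)
  | _, .var x => (.hole, .var x)
  | _, .lam x t => (.hole, .lam x t)
  | _, .bang t => (.hole, .bang t)
  | _, .val v => (.hole, v)
  | _, .cut v x t => (.cut v x t.split.1, t.split.2)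
  | _, .sub m v x t => (.sub m v x t.split.1, t.split.2)
  | _, .der e x t => (.der e x t.split.1, t.split.2)

/-! ## Proper terms, cut elimination, clashes -/

/-- Proper pre-terms: linearity of multiplicative variables, and no free multiplicative
variable in a promotion. -/
def Proper : {τ : Cat} → Expr Empty τ → Prop
  | _, .var _ => True
  | _, .lam x t => Proper t ∧ (x.kind = VKind.mul → x ∈ t.fv)
  | _, .bang t => Proper t ∧ ∀ m, mv m ∉ t.fv
  | _, .val v => Proper v
  | _, .cut v x t => Proper t ∧ Proper v ∧ (∀ n, mv n ∈ v.fv → mv n ∉ t.fv.erase x) ∧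
      (x.kind = VKind.mul → x ∈ t.fv)
  | _, .sub m v x t => Proper t ∧ Proper v ∧ (∀ n, mv n ∈ v.fv → mv n ∉ t.fv.erase x) ∧
      mv m ∉ v.fv ∧ mv m ∉ t.fv.erase x ∧ (x.kind = VKind.mul → x ∈ t.fv)
  | _, .der _ x t => Proper t ∧ (x.kind = VKind.mul → x ∈ t.fv)

/-- The kinds of cut elimination steps. -/
inductive StepKind where
  | axm1
  | axm2
  | lolli
  | axe1
  | axe2
  | bang
  | w

/-- `PreStep k P p q`: the pre-term `p` rewrites to `q` by contracting a redex of kind `k`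
and position `P`. The outer context `C` realizes the closure by contexts and `D` is the
context of the root rule. The position of a non-erasing step is `C⟨[v → x] D⟩`, whose hole
is the occurrence of `x` acted upon; the position of an erasing step is `C`.
The side conditions say that the occurrence is bound by the cut and that no
variable gets captured. -/
inductive PreStep : StepKind → {σ : Cat} → Ctx Empty σ .tm → PreTerm → PreTerm → Prop where
  | axm1 (C : Ctx Empty .tm .tm) (D : Ctx Empty .val .tm) (v : PreValue) (m : ℕ) :
      v.IsMul → mv m ∉ D.captured → Disjoint D.captured v.fv →
      PreStep .axm1 (C.comp (.cutR v (mv m) D))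
        (C.plug (.cut v (mv m) (D.plug (.var (mv m)))))
        (C.plug (D.plug v))
  | axm2 (C D : Ctx Empty .tm .tm) (n m : ℕ) (v : PreValue) (x : Var) (t : PreTerm) :
      mv m ∉ D.captured → mv n ∉ D.captured →
      PreStep .axm2 (C.comp (.cutR (.var (mv n)) (mv m) D))
        (C.plug (.cut (.var (mv n)) (mv m) (D.plug (.sub m v x t))))
        (C.plug (D.plug (.sub n v x t)))
  | lolli (C D : Ctx Empty .tm .tm) (y : Var) (L : LCtx Empty) (v' : PreValue) (m : ℕ)
      (v : PreValue) (x : Var) (t : PreTerm) :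
      mv m ∉ D.captured → Disjoint D.captured (Expr.lam y (L.plug (.val v'))).fv →
      Disjoint (insert y L.captured) (t.fv.erase x) →
      PreStep .lolli (C.comp (.cutR (.lam y (L.plug (.val v'))) (mv m) D))
        (C.plug (.cut (.lam y (L.plug (.val v'))) (mv m) (D.plug (.sub m v x t))))
        (C.plug (D.plug (.cut v y (L.plug (.cut v' x t)))))
  | axe1 (C : Ctx Empty .tm .tm) (D : Ctx Empty .val .tm) (v : PreValue) (e : ℕ) :
      v.IsExp → ev e ∉ D.captured → Disjoint D.captured v.fv → ev e ∉ v.fv →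
      PreStep .axe1 (C.comp (.cutR v (ev e) D))
        (C.plug (.cut v (ev e) (D.plug (.var (ev e)))))
        (C.plug (.cut v (ev e) (D.plug v)))
  | axe2 (C D : Ctx Empty .tm .tm) (f e : ℕ) (x : Var) (t : PreTerm) :
      ev e ∉ D.captured → ev f ∉ D.captured → f ≠ e →
      PreStep .axe2 (C.comp (.cutR (.var (ev f)) (ev e) D))
        (C.plug (.cut (.var (ev f)) (ev e) (D.plug (.der e x t))))
        (C.plug (.cut (.var (ev f)) (ev e) (D.plug (.der f x t))))
  | bang (C D : Ctx Empty .tm .tm) (L : LCtx Empty) (v : PreValue) (e : ℕ) (x : Var)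
      (t : PreTerm) :
      ev e ∉ D.captured → Disjoint D.captured (L.plug (.val v)).fv →
      ev e ∉ (L.plug (.val v)).fv → Disjoint L.captured (t.fv.erase x) →
      PreStep .bang (C.comp (.cutR (.bang (L.plug (.val v))) (ev e) D))
        (C.plug (.cut (.bang (L.plug (.val v))) (ev e) (D.plug (.der e x t))))
        (C.plug (.cut (.bang (L.plug (.val v))) (ev e) (D.plug (L.plug (.cut v x t)))))
  | w (C : Ctx Empty .tm .tm) (v : PreValue) (e : ℕ) (t : PreTerm) :
      v.IsExp → ev e ∉ t.fv →
      PreStep .w C (C.plug (.cut v (ev e) t)) (C.plug t)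

/-- Cut elimination of the exponential substitution calculus, on terms up to α. -/
def EscStep (t s : Term) : Prop :=
  ∃ (k : StepKind) (σ : Cat) (P : Ctx Empty σ .tm) (p q : PreTerm),
    PreTerm.toTerm p = t ∧ PreTerm.toTerm q = s ∧ PreStep k P p q

/-- The non-erasing good strategy: the steps of good position and of kind different
from `w`. -/
def GoodNonErasingStep (t s : Term) : Prop :=
  ∃ (k : StepKind) (σ : Cat) (P : Ctx Empty σ .tm) (p q : PreTerm),
    PreTerm.toTerm p = t ∧ PreTerm.toTerm q = s ∧ PreStep k P p q ∧ P.Good ∧ k ≠ .w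

/-- A term is proper if it has a proper representative. -/
def Term.IsProper (t : Term) : Prop := ∃ p : PreTerm, PreTerm.toTerm p = t ∧ Proper p

/-- A term is clashing if it has a sub-term that is a cut of a multiplicative value on an
exponential variable, or of an exponential value on a multiplicative variable. -/
def Term.Clashing (t : Term) : Prop :=
  ∃ (C : Ctx Empty .tm .tm) (v : PreValue) (x : Var) (s : PreTerm),
    PreTerm.toTerm (C.plug (.cut v x s)) = t ∧
    ((v.IsMul ∧ x.kind = VKind.exp) ∨ (v.IsExp ∧ x.kind = VKind.mul))

/-- A term is clash-free if neither it nor any of its reducts is clashing. -/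
def Term.ClashFree (t : Term) : Prop :=
  ∀ s, Relation.ReflTransGen EscStep t s → ¬ s.Clashing

/-! ## Strategies, abstract machines and big-step implementations -/

/-- `Evaluation r k t s`: there is an `r`-evaluation of length `k` from `t` to `s`. -/
def Evaluation {α : Type} (r : α → α → Prop) : ℕ → α → α → Prop
  | 0, t, s => t = s
  | k + 1, t, s => ∃ u, r t u ∧ Evaluation r k u s

/-- Normal forms of a relation. -/
def Normal {α : Type} (r : α → α → Prop) (t : α) : Prop := ∀ s, ¬ r t s

/-- `r` diverges on `t`: there is an infinite `r`-evaluation from `t`. -/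
def Diverges {α : Type} (r : α → α → Prop) (t : α) : Prop :=
  ∃ f : ℕ → α, f 0 = t ∧ ∀ n, r (f n) (f (n + 1))

/-- Transitions are either principal or search transitions. -/
inductive TransKind where
  | principal
  | search

/-- Abstract machines. The read-back is a partial function on states. -/
structure Machine where
  State : Type
  trans : TransKind → State → State → Prop
  init : Term → State → Prop
  readBack : State → Option Term

namespace Machine

variable (M : Machine)

/-- `M.Run k Q Q'`: there is a finite run from `Q` to `Q'` with exactly `k` principal
transitions. -/
inductive Run : ℕ → M.State → M.State → Prop where
  | nil (Q : M.State) : Run 0 Q Q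
  | search {k : ℕ} {Q Q' Q'' : M.State} :
      M.trans .search Q Q' → Run k Q' Q'' → Run k Q Q''
  | principal {k : ℕ} {Q Q' Q'' : M.State} :
      M.trans .principal Q Q' → Run k Q' Q'' → Run (k + 1) Q Q''

/-- Final states: no transition applies. -/
def Final (Q : M.State) : Prop := ∀ a Q', ¬ M.trans a Q Q'

/-- Infinite runs from `Q`; `l n` is the kind of the `n`-th transition. -/
def InfiniteRun (Q : M.State) (f : ℕ → M.State) (l : ℕ → TransKind) : Prop :=
  f 0 = Q ∧ ∀ n, M.trans (l n) (f n) (f (n + 1))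

/-- The machine diverges on `Q` doing infinitely many principal transitions: no run from
`Q` ever stops, and every infinite run from `Q` (there is at least one) has
infinitely many principal transitions. -/
def DivergesPrincipally (Q : M.State) : Prop :=
  (∀ k Q', M.Run k Q Q' → ¬ M.Final Q') ∧
  (∃ f l, M.InfiniteRun Q f l) ∧
  (∀ f l, M.InfiniteRun Q f l → ∀ N, ∃ n, N ≤ n ∧ l n = .principal)

end Machine

/-- The machine `M` is a big-step implementation of the strategy `str`. -/
structure BigStepImplementation (M : Machine) (str : Term → Term → Prop) : Prop where
  /-- Runs to evaluations. -/
  runs_to_evaluations : ∀ t : Term, t.IsProper → t.ClashFree →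
    ∀ (Q' Q : M.State) (k : ℕ), M.init t Q' → M.Run k Q' Q →
      ∃ s, M.readBack Q = some s ∧ Evaluation str k t s
  /-- Normalizing evaluations to runs: there are initial states for `t`, and from each
  of them a run of the same principal length that stops on a state reading back to the
  normal form. -/
  normalizing_evaluations_to_runs : ∀ t : Term, t.IsProper → t.ClashFree →
    ∀ (s : Term) (k : ℕ), Evaluation str k t s → Normal str s →
      (∃ Q', M.init t Q') ∧
      ∀ Q', M.init t Q' → ∃ Q, M.Run k Q' Q ∧ M.Final Q ∧ M.readBack Q = some s
  /-- Diverging evaluations to runs. -/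
  diverging_evaluations_to_runs : ∀ t : Term, t.IsProper → t.ClashFree →
    ∀ Q : M.State, M.init t Q → Diverges str t → M.DivergesPrincipally Q

/-! ## SESAME -/

/-- Pre-terms are the multi-contexts without holes. -/
def Expr.emb : {τ : Cat} → Expr Empty τ → Expr Name τ
  | _, .var x => .var x
  | _, .lam x t => .lam x t.emb
  | _, .bang t => .bang t.emb
  | _, .val v => .val v.emb
  | _, .cut v x t => .cut v.emb x t.emb
  | _, .sub m v x t => .sub m v.emb x t.emb
  | _, .der e x t => .der e x t.emb

/-- The pre-term that a multi-context without holes is; undefined if there are holes. -/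
def Expr.close : {τ : Cat} → Expr Name τ → Option (Expr Empty τ)
  | _, .hole _ => none
  | _, .var x => some (.var x)
  | _, .lam x t => do return .lam x (← t.close)
  | _, .bang t => do return .bang (← t.close)
  | _, .val v => do return .val (← v.close)
  | _, .cut v x t => do return .cut (← v.close) x (← t.close)
  | _, .sub m v x t => do return .sub m (← v.close) x (← t.close)
  | _, .der e x t => do return .der e x (← t.close)

/-- Plugging of the multi-context `u` on the name `a`: capture-allowing substitution of
the holes of name `a`. Cuts and subtractions are kept split: plugging
`u = L⟨v⟩` in the left hole of `[⟨·⟩ → x] t` gives `L⟨[v → x] t⟩`, and similarly for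
subtractions. -/
def Expr.fill : {τ : Cat} → Expr Name τ → Name → MCtx → MCtx
  | _, .hole b, a, u => if b = a then u else .val (.hole b)
  | _, .var x, _, _ => .val (.var x)
  | _, .lam x t, a, u => .val (.lam x (t.fill a u))
  | _, .bang t, a, u => .val (.bang (t.fill a u))
  | _, .val v, a, u => v.fill a u
  | _, .cut v x t, a, u =>
      (v.fill a u).split.1.plug (.cut (v.fill a u).split.2 x (t.fill a u))
  | _, .sub m v x t, a, u =>
      (v.fill a u).split.1.plug (.sub m (v.fill a u).split.2 x (t.fill a u))
  | _, .der e x t, a, u => .der e x (t.fill a u)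

/-- The domain of a multi-context: the variables of the out cuts having holes in their
scope. -/
def Expr.dom : {τ : Cat} → Expr Name τ → Finset Var
  | _, .hole _ => ∅
  | _, .var _ => ∅
  | _, .lam _ t => t.dom
  | _, .bang t => t.dom
  | _, .val v => v.dom
  | _, .cut _ x t => if t.holes = [] then ∅ else insert x t.dom
  | _, .sub _ v _ t => v.dom ∪ t.dom
  | _, .der _ _ t => t.dom

/-- The states of SESAME: a multi-context and a pool, that is, a LIFO list of named jobs. -/
@[ext]
structure SState where
  mctx : MCtx
  pool : List (Name × PreTerm)

/-- All the variables that occur in a state. -/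
def SState.vars (Q : SState) : Finset Var :=
  Q.mctx.vars ∪ (Q.pool.map fun j => j.2.vars).foldr (· ∪ ·) ∅

/-- Well-bound expressions: the bound names are pairwise distinct, and distinct from the
free ones. -/
def WellBound {H : Type} {τ : Cat} (t : Expr H τ) : Prop :=
  t.binders.Nodup ∧ ∀ x ∈ t.binders, x ∉ t.fv

/-- `FreshRenaming X t t'`: `t'` is a well-bound renaming of `t` whose bound
variables are fresh with respect to `X`. -/
def FreshRenaming {H : Type} {τ : Cat} (X : Finset Var) (t t' : Expr H τ) : Prop :=
  Alpha t t' ∧ WellBound t' ∧ ∀ x ∈ t'.binders, x ∉ X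

/-- Search transitions. -/
inductive SearchTrans : SState → SState → Prop where
  | sea1 (C : MCtx) (v : PreValue) (x : Var) (t : PreTerm) (a : Name)
      (P : List (Name × PreTerm)) :
      SearchTrans ⟨C, (a, .cut v x t) :: P⟩
        ⟨C.fill a (.cut v.emb x (.val (.hole a))), (a, t) :: P⟩
  | sea2 (C : MCtx) (m : ℕ) (v : PreValue) (x : Var) (t : PreTerm) (a b : Name)
      (P : List (Name × PreTerm)) :
      mv m ∉ C.dom → b ∉ C.holes → b ≠ a → b ∉ P.map Prod.fst →
      SearchTrans ⟨C, (a, .sub m v x t) :: P⟩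
        ⟨C.fill a (.sub m (.hole b) x (.val (.hole a))), (b, .val v) :: (a, t) :: P⟩
  | sea3 (C : MCtx) (e : ℕ) (x : Var) (t : PreTerm) (a : Name)
      (P : List (Name × PreTerm)) :
      ev e ∉ C.dom →
      SearchTrans ⟨C, (a, .der e x t) :: P⟩
        ⟨C.fill a (.der e x (.val (.hole a))), (a, t) :: P⟩
  | sea4 (C : MCtx) (x : Var) (t : PreTerm) (a : Name) (P : List (Name × PreTerm)) :
      SearchTrans ⟨C, (a, .val (.lam x t)) :: P⟩
        ⟨C.fill a (.val (.lam x (.val (.hole a)))), (a, t) :: P⟩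
  | sea5 (C : MCtx) (t : PreTerm) (a : Name) (P : List (Name × PreTerm)) :
      SearchTrans ⟨C, (a, .val (.bang t)) :: P⟩
        ⟨C.fill a (.val (.bang (.val (.hole a)))), (a, t) :: P⟩
  | sea6 (C : MCtx) (x : Var) (a : Name) (P : List (Name × PreTerm)) :
      x ∉ C.dom →
      SearchTrans ⟨C, (a, .val (.var x)) :: P⟩ ⟨C.fill a (.val (.var x)), P⟩

/-- Principal transitions. The multi-context is decomposed as `K⟨[v → x] D⟩`. -/
inductive PrincipalTrans : SState → SState → Prop where
  | axm2 (K : Ctx Name .tm .tm) (D : MCtx) (n m : ℕ) (v : PreValue) (x : Var) (t : PreTerm)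
      (a : Name) (P : List (Name × PreTerm)) :
      PrincipalTrans ⟨K.plug (.cut (.var (mv n)) (mv m) D), (a, .sub m v x t) :: P⟩
        ⟨K.plug D, (a, .sub n v x t) :: P⟩
  | lolli (K : Ctx Name .tm .tm) (D : MCtx) (y : Var) (L : LCtx Empty) (v' : PreValue)
      (m : ℕ) (v : PreValue) (x : Var) (t : PreTerm) (a : Name)
      (P : List (Name × PreTerm)) :
      PrincipalTrans
        ⟨K.plug (.cut (Expr.lam y (L.plug (.val v'))).emb (mv m) D), (a, .sub m v x t) :: P⟩
        ⟨K.plug D, (a, .cut v y (L.plug (.cut v' x t))) :: P⟩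
  | axe2 (K : Ctx Name .tm .tm) (D : MCtx) (f e : ℕ) (x : Var) (t : PreTerm) (a : Name)
      (P : List (Name × PreTerm)) :
      PrincipalTrans ⟨K.plug (.cut (.var (ev f)) (ev e) D), (a, .der e x t) :: P⟩
        ⟨K.plug (.cut (.var (ev f)) (ev e) D), (a, .der f x t) :: P⟩
  | bang (K : Ctx Name .tm .tm) (D : MCtx) (s : PreTerm) (L' : LCtx Empty) (v' : PreValue)
      (e : ℕ) (x : Var) (t : PreTerm) (a : Name) (P : List (Name × PreTerm)) :
      FreshRenaming
        (SState.vars ⟨K.plug (.cut (Expr.bang s).emb (ev e) D), (a, .der e x t) :: P⟩)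
        s (L'.plug (.val v')) →
      PrincipalTrans ⟨K.plug (.cut (Expr.bang s).emb (ev e) D), (a, .der e x t) :: P⟩
        ⟨K.plug (.cut (Expr.bang s).emb (ev e) D), (a, L'.plug (.cut v' x t)) :: P⟩
  | axm1 (K : Ctx Name .tm .tm) (D : MCtx) (v : PreValue) (m : ℕ) (a : Name)
      (P : List (Name × PreTerm)) :
      v.IsMul →
      PrincipalTrans ⟨K.plug (.cut v.emb (mv m) D), (a, .val (.var (mv m))) :: P⟩
        ⟨K.plug D, (a, .val v) :: P⟩
  | axe1 (K : Ctx Name .tm .tm) (D : MCtx) (v v' : PreValue) (e : ℕ) (a : Name)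
      (P : List (Name × PreTerm)) :
      v.IsExp →
      FreshRenaming
        (SState.vars ⟨K.plug (.cut v.emb (ev e) D), (a, .val (.var (ev e))) :: P⟩) v v' →
      PrincipalTrans ⟨K.plug (.cut v.emb (ev e) D), (a, .val (.var (ev e))) :: P⟩
        ⟨K.plug (.cut v.emb (ev e) D), (a, .val v') :: P⟩

/-- Initialization: a single hole, and a single job that is a well-bound
representative of the term. -/
def SState.Init (t : Term) (Q : SState) : Prop :=
  ∃ (a : Name) (p : PreTerm), PreTerm.toTerm p = t ∧ WellBound p ∧
    Q = ⟨.val (.hole a), [(a, p)]⟩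

/-- Read-back: plug each job in the hole of its name. It is defined when no hole is left. -/
def SState.readBack (Q : SState) : Option Term :=
  ((Q.pool.foldl (fun C j => C.fill j.1 j.2.emb) Q.mctx).close).map PreTerm.toTerm

/-- The Strong Exponential Substitution Abstract Machine without Erasure. -/
def SESAME : Machine where
  State := SState
  trans
    | .principal => PrincipalTrans
    | .search => SearchTrans
  init := SState.Init
  readBack := SState.readBack

end ESC

namespace ESC

/-! ## Nameless expressions -/

/-! The strategy is non-deterministic, whereas the machine explores the term in one fixed order. Two
facts reconcile them. The machine is sound: a search transition leaves the read-back unchanged, and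
a principal transition performs one good non-erasing step on it. The strategy has the diamond
property: two different steps from one term are closed by one step on each side. By random descent
(`Evaluation.of_diamond`, `Evaluation.not_diverges`), the length and the end point of a normalizing
evaluation do not depend on the steps chosen, and a term that has one does not diverge. Hence the
evaluation followed by the machine is as good as any given one.

The diamond is proved on nameless expressions, for the labelled system `LStep`. A label is either
absent (an internal step) or a request, that is, a free variable together with the value of a cut on
it that lies further out; passing the cut turns an answered request into an internal step. The set
carried by `LStep` expresses goodness from the outside in: it collects the variables that the
position must not have as dominating variables. Goodness makes `LStep.diamond` work. If a request
contracts a subtraction on `m`, then `m` is in the set, so no step takes place in the argument of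
the subtraction, which is about to become the value of a cut; and the bound variable of the
subtraction is already treated as the variable of a cut, which it becomes. Since no step takes place
inside the value of a cut, copying such a value never copies a redex that the other step contracts.

Terms are transported by `Term.db`, which is injective on α-classes, and `PreStep.dstep` sends good
steps of linear terms to nameless ones. Linearity is needed there because a multiplicative cut
vanishes together with the only occurrence of its variable.

Soundness rests on the invariant `SState.Inv`: the read-back has a well-bound representative and no
occurrence already visited is bound by a cut outside. Well-boundness supplies the side conditions on
capture of the root rules (`WellBound.redex`), and the search condition supplies the goodness of the
position (`ReadsBack.exists_redex`). On clash-free terms a final state has an empty pool, and a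
completely searched context is normal for `DStep`. Running the machine thus also shows that a normal
form of the named strategy is normal in nameless form (`Term.normal_db`), so no general converse of
`PreStep.dstep` is needed. Finally, search transitions decrease the size of the pool, so an infinite
run has infinitely many principal transitions. -/

/-- Nameless expressions. A variable is a kind together with a de Bruijn index that counts
the binders of that kind only. -/
inductive DExpr : Cat → Type where
  | var (x : Var) : DExpr .val
  | lam (κ : VKind) (t : DExpr .tm) : DExpr .val
  | bang (t : DExpr .tm) : DExpr .val
  | val (v : DExpr .val) : DExpr .tm
  | cut (v : DExpr .val) (κ : VKind) (t : DExpr .tm) : DExpr .tm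
  | sub (m : ℕ) (v : DExpr .val) (κ : VKind) (t : DExpr .tm) : DExpr .tm
  | der (e : ℕ) (κ : VKind) (t : DExpr .tm) : DExpr .tm

/-- Kind-preserving maps of variables. -/
abbrev Ren := VKind → ℕ → ℕ

namespace Ren

/-- The action of a renaming on variables. -/
def act (f : Ren) (x : Var) : Var := ⟨x.kind, f x.kind x.name⟩

/-- Weakening by a variable of kind `κ`. -/
def shift (κ : VKind) : Ren := fun κ' n => if κ' = κ then n + 1 else n

/-- Left inverse of `shift κ`. -/
def pred (κ : VKind) : Ren := fun κ' n => if κ' = κ then n - 1 else n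

/-- Lifting of a renaming under a binder of kind `κ`. -/
def up (κ : VKind) (f : Ren) : Ren := fun κ' n =>
  if κ' = κ then (match n with | 0 => 0 | n + 1 => f κ' n + 1) else f κ' n

/-- Composition of renamings. -/
def comp (g f : Ren) : Ren := fun κ n => g κ (f κ n)

@[simp] theorem act_comp (g f : Ren) (x : Var) : act (comp g f) x = act g (act f x) := rfl

@[simp] theorem act_mv (f : Ren) (m : ℕ) : act f (mv m) = mv (f .mul m) := rfl

@[simp] theorem act_ev (f : Ren) (e : ℕ) : act f (ev e) = ev (f .exp e) := rfl

@[simp] theorem act_kind (f : Ren) (x : Var) : (act f x).kind = x.kind := rfl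

@[simp] theorem act_up_zero (κ : VKind) (f : Ren) : act (up κ f) ⟨κ, 0⟩ = ⟨κ, 0⟩ := by
  simp [act, up]

@[simp] theorem act_up_shift (κ : VKind) (f : Ren) (y : Var) :
    act (up κ f) (act (shift κ) y) = act (shift κ) (act f y) := by
  rcases y with ⟨κ', n⟩
  by_cases h : κ' = κ <;> simp [act, up, shift, h]

@[simp] theorem act_pred_shift (κ : VKind) (y : Var) : act (pred κ) (act (shift κ) y) = y := by
  rcases y with ⟨κ', n⟩
  by_cases h : κ' = κ <;> simp [act, pred, shift, h]

@[simp] theorem shift_ne_zero (κ : VKind) (y : Var) : act (shift κ) y ≠ ⟨κ, 0⟩ := by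
  rcases y with ⟨κ', n⟩
  by_cases h : κ' = κ <;> simp [act, shift, h]

@[simp] theorem zero_ne_shift (κ : VKind) (y : Var) : ⟨κ, 0⟩ ≠ act (shift κ) y :=
  (shift_ne_zero κ y).symm

@[simp] theorem shift_inj {κ : VKind} {x y : Var} :
    act (shift κ) x = act (shift κ) y ↔ x = y :=
  ⟨fun h => by simpa using congrArg (act (pred κ)) h, fun h => h ▸ rfl⟩

theorem zero_or_shift (κ : VKind) (z : Var) : z = ⟨κ, 0⟩ ∨ ∃ y, z = act (shift κ) y := by
  rcases z with ⟨κ', n⟩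
  by_cases h : κ' = κ
  · subst h
    cases n with
    | zero => exact .inl rfl
    | succ n => exact .inr ⟨⟨κ', n⟩, by simp [act, shift]⟩
  · exact .inr ⟨⟨κ', n⟩, by simp [act, shift, h]⟩

theorem ext_act {f g : Ren} (h : ∀ y, act f y = act g y) : f = g := by
  funext κ n
  simpa [act] using h ⟨κ, n⟩

theorem up_comp (κ : VKind) (g f : Ren) : up κ (comp g f) = comp (up κ g) (up κ f) := by
  refine ext_act fun y => ?_
  obtain rfl | ⟨y, rfl⟩ := zero_or_shift κ y <;> simp

theorem up_comp_shift (κ : VKind) (f : Ren) :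
    comp (up κ f) (shift κ) = comp (shift κ) f :=
  ext_act fun y => by simp

theorem act_up_eq_zero {κ : VKind} {f : Ren} {y : Var} :
    act (up κ f) y = ⟨κ, 0⟩ ↔ y = ⟨κ, 0⟩ := by
  obtain rfl | ⟨y, rfl⟩ := zero_or_shift κ y <;> simp

end Ren

open Ren

namespace DExpr

/-- Renaming of the free variables. -/
def ren : {τ : Cat} → Ren → DExpr τ → DExpr τ
  | _, f, .var x => .var (act f x)
  | _, f, .lam κ t => .lam κ (ren (up κ f) t)
  | _, f, .bang t => .bang (ren f t)
  | _, f, .val v => .val (ren f v)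
  | _, f, .cut v κ t => .cut (ren f v) κ (ren (up κ f) t)
  | _, f, .sub m v κ t => .sub (f .mul m) (ren f v) κ (ren (up κ f) t)
  | _, f, .der e κ t => .der (f .exp e) κ (ren (up κ f) t)

/-- The number of free occurrences of a variable. -/
def cnt : {τ : Cat} → Var → DExpr τ → ℕ
  | _, z, .var x => if x = z then 1 else 0
  | _, z, .lam κ t => cnt (act (shift κ) z) t
  | _, z, .bang t => cnt z t
  | _, z, .val v => cnt z v
  | _, z, .cut v κ t => cnt z v + cnt (act (shift κ) z) t
  | _, z, .sub m v κ t => (if mv m = z then 1 else 0) + cnt z v + cnt (act (shift κ) z) t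
  | _, z, .der e κ t => (if ev e = z then 1 else 0) + cnt (act (shift κ) z) t

/-- `splice L⟨v⟩ κ t` is `L⟨[v → x] t⟩` where `x` has kind `κ`. -/
def splice : {τ : Cat} → DExpr τ → VKind → DExpr .tm → DExpr .tm
  | _, .val v, κ, t => .cut v κ t
  | _, .cut v κ' s, κ, t => .cut v κ' (splice s κ (ren (up κ (shift κ')) t))
  | _, .sub m v κ' s, κ, t => .sub m v κ' (splice s κ (ren (up κ (shift κ')) t))
  | _, .der e κ' s, κ, t => .der e κ' (splice s κ (ren (up κ (shift κ')) t))
  | _, .var x, κ, t => .cut (.var x) κ t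
  | _, .lam κ' s, κ, t => .cut (.lam κ' s) κ t
  | _, .bang s, κ, t => .cut (.bang s) κ t

variable {τ : Cat}

theorem ren_ren (t : DExpr τ) (g f : Ren) : ren g (ren f t) = ren (comp g f) t := by
  induction t generalizing g f with
  | var x => simp [ren]
  | _ => simp_all [ren, up_comp]; try rfl

theorem ren_congr (t : DExpr τ) {f g : Ren} (h : ∀ y, cnt y t ≠ 0 → act f y = act g y) :
    ren f t = ren g t := by
  have key : ∀ {κ : VKind} {f g : Ren} {s : DExpr .tm},
      (∀ y, cnt (act (shift κ) y) s ≠ 0 → act f y = act g y) →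
      ∀ y, cnt y s ≠ 0 → act (up κ f) y = act (up κ g) y := by
    intro κ f g s h y hy
    obtain rfl | ⟨y, rfl⟩ := zero_or_shift κ y
    · simp
    · simp [h y hy]
  induction t generalizing f g with
  | var x => simp [ren, h x (by simp [cnt])]
  | lam κ t ih => simp only [ren, ih (key h)]
  | bang t ih => simp only [ren, ih h]
  | val v ih => simp only [ren, ih h]
  | cut v κ t ihv iht =>
    simp only [ren, ihv fun y hy => h y (by simp [cnt, hy]),
      iht (key (κ := κ) fun y hy => h y (by simp [cnt, hy]))]
  | sub m v κ t ihv iht =>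
    have := congrArg Var.name (h (mv m) (by simp [cnt]))
    simp only [act] at this
    simp only [ren, this, ihv fun y hy => h y (by simp [cnt, hy]),
      iht (key (κ := κ) fun y hy => h y (by simp [cnt, hy]))]
  | der e κ t iht =>
    have := congrArg Var.name (h (ev e) (by simp [cnt]))
    simp only [act] at this
    simp only [ren, this, iht (key (κ := κ) fun y hy => h y (by simp [cnt, hy]))]

theorem ren_id (t : DExpr τ) {f : Ren} (h : ∀ y, cnt y t ≠ 0 → act f y = y) : ren f t = t := by
  have hid : ∀ {τ : Cat} (t : DExpr τ), ren (fun _ n => n) t = t := by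
    intro τ t
    have hup : ∀ κ, up κ (fun _ n => n) = fun _ n => n := fun κ => ext_act fun y => by
      obtain rfl | ⟨y, rfl⟩ := zero_or_shift κ y
      · exact act_up_zero κ _
      · exact act_up_shift κ _ y
    induction t with
    | var x => rfl
    | _ => simp_all [ren]
  exact (ren_congr t (g := fun _ n => n) h).trans (hid t)

theorem ren_pred_shift (κ : VKind) (t : DExpr τ) : ren (pred κ) (ren (shift κ) t) = t := by
  rw [ren_ren]
  exact ren_id _ fun y _ => by simp

/-- `pred κ` sends both indices 0 and 1 of kind `κ` to 0, so it is undone by the shift only where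
index 0 does not occur. -/
theorem ren_shift_pred {κ : VKind} {t : DExpr τ} (h : cnt ⟨κ, 0⟩ t = 0) :
    ren (shift κ) (ren (pred κ) t) = t := by
  rw [ren_ren]
  refine ren_id _ fun y hy => ?_
  obtain rfl | ⟨y, rfl⟩ := zero_or_shift κ y
  · exact absurd h hy
  · simp

theorem ren_up_shift (κ : VKind) (f : Ren) (t : DExpr τ) :
    ren (up κ f) (ren (shift κ) t) = ren (shift κ) (ren f t) := by
  rw [ren_ren, ren_ren, up_comp_shift]

theorem ren_up_up_shift (κ κ' : VKind) (f : Ren) (t : DExpr τ) :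
    ren (up κ (up κ' f)) (ren (up κ (shift κ')) t) =
      ren (up κ (shift κ')) (ren (up κ f) t) := by
  rw [ren_ren, ren_ren, ← up_comp, ← up_comp, up_comp_shift]

/-- Occurrences of `z` after renaming come from the fibre of the renaming over `z`. It is enough
that this one fibre is a singleton; the renaming need not be injective elsewhere. -/
theorem cnt_ren_eq {f : Ren} {z z₀ : Var} (t : DExpr τ) (h : ∀ y, act f y = z ↔ y = z₀) :
    cnt z (ren f t) = cnt z₀ t := by
  have key : ∀ {κ : VKind} {f : Ren} {z z₀ : Var}, (∀ y, act f y = z ↔ y = z₀) →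
      ∀ y, act (up κ f) y = act (shift κ) z ↔ y = act (shift κ) z₀ := by
    intro κ f z z₀ h y
    obtain rfl | ⟨y, rfl⟩ := zero_or_shift κ y <;> simp [h]
  induction t generalizing f z z₀ with
  | var x => simp [ren, cnt, h]
  | lam κ t ih => simp only [ren, cnt, ih (key h)]
  | bang t ih => simp only [ren, cnt, ih h]
  | val v ih => simp only [ren, cnt, ih h]
  | cut v κ t ihv iht => simp only [ren, cnt, ihv h, iht (key h)]
  | sub m v κ t ihv iht => simp only [ren, cnt, ihv h, iht (key h), ← act_mv, h]
  | der e κ t iht => simp only [ren, cnt, iht (key h), ← act_ev, h]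

theorem exists_of_cnt_ren {f : Ren} {z : Var} (t : DExpr τ) (h : cnt z (ren f t) ≠ 0) :
    ∃ y, cnt y t ≠ 0 ∧ act f y = z := by
  have key : ∀ {κ : VKind} {f : Ren} {z : Var} {s : DExpr .tm},
      (∃ y, cnt y s ≠ 0 ∧ act (up κ f) y = act (shift κ) z) →
      ∃ y, cnt (act (shift κ) y) s ≠ 0 ∧ act f y = z := by
    rintro κ f z s ⟨y, hy, hz⟩
    obtain rfl | ⟨y, rfl⟩ := zero_or_shift κ y
    · simp at hz
    · exact ⟨y, hy, by simpa using hz⟩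
  induction t generalizing f z with
  | var x =>
    refine ⟨x, by simp [cnt], ?_⟩
    by_contra hx
    simp [ren, cnt, hx] at h
  | lam κ t ih => exact key (ih h)
  | bang t ih => exact ih h
  | val v ih => exact ih h
  | cut v κ t ihv iht =>
    simp only [ren, cnt, ne_eq, Nat.add_eq_zero_iff, not_and_or] at h ⊢
    rcases h with h | h
    · obtain ⟨y, hy, hz⟩ := ihv h; exact ⟨y, .inl hy, hz⟩
    · obtain ⟨y, hy, hz⟩ := key (iht h); exact ⟨y, .inr hy, hz⟩
  | sub m v κ t ihv iht =>
    simp only [ren, cnt, ne_eq, Nat.add_eq_zero_iff, not_and_or] at h ⊢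
    rcases h with (h | h) | h
    · exact ⟨mv m, by simp, by by_contra hm; simp_all⟩
    · obtain ⟨y, hy, hz⟩ := ihv h; exact ⟨y, .inl (.inr hy), hz⟩
    · obtain ⟨y, hy, hz⟩ := key (iht h); exact ⟨y, .inr hy, hz⟩
  | der e κ t iht =>
    simp only [ren, cnt, ne_eq, Nat.add_eq_zero_iff, not_and_or] at h ⊢
    rcases h with h | h
    · exact ⟨ev e, by simp, by by_contra hm; simp_all⟩
    · obtain ⟨y, hy, hz⟩ := key (iht h); exact ⟨y, .inr hy, hz⟩

@[simp] theorem cnt_shift (κ : VKind) (z : Var) (t : DExpr τ) :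
    cnt (act (shift κ) z) (ren (shift κ) t) = cnt z t :=
  cnt_ren_eq t fun _ => shift_inj

@[simp] theorem cnt_zero_shift (κ : VKind) (t : DExpr τ) :
    cnt ⟨κ, 0⟩ (ren (shift κ) t) = 0 := by
  by_contra h
  obtain ⟨y, -, hy⟩ := exists_of_cnt_ren t h
  exact shift_ne_zero _ _ hy

@[simp] theorem cnt_zero_up (κ : VKind) (f : Ren) (t : DExpr τ) :
    cnt ⟨κ, 0⟩ (ren (up κ f) t) = cnt ⟨κ, 0⟩ t :=
  cnt_ren_eq t fun _ => act_up_eq_zero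

@[simp] theorem cnt_shift_up_shift (κ κ' : VKind) (z : Var) (t : DExpr τ) :
    cnt (act (shift κ) (act (shift κ') z)) (ren (up κ (shift κ')) t) =
      cnt (act (shift κ) z) t := by
  refine cnt_ren_eq t fun y => ?_
  obtain rfl | ⟨y, rfl⟩ := zero_or_shift κ y <;> simp

theorem cnt_pred {κ : VKind} {t : DExpr τ} (h : cnt ⟨κ, 0⟩ t = 0) (z : Var) :
    cnt z (ren (pred κ) t) = cnt (act (shift κ) z) t := by
  rw [← cnt_shift κ, ren_shift_pred h]

theorem ren_splice (s : DExpr τ) (κ : VKind) (t : DExpr .tm) (f : Ren) :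
    ren f (splice s κ t) = splice (ren f s) κ (ren (up κ f) t) := by
  induction s generalizing t f with
  | cut v κ' s _ ih => simp only [splice, ren, ih, ren_up_up_shift]
  | sub m v κ' s _ ih => simp only [splice, ren, ih, ren_up_up_shift]
  | der e κ' s ih => simp only [splice, ren, ih, ren_up_up_shift]
  | _ => rfl

theorem cnt_splice (s : DExpr τ) (κ : VKind) (t : DExpr .tm) (z : Var) :
    cnt z (splice s κ t) = cnt z s + cnt (act (shift κ) z) t := by
  induction s generalizing t z with
  | cut v κ' s _ ih => simp only [splice, cnt, ih, cnt_shift_up_shift]; ring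
  | sub m v κ' s _ ih => simp only [splice, cnt, ih, cnt_shift_up_shift]; ring
  | der e κ' s ih => simp only [splice, cnt, ih, cnt_shift_up_shift]; ring
  | _ => rfl

end DExpr

/-! ## A labelled transition system for the good strategy -/

namespace DExpr

/-- Extension of a set of variables under a binder of kind `κ`; the new variable belongs to
the extension when `b` holds. -/
def lift (κ : VKind) (b : Prop) (F : Set Var) : Set Var :=
  {z | (z = ⟨κ, 0⟩ ∧ b) ∨ ∃ y ∈ F, z = act (shift κ) y}

@[simp] theorem zero_mem_lift {κ : VKind} {b : Prop} {F : Set Var} :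
    (⟨κ, 0⟩ : Var) ∈ lift κ b F ↔ b := by
  simp [lift]

@[simp] theorem shift_mem_lift {κ : VKind} {b : Prop} {F : Set Var} {y : Var} :
    act (shift κ) y ∈ lift κ b F ↔ y ∈ F := by
  simp [lift]

/-- A request `(x, v)` asks for the contraction, at some occurrence of the free variable `x`,
of a cut of value `v` on `x`. -/
abbrev Request := Var × DExpr .val

/-- Renaming of requests. -/
def renReq (f : Ren) (r : Request) : Request := (act f r.1, ren f r.2)

/-- `LStep F none t t'` is a non-erasing step and `LStep F (some r) t t'` answers the
request `r`. The dominating free variables of the position are not in `F`. -/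
inductive LStep : Set Var → Option Request → {τ : Cat} → DExpr τ → DExpr τ → Prop where
  | var (F : Set Var) (x : Var) (v : DExpr .val) : LStep F (some (x, v)) (.var x) v
  | subVar (F : Set Var) (m n : ℕ) (v : DExpr .val) (κ : VKind) (t : DExpr .tm) :
      LStep F (some (mv m, .var (mv n))) (.sub m v κ t) (.sub n v κ t)
  | subLam (F : Set Var) (m : ℕ) (κ' : VKind) (s : DExpr .tm) (v : DExpr .val) (κ : VKind)
      (t : DExpr .tm) :
      LStep F (some (mv m, .lam κ' s)) (.sub m v κ t)
        (.cut v κ' (splice s κ (ren (up κ (shift κ')) t)))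
  | derVar (F : Set Var) (e f : ℕ) (κ : VKind) (t : DExpr .tm) :
      LStep F (some (ev e, .var (ev f))) (.der e κ t) (.der f κ t)
  | derBang (F : Set Var) (e : ℕ) (s : DExpr .tm) (κ : VKind) (t : DExpr .tm) :
      LStep F (some (ev e, .bang s)) (.der e κ t) (splice s κ t)
  | lam {F : Set Var} {r : Option Request} (κ : VKind) {t t' : DExpr .tm} :
      LStep (lift κ False F) (r.map (renReq (shift κ))) t t' →
      LStep F r (.lam κ t) (.lam κ t')
  | bang {F : Set Var} {r : Option Request} {t t' : DExpr .tm} :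
      LStep F r t t' → LStep F r (.bang t) (.bang t')
  | val {F : Set Var} {r : Option Request} {v v' : DExpr .val} :
      LStep F r v v' → LStep F r (.val v) (.val v')
  | cut {F : Set Var} {r : Option Request} (v : DExpr .val) (κ : VKind) {t t' : DExpr .tm} :
      LStep (lift κ True F) (r.map (renReq (shift κ))) t t' →
      LStep F r (.cut v κ t) (.cut v κ t')
  | cutMul {F : Set Var} (v : DExpr .val) {t t' : DExpr .tm} :
      LStep (lift .mul True F) (some (mv 0, ren (shift .mul) v)) t t' →
      cnt (mv 0) t' = 0 → LStep F none (.cut v .mul t) (ren (pred .mul) t')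
  | cutExp {F : Set Var} (v : DExpr .val) {t t' : DExpr .tm} :
      (∀ m, cnt (mv m) v = 0) →
      LStep (lift .exp True F) (some (ev 0, ren (shift .exp) v)) t t' →
      LStep F none (.cut v .exp t) (.cut v .exp t')
  | subL {F : Set Var} {r : Option Request} (m : ℕ) {v v' : DExpr .val} (κ : VKind)
      (t : DExpr .tm) : mv m ∉ F → LStep F r v v' →
      LStep F r (.sub m v κ t) (.sub m v' κ t)
  | subR {F : Set Var} {r : Option Request} (m : ℕ) (v : DExpr .val) (κ : VKind)
      {t t' : DExpr .tm} : LStep (lift κ (mv m ∈ F) F) (r.map (renReq (shift κ))) t t' →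
      LStep F r (.sub m v κ t) (.sub m v κ t')
  | der {F : Set Var} {r : Option Request} (e : ℕ) (κ : VKind) {t t' : DExpr .tm} :
      LStep (lift κ (ev e ∈ F) F) (r.map (renReq (shift κ))) t t' →
      LStep F r (.der e κ t) (.der e κ t')

/-- The nameless non-erasing good strategy. -/
def DStep (t t' : DExpr .tm) : Prop := LStep ∅ none t t'

variable {τ : Cat}

theorem renReq_up_shift (κ : VKind) (f : Ren) (r : Option Request) :
    (r.map (renReq (shift κ))).map (renReq (up κ f)) =
      (r.map (renReq f)).map (renReq (shift κ)) := by
  cases r <;> simp [renReq, ren_up_shift]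

theorem ren_mem_lift {κ : VKind} {f : Ren} {F F' : Set Var} {t : DExpr .tm} {b b' : Prop}
    (hb : b' → b) (h : ∀ y, cnt (act (shift κ) y) t ≠ 0 → act f y ∈ F' → y ∈ F) (y : Var)
    (hy : cnt y t ≠ 0) (hF : act (up κ f) y ∈ lift κ b' F') : y ∈ lift κ b F := by
  obtain rfl | ⟨y, rfl⟩ := zero_or_shift κ y
  · simpa using hb (by simpa using hF)
  · simpa using h y hy (by simpa using hF)

/-- A step only needs equalities between variables, which survive every renaming, injective or not.
The sole obstruction is the set of forbidden variables, and it has to be controlled only on the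
variables that occur. Weakening, `pred` and shrinking of the set are all instances. -/
theorem LStep.ren {F : Set Var} {r : Option Request} {t t' : DExpr τ} (hs : LStep F r t t')
    (f : Ren) (F' : Set Var) (h : ∀ y, cnt y t ≠ 0 → act f y ∈ F' → y ∈ F) :
    LStep F' (r.map (renReq f)) (ren f t) (ren f t') := by
  induction hs generalizing f F' with
  | var F x v => exact .var _ _ _
  | subVar F m n v κ t => exact .subVar _ _ _ _ _ _
  | subLam F m κ' s v κ t =>
    simp only [DExpr.ren, ren_splice, ren_up_up_shift]
    exact .subLam _ _ _ _ _ _ _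
  | derVar F e g κ t => exact .derVar _ _ _ _ _
  | derBang F e s κ t =>
    rw [ren_splice]
    exact .derBang _ _ _ _ _
  | lam κ _ ih =>
    refine .lam κ ?_
    rw [← renReq_up_shift]
    exact ih _ _ (ren_mem_lift id h)
  | bang _ ih => exact .bang (ih _ _ h)
  | val _ ih => exact .val (ih _ _ h)
  | cut v κ _ ih =>
    refine .cut _ κ ?_
    rw [← renReq_up_shift]
    exact ih _ _ (ren_mem_lift id fun y hy => h y (by simp [cnt, hy]))
  | @cutMul F v t t' _ h0 ih =>
    -- Lowering the indices commutes with the renaming because index 0 is absent from `t'`.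
    have e : DExpr.ren f (DExpr.ren (pred .mul) t') =
        DExpr.ren (pred .mul) (DExpr.ren (up .mul f) t') := by
      rw [← ren_shift_pred h0, ren_pred_shift, ren_up_shift, ren_pred_shift]
    rw [e]
    refine .cutMul _ ?_ (by simpa using h0)
    have := ih (up .mul f) (lift .mul True F')
      (ren_mem_lift id fun y hy => h y (by simp [cnt, hy]))
    rw [Option.map_some, renReq, act_up_zero, ren_up_shift] at this
    exact this
  | @cutExp F v t t' hv _ ih =>
    refine .cutExp _ (fun m => ?_) ?_
    · by_contra hm
      obtain ⟨⟨k, y⟩, hy, hz⟩ := exists_of_cnt_ren v hm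
      obtain rfl : k = .mul := congrArg Var.kind hz
      exact hy (hv y)
    · have := ih (up .exp f) (lift .exp True F')
        (ren_mem_lift id fun y hy => h y (by simp [cnt, hy]))
      rw [Option.map_some, renReq, act_up_zero, ren_up_shift] at this
      exact this
  | subL m κ t hm _ ih =>
    exact .subL _ _ _ (fun hF => hm (h (mv m) (by simp [cnt]) hF))
      (ih _ _ fun y hy => h y (by simp [cnt, hy]))
  | subR m v κ _ ih =>
    refine .subR _ _ κ ?_
    rw [← renReq_up_shift]
    exact ih _ _ (ren_mem_lift (fun hF => h (mv m) (by simp [cnt]) hF)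
      fun y hy => h y (by simp [cnt, hy]))
  | der e κ _ ih =>
    refine .der _ κ ?_
    rw [← renReq_up_shift]
    exact ih _ _ (ren_mem_lift (fun hF => h (ev e) (by simp [cnt]) hF)
      fun y hy => h y (by simp [cnt, hy]))

theorem LStep.mono {F F' : Set Var} {r : Option Request} {t t' : DExpr τ}
    (hs : LStep F r t t') (h : F' ⊆ F) : LStep F' r t t' := by
  have e : ∀ {σ : Cat} (s : DExpr σ), DExpr.ren (fun _ n => n) s = s :=
    fun s => ren_id s fun _ _ => rfl
  have := hs.ren (fun _ n => n) F' fun y _ hy => h hy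
  rw [e, e] at this
  rcases r with _ | ⟨x, v⟩
  · exact this
  · rw [Option.map_some, renReq, e] at this
    exact this

theorem lift_mono (κ : VKind) {b b' : Prop} (F : Set Var) (h : b' → b) :
    lift κ b' F ⊆ lift κ b F := by
  rintro z (⟨rfl, hb⟩ | hz)
  · exact .inl ⟨rfl, h hb⟩
  · exact .inr hz

theorem lift_true_mem {κ : VKind} {F F' : Set Var} {f : Ren}
    (h : ∀ y, act f y ∈ F' → y ∈ F) (b : Prop) (y : Var) :
    act (up κ f) y ∈ lift κ b F' → y ∈ lift κ b F := by
  obtain rfl | ⟨y, rfl⟩ := zero_or_shift κ y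
  · simp
  · simpa using h y

/-- A contraction puts `t` under the left context of the cut value, and the path to `t` only goes
through bodies of that left context, never through values. The variable of the new cut must be
forbidden, hence the set `lift κ True F` in the hypothesis. -/
theorem LStep.splice {κ : VKind} {F : Set Var} {r : Option Request} {t t' : DExpr .tm}
    (s : DExpr τ) (h : LStep (lift κ True F) (r.map (renReq (shift κ))) t t') :
    LStep F r (splice s κ t) (splice s κ t') := by
  -- Whether the binder crossed is forbidden does not matter, since the weakened `t` does not
  -- mention it.
  have key : ∀ (κ' : VKind) (b : Prop) {F : Set Var} {r : Option Request} {t t' : DExpr .tm},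
      LStep (lift κ True F) (r.map (renReq (shift κ))) t t' →
      LStep (lift κ True (lift κ' b F))
        ((r.map (renReq (shift κ'))).map (renReq (shift κ)))
        (DExpr.ren (up κ (shift κ')) t) (DExpr.ren (up κ (shift κ')) t') := by
    intro κ' b F r t t' h
    have := h.ren (up κ (shift κ')) (lift κ True (lift κ' b F))
      fun y _ => lift_true_mem (fun z hz => by simpa using hz) True y
    rwa [renReq_up_shift] at this
  induction s generalizing F r t t' with
  | cut v κ' s _ ih => exact .cut _ _ (ih (key κ' _ h))
  | sub m v κ' s _ ih => exact .subR _ _ _ (ih (key κ' _ h))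
  | der e κ' s ih => exact .der _ _ (ih (key κ' _ h))
  | _ => exact .cut _ _ h

/-- Answering a request uses up an occurrence of the requested variable. This rules out a second
answer to a linear request in the diamond, and shows that a linear variable does not occur beside
the path to the redex. -/
theorem LStep.cnt_request {F : Set Var} {r : Option Request} {t t' : DExpr τ}
    (hs : LStep F r t t') : ∀ x v, r = some (x, v) → cnt x t ≠ 0 := by
  induction hs with
  | var F x v => rintro _ _ ⟨⟩; simp [cnt]
  | subVar F m n v κ t => rintro _ _ ⟨⟩; simp [cnt]
  | subLam F m κ' s v κ t => rintro _ _ ⟨⟩; simp [cnt]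
  | derVar F e g κ t => rintro _ _ ⟨⟩; simp [cnt]
  | derBang F e s κ t => rintro _ _ ⟨⟩; simp [cnt]
  | cutMul => rintro _ _ ⟨⟩
  | cutExp => rintro _ _ ⟨⟩
  | bang _ ih => exact ih
  | val _ ih => exact ih
  | lam κ _ ih =>
    rintro x v rfl
    exact ih _ _ rfl
  | subL m κ t hm _ ih =>
    rintro x v rfl
    have := ih _ _ rfl
    simp only [cnt]; omega
  | _ =>
    rename_i ih
    rintro x v rfl
    have := ih _ _ rfl
    simp only [cnt] at this ⊢; omega

/-- Variables that do not occur do not show up. -/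
theorem LStep.cnt_eq_zero {F : Set Var} {r : Option Request} {t t' : DExpr τ}
    (hs : LStep F r t t') (z : Var) (hr : ∀ q ∈ r, cnt z q.2 = 0) (ht : cnt z t = 0) :
    cnt z t' = 0 := by
  have key : ∀ {κ : VKind} {r : Option Request} {z : Var}, (∀ q ∈ r, cnt z q.2 = 0) →
      ∀ q ∈ r.map (renReq (shift κ)), cnt (act (shift κ) z) q.2 = 0 := by
    intro κ r z h q hq
    rcases r with _ | r
    · simp at hq
    · obtain rfl : renReq (shift κ) r = q := by simpa using hq
      simpa [renReq] using h r rfl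
  induction hs generalizing z with
  | var F x v => exact hr _ rfl
  | subVar F m n v κ t => have := hr _ rfl; simp_all [cnt]
  | subLam F m κ' s v κ t =>
    have := hr _ rfl
    simp_all [cnt, cnt_splice]
  | derVar F e g κ t => have := hr _ rfl; simp_all [cnt]
  | derBang F e s κ t => have := hr _ rfl; simp_all [cnt, cnt_splice]
  | lam κ _ ih => exact ih _ (key hr) ht
  | bang _ ih => exact ih _ hr ht
  | val _ ih => exact ih _ hr ht
  | cut v κ _ ih =>
    simp only [cnt, Nat.add_eq_zero_iff] at ht ⊢
    exact ⟨ht.1, ih _ (key hr) ht.2⟩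
  | cutMul v _ h0 ih =>
    simp only [cnt, Nat.add_eq_zero_iff] at ht ⊢
    rw [cnt_pred h0]
    exact ih _ (by simpa using ht.1) ht.2
  | cutExp v _ _ ih =>
    simp only [cnt, Nat.add_eq_zero_iff] at ht ⊢
    exact ⟨ht.1, ih _ (by simpa using ht.1) ht.2⟩
  | subL m κ t hm _ ih =>
    simp only [cnt, Nat.add_eq_zero_iff] at ht ⊢
    exact ⟨⟨ht.1.1, ih _ hr ht.1.2⟩, ht.2⟩
  | subR m v κ _ ih =>
    simp only [cnt, Nat.add_eq_zero_iff] at ht ⊢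
    exact ⟨ht.1, ih _ (key hr) ht.2⟩
  | der e κ _ ih =>
    simp only [cnt, Nat.add_eq_zero_iff] at ht ⊢
    exact ⟨ht.1, ih _ (key hr) ht.2⟩

/-- Two labels may act on the same expression: requests concern variables of `F`, and they
agree on the value to use for a given variable. -/
def Compat (F : Set Var) (r₁ r₂ : Option Request) : Prop :=
  (∀ q ∈ r₁, q.1 ∈ F) ∧ (∀ q ∈ r₂, q.1 ∈ F) ∧ ∀ q₁ ∈ r₁, ∀ q₂ ∈ r₂, q₁.1 = q₂.1 → q₁.2 = q₂.2

theorem Compat.lift {F : Set Var} {r₁ r₂ : Option Request} (h : Compat F r₁ r₂) (κ : VKind)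
    (b : Prop) :
    Compat (lift κ b F) (r₁.map (renReq (shift κ))) (r₂.map (renReq (shift κ))) := by
  obtain ⟨h1, h2, h3⟩ := h
  refine ⟨?_, ?_, ?_⟩
  · rintro q hq
    obtain ⟨q, hq', rfl⟩ := Option.mem_map.1 hq
    simpa [renReq] using h1 q hq'
  · rintro q hq
    obtain ⟨q, hq', rfl⟩ := Option.mem_map.1 hq
    simpa [renReq] using h2 q hq'
  · rintro q₁ hq₁ q₂ hq₂
    obtain ⟨q₁, hq₁', rfl⟩ := Option.mem_map.1 hq₁
    obtain ⟨q₂, hq₂', rfl⟩ := Option.mem_map.1 hq₂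
    intro e
    simp only [renReq, shift_inj] at e ⊢
    rw [h3 _ hq₁' _ hq₂' e]

/-- An outer request reaches the body weakened, so it never concerns the variable of the cut and the
agreement condition is vacuous. -/
theorem Compat.cut {F : Set Var} {r : Option Request} (h : ∀ q ∈ r, q.1 ∈ F) (κ : VKind)
    (v : DExpr .val) :
    Compat (DExpr.lift κ True F) (r.map (renReq (shift κ))) (some (⟨κ, 0⟩, v)) := by
  refine ⟨?_, ?_, ?_⟩
  · rintro q hq
    obtain ⟨q, hq', rfl⟩ := Option.mem_map.1 hq
    simpa [renReq] using h q hq'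
  · rintro q ⟨⟩
    simp
  · rintro q₁ hq₁ q₂ ⟨⟩ e
    obtain ⟨q₁, hq₁', rfl⟩ := Option.mem_map.1 hq₁
    simp [renReq] at e

theorem Compat.refl {F : Set Var} {x : Var} (h : x ∈ F) (v : DExpr .val) :
    Compat F (some (x, v)) (some (x, v)) := by
  refine ⟨?_, ?_, ?_⟩
  · rintro q ⟨⟩; exact h
  · rintro q ⟨⟩; exact h
  · rintro q ⟨⟩ q' ⟨⟩ _; rfl

/-- The conclusion of the diamond property. -/
def Joins (F : Set Var) (r₁ r₂ : Option Request) (t₁ t₂ : DExpr τ) : Prop :=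
  (r₁ = r₂ ∧ t₁ = t₂) ∨ ∃ t₃, LStep F r₂ t₁ t₃ ∧ LStep F r₁ t₂ t₃

theorem Joins.symm {F : Set Var} {r₁ r₂ : Option Request} {t₁ t₂ : DExpr τ}
    (h : Joins F r₁ r₂ t₁ t₂) : Joins F r₂ r₁ t₂ t₁ := by
  rcases h with ⟨h, h'⟩ | ⟨t₃, h, h'⟩
  · exact .inl ⟨h.symm, h'.symm⟩
  · exact .inr ⟨t₃, h', h⟩

theorem map_renReq_shift_inj {κ : VKind} {r₁ r₂ : Option Request}
    (h : r₁.map (renReq (shift κ)) = r₂.map (renReq (shift κ))) : r₁ = r₂ := by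
  refine Option.map_injective (fun q q' e => ?_) h
  simp only [renReq, Prod.mk.injEq, shift_inj] at e
  refine Prod.ext e.1 ?_
  rw [← ren_pred_shift κ q.2, e.2, ren_pred_shift]

theorem Joins.congr {σ : Cat} {F F' : Set Var} {r₁ r₂ r₁' r₂' : Option Request}
    {t₁ t₂ : DExpr σ} (h : Joins F' r₁' r₂' t₁ t₂) (f : DExpr σ → DExpr τ)
    (hr : r₁' = r₂' → r₁ = r₂) (h₁ : ∀ {s s'}, LStep F' r₁' s s' → LStep F r₁ (f s) (f s'))
    (h₂ : ∀ {s s'}, LStep F' r₂' s s' → LStep F r₂ (f s) (f s')) :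
    Joins F r₁ r₂ (f t₁) (f t₂) := by
  rcases h with ⟨h, rfl⟩ | ⟨t₃, h, h'⟩
  · exact .inl ⟨hr h, rfl⟩
  · exact .inr ⟨f t₃, h₂ h, h₁ h'⟩

/-- An outer step and the consumption of a multiplicative cut commute: the outer request carries a
weakened value, so it cannot bring back the consumed variable, and the outer step can be lowered to
the term without the cut. -/
theorem Joins.cutMul {F : Set Var} {r : Option Request} {v : DExpr .val} {t₁ t₂ : DExpr .tm}
    (h : Joins (lift .mul True F) (r.map (renReq (shift .mul)))
      (some (mv 0, DExpr.ren (shift .mul) v)) t₁ t₂) (h0 : cnt (mv 0) t₂ = 0) :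
    Joins F r none (.cut v .mul t₁) (DExpr.ren (pred .mul) t₂) := by
  rcases h with ⟨h, -⟩ | ⟨t₃, h, h'⟩
  · rcases r with _ | r
    · simp at h
    · simp [renReq] at h
  · have h3 : cnt (mv 0) t₃ = 0 := by
      refine h'.cnt_eq_zero _ (fun q hq => ?_) h0
      obtain ⟨q, hq', rfl⟩ := Option.mem_map.1 hq
      exact cnt_zero_shift _ _
    refine .inr ⟨_, .cutMul v h h3, ?_⟩
    have := h'.ren (pred .mul) F fun y hy hF => by
      obtain rfl | ⟨y, rfl⟩ := zero_or_shift .mul y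
      · exact absurd h0 hy
      · simpa using hF
    have e : (r.map (renReq (shift .mul))).map (renReq (pred .mul)) = r := by
      rcases r with _ | r
      · rfl
      · simp [renReq, ren_pred_shift]
    rwa [e] at this

theorem Joins.cutExp {F : Set Var} {r : Option Request} {v : DExpr .val} {t₁ t₂ : DExpr .tm}
    (hv : ∀ m, cnt (mv m) v = 0)
    (h : Joins (lift .exp True F) (r.map (renReq (shift .exp)))
      (some (ev 0, DExpr.ren (shift .exp) v)) t₁ t₂) :
    Joins F r none (.cut v .exp t₁) (.cut v .exp t₂) := by
  rcases h with ⟨h, -⟩ | ⟨t₃, h, h'⟩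
  · rcases r with _ | r
    · simp at h
    · simp [renReq] at h
  · exact .inr ⟨_, .cutExp v hv h, .cut v _ h'⟩

/-- Requests concern forbidden variables, so the bound variable of the subtraction is already
forbidden in the body. Changing `m` into `n` can only shrink the set, and `LStep.mono` applies. -/
theorem Joins.subVar_subR {F : Set Var} {r : Option Request} {m n : ℕ} (v : DExpr .val)
    {κ : VKind} {t t' : DExpr .tm} (hm : mv m ∈ F)
    (h : LStep (lift κ (mv m ∈ F) F) (r.map (renReq (shift κ))) t t') :
    Joins F (some (mv m, .var (mv n))) r (.sub n v κ t) (.sub m v κ t') :=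
  .inr ⟨_, .subR _ _ _ (h.mono (lift_mono _ _ fun _ => hm)), .subVar _ _ _ _ _ _⟩

/-- The bound variable of the subtraction becomes the variable of a cut. As `m` is forbidden, that
variable was forbidden beforehand, so the step in the body stays good after the contraction. -/
theorem Joins.subLam_subR {F : Set Var} {r : Option Request} {m : ℕ} {κ' : VKind}
    {s : DExpr .tm} (v : DExpr .val) {κ : VKind} {t t' : DExpr .tm} (hm : mv m ∈ F)
    (h : LStep (lift κ (mv m ∈ F) F) (r.map (renReq (shift κ))) t t') :
    Joins F (some (mv m, .lam κ' s)) r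
      (.cut v κ' (DExpr.splice s κ (DExpr.ren (up κ (shift κ')) t))) (.sub m v κ t') := by
  refine .inr ⟨_, .cut _ _ (LStep.splice s ?_), .subLam _ _ _ _ _ _ _⟩
  have := h.ren (up κ (shift κ')) (DExpr.lift κ True (DExpr.lift κ' True F)) fun y _ hy =>
    lift_mono κ F (fun _ => hm) (lift_true_mem (fun z hz => by simpa using hz) True y hy)
  rwa [renReq_up_shift] at this

theorem Joins.derVar_der {F : Set Var} {r : Option Request} {e f : ℕ}
    {κ : VKind} {t t' : DExpr .tm} (he : ev e ∈ F)
    (h : LStep (lift κ (ev e ∈ F) F) (r.map (renReq (shift κ))) t t') :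
    Joins F (some (ev e, .var (ev f))) r (.der f κ t) (.der e κ t') :=
  .inr ⟨_, .der _ _ (h.mono (lift_mono _ _ fun _ => he)), .derVar _ _ _ _ _⟩

theorem Joins.derBang_der {F : Set Var} {r : Option Request} {e : ℕ} {s : DExpr .tm}
    {κ : VKind} {t t' : DExpr .tm} (he : ev e ∈ F)
    (h : LStep (lift κ (ev e ∈ F) F) (r.map (renReq (shift κ))) t t') :
    Joins F (some (ev e, .bang s)) r (DExpr.splice s κ t) (.der e κ t') :=
  .inr ⟨_, LStep.splice s (h.mono (lift_mono _ _ fun _ => he)), .derBang _ _ _ _ _⟩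

/-- The diamond property. -/
theorem LStep.diamond {F : Set Var} {r₁ r₂ : Option Request} {t t₁ t₂ : DExpr τ}
    (h₁ : LStep F r₁ t t₁) (h₂ : LStep F r₂ t t₂) (hc : Compat F r₁ r₂) :
    Joins F r₁ r₂ t₁ t₂ := by
  induction t generalizing F r₁ r₂ with
  | var x =>
    cases h₁; cases h₂
    have := hc.2.2 _ rfl _ rfl rfl
    simp only at this
    subst this
    exact .inl ⟨rfl, rfl⟩
  | lam κ t ih =>
    cases h₁ with | lam _ h₁ =>
    cases h₂ with | lam _ h₂ =>
    exact (ih h₁ h₂ (hc.lift _ _)).congr _ map_renReq_shift_inj (.lam κ) (.lam κ)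
  | bang t ih =>
    cases h₁ with | bang h₁ =>
    cases h₂ with | bang h₂ =>
    exact (ih h₁ h₂ hc).congr _ id .bang .bang
  | val t ih =>
    cases h₁ with | val h₁ =>
    cases h₂ with | val h₂ =>
    exact (ih h₁ h₂ hc).congr _ id .val .val
  | cut v κ t _ ih =>
    cases h₁ with
    | cut _ _ h₁ =>
      cases h₂ with
      | cut _ _ h₂ =>
        exact (ih h₁ h₂ (hc.lift _ _)).congr _ map_renReq_shift_inj (.cut v κ) (.cut v κ)
      | cutMul _ h₂ h0 => exact (ih h₁ h₂ (Compat.cut hc.1 _ _)).cutMul h0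
      | cutExp _ hv h₂ => exact (ih h₁ h₂ (Compat.cut hc.1 _ _)).cutExp hv
    | cutMul _ h₁ h0 =>
      cases h₂ with
      | cut _ _ h₂ => exact ((ih h₂ h₁ (Compat.cut hc.2.1 _ _)).cutMul h0).symm
      | cutMul _ h₂ h0' =>
        -- Answers at different occurrences would leave, in `t₁`, an occurrence for the other step
        -- to consume; but the cut has been removed because none is left.
        rcases ih h₁ h₂ (Compat.refl (by simp) _) with ⟨-, rfl⟩ | ⟨t₃, h, -⟩
        · exact .inl ⟨rfl, rfl⟩
        · exact absurd h0 (h.cnt_request _ _ rfl)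
    | cutExp _ hv h₁ =>
      cases h₂ with
      | cut _ _ h₂ => exact ((ih h₂ h₁ (Compat.cut hc.2.1 _ _)).cutExp hv).symm
      | cutExp _ _ h₂ =>
        exact (ih h₁ h₂ (Compat.refl (by simp) _)).congr _ (fun _ => rfl) (.cutExp v hv)
          (.cutExp v hv)
  | sub m v κ t ihv iht =>
    cases h₁ with
    | subVar =>
      cases h₂ with
      | subVar => cases hc.2.2 _ rfl _ rfl rfl; exact .inl ⟨rfl, rfl⟩
      | subLam => cases hc.2.2 _ rfl _ rfl rfl
      -- The requested variable is forbidden, whereas a step in the argument of a subtraction on it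
      -- needs it not to be. This is where goodness excludes a redex inside a future cut value.
      | subL _ _ _ hm => exact absurd (hc.1 _ rfl) hm
      | subR _ _ _ h₂ => exact .subVar_subR v (hc.1 _ rfl) h₂
    | subLam =>
      cases h₂ with
      | subVar => cases hc.2.2 _ rfl _ rfl rfl
      | subLam => cases hc.2.2 _ rfl _ rfl rfl; exact .inl ⟨rfl, rfl⟩
      | subL _ _ _ hm => exact absurd (hc.1 _ rfl) hm
      | subR _ _ _ h₂ => exact .subLam_subR v (hc.1 _ rfl) h₂
    | subL _ _ _ hm h₁ =>
      cases h₂ with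
      | subVar => exact absurd (hc.2.1 _ rfl) hm
      | subLam => exact absurd (hc.2.1 _ rfl) hm
      | subL _ _ _ _ h₂ =>
        exact (ihv h₁ h₂ hc).congr (fun v => DExpr.sub m v κ t) id (.subL m κ t hm)
          (.subL m κ t hm)
      | subR _ _ _ h₂ => exact .inr ⟨_, .subR _ _ _ h₂, .subL _ _ _ hm h₁⟩
    | subR _ _ _ h₁ =>
      cases h₂ with
      | subVar => exact (Joins.subVar_subR v (hc.2.1 _ rfl) h₁).symm
      | subLam => exact (Joins.subLam_subR v (hc.2.1 _ rfl) h₁).symm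
      | subL _ _ _ hm h₂ => exact .inr ⟨_, .subL _ _ _ hm h₂, .subR _ _ _ h₁⟩
      | subR _ _ _ h₂ =>
        exact (iht h₁ h₂ (hc.lift _ _)).congr _ map_renReq_shift_inj (.subR m v κ)
          (.subR m v κ)
  | der e κ t ih =>
    cases h₁ with
    | derVar =>
      cases h₂ with
      | derVar => cases hc.2.2 _ rfl _ rfl rfl; exact .inl ⟨rfl, rfl⟩
      | derBang => cases hc.2.2 _ rfl _ rfl rfl
      | der _ _ h₂ => exact .derVar_der (hc.1 _ rfl) h₂
    | derBang =>
      cases h₂ with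
      | derVar => cases hc.2.2 _ rfl _ rfl rfl
      | derBang => cases hc.2.2 _ rfl _ rfl rfl; exact .inl ⟨rfl, rfl⟩
      | der _ _ h₂ => exact .derBang_der (hc.1 _ rfl) h₂
    | der _ _ h₁ =>
      cases h₂ with
      | derVar => exact (Joins.derVar_der (hc.2.1 _ rfl) h₁).symm
      | derBang => exact (Joins.derBang_der (hc.2.1 _ rfl) h₁).symm
      | der _ _ h₂ =>
        exact (ih h₁ h₂ (hc.lift _ _)).congr _ map_renReq_shift_inj (.der e κ) (.der e κ)

theorem DStep.diamond {t t₁ t₂ : DExpr .tm} (h₁ : DStep t t₁) (h₂ : DStep t t₂) :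
    t₁ = t₂ ∨ ∃ t₃, DStep t₁ t₃ ∧ DStep t₂ t₃ := by
  have hc : Compat ∅ none none := by simp [Compat]
  exact (LStep.diamond h₁ h₂ hc).imp_left And.right

end DExpr

/-! ## Random descent -/

section RandomDescent

variable {α : Type} {R : α → α → Prop}

/-- The diamond slides the first step along the given evaluation until it coincides with one of its
steps. This must happen, since a normal end point admits no further step, and it saves exactly one
step. -/
theorem Evaluation.of_diamond
    (hd : ∀ a b c, R a b → R a c → b = c ∨ ∃ d, R b d ∧ R c d) {k : ℕ} {a b n : α}
    (h : Evaluation R k a n) (hn : Normal R n) (hab : R a b) :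
    ∃ k', k = k' + 1 ∧ Evaluation R k' b n := by
  induction k generalizing a b with
  | zero => obtain rfl : a = n := h; exact absurd hab (hn b)
  | succ k ih =>
    obtain ⟨u, hu, h⟩ := h
    refine ⟨k, rfl, ?_⟩
    rcases hd a b u hab hu with rfl | ⟨d, hbd, hud⟩
    · exact h
    · obtain ⟨k', rfl, h'⟩ := ih h hud
      exact ⟨d, hbd, h'⟩

theorem Evaluation.not_diverges
    (hd : ∀ a b c, R a b → R a c → b = c ∨ ∃ d, R b d ∧ R c d) {k : ℕ} {a n : α}
    (h : Evaluation R k a n) (hn : Normal R n) : ¬ Diverges R a := by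
  induction k generalizing a with
  | zero =>
    obtain rfl : a = n := h
    rintro ⟨f, rfl, hf⟩
    exact hn _ (hf 0)
  | succ k ih =>
    rintro ⟨f, rfl, hf⟩
    obtain ⟨k', hk, h'⟩ := h.of_diamond hd hn (hf 0)
    obtain rfl : k = k' := by omega
    exact ih h' ⟨fun i => f (i + 1), rfl, fun i => hf (i + 1)⟩

end RandomDescent

namespace DExpr

/-! ## Linearity -/

/-- Linear expressions: multiplicative binders bind exactly one occurrence, and promotions
have no free multiplicative variables. -/
def Lin : {τ : Cat} → DExpr τ → Prop
  | _, .var _ => True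
  | _, .lam κ t => Lin t ∧ (κ = .mul → cnt ⟨κ, 0⟩ t = 1)
  | _, .bang t => Lin t ∧ ∀ m, cnt (mv m) t = 0
  | _, .val v => Lin v
  | _, .cut v κ t => Lin v ∧ Lin t ∧ (κ = .mul → cnt ⟨κ, 0⟩ t = 1)
  | _, .sub _ v κ t => Lin v ∧ Lin t ∧ (κ = .mul → cnt ⟨κ, 0⟩ t = 1)
  | _, .der _ κ t => Lin t ∧ (κ = .mul → cnt ⟨κ, 0⟩ t = 1)

variable {τ : Cat}

theorem cnt_mv_ren {t : DExpr τ} (h : ∀ m, cnt (mv m) t = 0) (f : Ren) (m : ℕ) :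
    cnt (mv m) (ren f t) = 0 := by
  by_contra hm
  obtain ⟨⟨k, y⟩, hy, hz⟩ := exists_of_cnt_ren t hm
  obtain rfl : k = .mul := congrArg Var.kind hz
  exact hy (h y)

theorem Lin.ren {t : DExpr τ} (h : Lin t) (f : Ren) : Lin (ren f t) := by
  induction t generalizing f with
  | var x => trivial
  | lam κ t ih => exact ⟨ih h.1 _, by simpa using h.2⟩
  | bang t ih => exact ⟨ih h.1 _, cnt_mv_ren h.2 f⟩
  | val v ih => exact ih h f
  | cut v κ t ihv iht => exact ⟨ihv h.1 _, iht h.2.1 _, by simpa using h.2.2⟩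
  | sub m v κ t ihv iht => exact ⟨ihv h.1 _, iht h.2.1 _, by simpa using h.2.2⟩
  | der e κ t ih => exact ⟨ih h.1 _, by simpa using h.2⟩

theorem cnt_zero_splice (s : DExpr τ) (κ κ' : VKind) (t : DExpr .tm) :
    cnt ⟨κ', 0⟩ (splice s κ (DExpr.ren (up κ (shift κ')) t)) = cnt ⟨κ', 0⟩ s := by
  rw [cnt_splice, Nat.add_eq_left]
  by_contra h
  obtain ⟨y, -, hy⟩ := exists_of_cnt_ren t h
  obtain rfl | ⟨y, rfl⟩ := zero_or_shift κ y <;> simp at hy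

theorem Lin.splice {s : DExpr τ} (hs : Lin s) {κ : VKind} {t : DExpr .tm} (ht : Lin t)
    (hκ : κ = .mul → cnt ⟨κ, 0⟩ t = 1) : Lin (splice s κ t) := by
  induction s generalizing t with
  | cut v κ' s _ ih =>
    exact ⟨hs.1, ih hs.2.1 (ht.ren _) (by simpa using hκ),
      by simpa [cnt_zero_splice] using hs.2.2⟩
  | sub m v κ' s _ ih =>
    exact ⟨hs.1, ih hs.2.1 (ht.ren _) (by simpa using hκ),
      by simpa [cnt_zero_splice] using hs.2.2⟩
  | der e κ' s ih =>
    exact ⟨ih hs.1 (ht.ren _) (by simpa using hκ), by simpa [cnt_zero_splice] using hs.2⟩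
  | _ => exact ⟨hs, ht, hκ⟩

/-- Requests of linear values that have no multiplicative variables if they concern
exponential variables. -/
def LinReq (r : Option Request) : Prop :=
  ∀ q ∈ r, Lin q.2 ∧ (q.1.kind = .exp → ∀ m, cnt (mv m) q.2 = 0)

/-- The occurrences that disappear when a request is answered. -/
def consumed (z : Var) : Option Request → ℕ
  | none => 0
  | some q => if q.1 = z then 1 else 0

/-- The occurrences that show up when a request is answered. -/
def supplied (z : Var) : Option Request → ℕ
  | none => 0
  | some q => cnt z q.2

theorem LinReq.shift {r : Option Request} (h : LinReq r) (κ : VKind) :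
    LinReq (r.map (renReq (shift κ))) := by
  intro q hq
  obtain ⟨q, hq', rfl⟩ := Option.mem_map.1 hq
  exact ⟨(h q hq').1.ren _, fun hk => cnt_mv_ren ((h q hq').2 hk) _⟩

@[simp] theorem consumed_shift (κ : VKind) (z : Var) (r : Option Request) :
    consumed (act (shift κ) z) (r.map (renReq (shift κ))) = consumed z r := by
  rcases r with _ | q <;> simp [consumed, renReq]

@[simp] theorem consumed_zero_shift (κ : VKind) (r : Option Request) :
    consumed ⟨κ, 0⟩ (r.map (renReq (shift κ))) = 0 := by
  rcases r with _ | q <;> simp [consumed, renReq]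

@[simp] theorem supplied_shift (κ : VKind) (z : Var) (r : Option Request) :
    supplied (act (shift κ) z) (r.map (renReq (shift κ))) = supplied z r := by
  rcases r with _ | q <;> simp [supplied, renReq]

@[simp] theorem supplied_zero_shift (κ : VKind) (r : Option Request) :
    supplied ⟨κ, 0⟩ (r.map (renReq (shift κ))) = 0 := by
  rcases r with _ | q <;> simp [supplied, renReq]

/-- Steps preserve linearity, and the number of free occurrences of multiplicative
variables up to what the request adds and removes. -/
theorem LStep.lin {F : Set Var} {r : Option Request} {t t' : DExpr τ} (hs : LStep F r t t')
    (ht : Lin t) (hr : LinReq r) :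
    Lin t' ∧ ∀ z : Var, z.kind = .mul →
      cnt z t' + consumed z r = cnt z t + supplied z r := by
  induction hs with
  | var F x v => exact ⟨(hr _ rfl).1, fun z _ => by simp [cnt, consumed, supplied, add_comm]⟩
  | subVar F m n v κ t =>
    exact ⟨ht, fun z _ => by simp only [cnt, consumed, supplied]; ring⟩
  | subLam F m κ' s v κ t =>
    have hl := (hr _ rfl).1
    refine ⟨⟨ht.1, Lin.splice hl.1 (ht.2.1.ren _) (by simpa using ht.2.2), fun hk => ?_⟩,
      fun z _ => ?_⟩
    · rw [cnt_zero_splice]; exact hl.2 hk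
    · simp only [cnt, consumed, supplied, cnt_splice, cnt_shift_up_shift]; ring
  | derVar F e g κ t =>
    exact ⟨ht, fun z _ => by simp only [cnt, consumed, supplied]; ring⟩
  | derBang F e s κ t =>
    have hl := (hr _ rfl).1
    exact ⟨Lin.splice hl.1 ht.1 ht.2,
      fun z _ => by simp only [cnt, consumed, supplied, cnt_splice]; ring⟩
  | lam κ _ ih =>
    obtain ⟨hl, hc⟩ := ih ht.1 (hr.shift _)
    refine ⟨⟨hl, ?_⟩, fun z hz => by simpa [cnt] using hc (act (shift κ) z) hz⟩
    rintro rfl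
    simpa [ht.2] using hc ⟨.mul, 0⟩ rfl
  | @bang F r t t' hs ih =>
    obtain ⟨hl, hc⟩ := ih ht.1 hr
    refine ⟨⟨hl, fun m => ?_⟩, hc⟩
    have h := hc (mv m) rfl
    rw [ht.2] at h
    -- A request answered inside a promotion cannot concern a multiplicative variable, as none
    -- occurs there. It concerns an exponential one, and then its value has no multiplicative
    -- variables either.
    rcases r with _ | ⟨⟨κ, x⟩, v⟩
    · simpa [supplied, consumed] using h
    · have hx := hs.cnt_request _ _ rfl
      cases κ
      · exact absurd (ht.2 x) hx
      · have := (hr _ rfl).2 rfl m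
        simp only [supplied] at this h
        omega
  | val _ ih => exact ih ht hr
  | cut v κ _ ih =>
    obtain ⟨hl, hc⟩ := ih ht.2.1 (hr.shift _)
    refine ⟨⟨ht.1, hl, ?_⟩, fun z hz => ?_⟩
    · rintro rfl
      simpa [ht.2.2] using hc ⟨.mul, 0⟩ rfl
    · have := hc (act (shift κ) z) hz
      simp only [consumed_shift, supplied_shift] at this
      simp only [cnt]; omega
  | cutMul v _ h0 ih =>
    obtain ⟨hl, hc⟩ := ih ht.2.1 (by rintro q ⟨⟩; exact ⟨ht.1.ren _, by simp⟩)
    refine ⟨hl.ren _, fun z hz => ?_⟩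
    have := hc (act (shift .mul) z) hz
    simp only [consumed, supplied, zero_ne_shift, if_false, cnt_shift] at this
    rw [cnt_pred h0]
    simp only [consumed, supplied, cnt]; omega
  | cutExp v hv _ ih =>
    obtain ⟨hl, hc⟩ := ih ht.2.1 (by rintro q ⟨⟩; exact ⟨ht.1.ren _, fun _ => cnt_mv_ren hv _⟩)
    refine ⟨⟨ht.1, hl, by simp⟩, fun z hz => ?_⟩
    have := hc (act (shift .exp) z) hz
    obtain ⟨k, m⟩ := z
    obtain rfl : k = .mul := hz
    simp only [consumed, supplied, zero_ne_shift, if_false, cnt_shift, hv m] at this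
    simp only [consumed, supplied, cnt, hv m]; omega
  | subL m κ t hm _ ih =>
    obtain ⟨hl, hc⟩ := ih ht.1 hr
    refine ⟨⟨hl, ht.2⟩, fun z hz => ?_⟩
    have := hc z hz
    simp only [cnt]; omega
  | subR m v κ _ ih =>
    obtain ⟨hl, hc⟩ := ih ht.2.1 (hr.shift _)
    refine ⟨⟨ht.1, hl, ?_⟩, fun z hz => ?_⟩
    · rintro rfl
      simpa [ht.2.2] using hc ⟨.mul, 0⟩ rfl
    · have := hc (act (shift κ) z) hz
      simp only [consumed_shift, supplied_shift] at this
      simp only [cnt]; omega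
  | der e κ _ ih =>
    obtain ⟨hl, hc⟩ := ih ht.1 (hr.shift _)
    refine ⟨⟨hl, ?_⟩, fun z hz => ?_⟩
    · rintro rfl
      simpa [ht.2] using hc ⟨.mul, 0⟩ rfl
    · have := hc (act (shift κ) z) hz
      simp only [consumed_shift, supplied_shift] at this
      simp only [cnt]; omega

theorem DStep.lin {t t' : DExpr .tm} (h : DStep t t') (ht : Lin t) : Lin t' :=
  (LStep.lin h ht (by rintro q ⟨⟩)).1

/-! ## Normality -/

/-- The occurrences outside the left sub-terms of cuts are neither in `S` nor bound by
a cut. -/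
def Nrm : {τ : Cat} → Set Var → DExpr τ → Prop
  | _, S, .var x => x ∉ S
  | _, S, .lam κ t => Nrm (lift κ False S) t
  | _, S, .bang t => Nrm S t
  | _, S, .val v => Nrm S v
  | _, S, .cut _ κ t => Nrm (lift κ True S) t
  | _, S, .sub m v κ t => mv m ∉ S ∧ Nrm S v ∧ Nrm (lift κ False S) t
  | _, S, .der e κ t => ev e ∉ S ∧ Nrm (lift κ False S) t

/-- A step acts on an occurrence outside the left sub-terms of cuts, and `Nrm` puts every such
occurrence outside the current set. The variable of a crossed cut belongs to that set, so the
request can never be closed by a cut and must still be open at the root. -/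
theorem Nrm.not_lstep {F S : Set Var} {r : Option Request} {t t' : DExpr τ}
    (hs : LStep F r t t') (ht : Nrm S t) : ∃ q ∈ r, q.1 ∉ S := by
  have key : ∀ {κ : VKind} {b : Prop} {r : Option Request} {S : Set Var},
      (∃ q ∈ r.map (renReq (shift κ)), q.1 ∉ lift κ b S) → ∃ q ∈ r, q.1 ∉ S := by
    rintro κ b r S ⟨q, hq, h⟩
    obtain ⟨q, hq', rfl⟩ := Option.mem_map.1 hq
    exact ⟨q, hq', by simpa [renReq] using h⟩
  induction hs generalizing S with
  | var F x v => exact ⟨_, rfl, ht⟩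
  | subVar F m n v κ t => exact ⟨_, rfl, ht.1⟩
  | subLam F m κ' s v κ t => exact ⟨_, rfl, ht.1⟩
  | derVar F e g κ t => exact ⟨_, rfl, ht.1⟩
  | derBang F e s κ t => exact ⟨_, rfl, ht.1⟩
  | lam κ _ ih => exact key (ih ht)
  | bang _ ih => exact ih ht
  | val _ ih => exact ih ht
  | cut v κ _ ih => exact key (ih ht)
  | cutMul v _ h0 ih =>
    obtain ⟨q, ⟨⟩, h⟩ := ih ht
    simp at h
  | cutExp v hv _ ih =>
    obtain ⟨q, ⟨⟩, h⟩ := ih ht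
    simp at h
  | subL m κ t hm _ ih => exact ih ht.2.1
  | subR m v κ _ ih => exact key (ih ht.2.2)
  | der e κ _ ih => exact key (ih ht.2)

theorem Nrm.normal {t : DExpr .tm} (h : Nrm ∅ t) : Normal DStep t := by
  intro s hs
  obtain ⟨q, ⟨⟩, -⟩ := Nrm.not_lstep hs h

end DExpr

open DExpr

/-! ### Fresh names, environments and exchanges of names. -/

theorem Var.exists_fresh {κ : VKind} (X : Finset Var) : ∃ j, (⟨κ, j⟩ : Var) ∉ X := by
  obtain ⟨j, hj⟩ := Infinite.exists_notMem_finset (X.image Var.name)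
  exact ⟨j, fun h => hj (Finset.mem_image_of_mem Var.name h)⟩

namespace Ren

/-- The environment that sends `x` to the innermost index. -/
def ext (ρ : Ren) (x : Var) : Ren := fun κ n =>
  if κ = x.kind then (if n = x.name then 0 else ρ κ n + 1) else ρ κ n

/-- Exchange of two names as a renaming. -/
def swap (κ : VKind) (i j : ℕ) : Ren := fun κ' n => if κ' = κ then Equiv.swap i j n else n

@[simp] theorem act_ext_self (ρ : Ren) (x : Var) : act (ext ρ x) x = ⟨x.kind, 0⟩ := by
  simp [act, ext]

theorem act_ext_of_ne (ρ : Ren) {x y : Var} (h : y ≠ x) :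
    act (ext ρ x) y = act (shift x.kind) (act ρ y) := by
  rcases x with ⟨κ, n⟩
  rcases y with ⟨κ', n'⟩
  by_cases hk : κ' = κ
  · subst hk
    have : n' ≠ n := fun e => h (by rw [e])
    simp [act, ext, shift, this]
  · simp [act, ext, shift, hk]

theorem act_swap (κ : VKind) (i j : ℕ) (x : Var) : act (swap κ i j) x = x.swap κ i j := rfl

theorem swap_injective (κ : VKind) (i j : ℕ) : Function.Injective (act (swap κ i j)) := by
  rintro ⟨κ₁, n⟩ ⟨κ₂, n'⟩ h
  simp only [act, swap, Var.mk.injEq] at h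
  obtain ⟨rfl, h⟩ := h
  split_ifs at h with hk
  · rw [(Equiv.swap i j).injective h]
  · rw [h]

theorem swap_left (κ : VKind) (i j : ℕ) : act (swap κ i j) ⟨κ, i⟩ = ⟨κ, j⟩ := by
  simp [act, swap]

theorem swap_of_ne {κ : VKind} {i j : ℕ} {x : Var} (hi : x ≠ ⟨κ, i⟩) (hj : x ≠ ⟨κ, j⟩) :
    act (swap κ i j) x = x := by
  rcases x with ⟨κ', n⟩
  by_cases hk : κ' = κ
  · subst hk
    simp only [ne_eq, Var.mk.injEq, true_and] at hi hj
    simp [act, swap, Equiv.swap_apply_of_ne_of_ne hi hj]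
  · simp [act, swap, hk]

theorem up_comp_ext (f ρ : Ren) (x : Var) :
    comp (up x.kind f) (ext ρ x) = ext (comp f ρ) x := by
  refine ext_act fun y => ?_
  by_cases h : y = x
  · subst h; simp
  · simp [act_ext_of_ne _ h]

theorem ext_comp_swap (ρ : Ren) (κ : VKind) (i j : ℕ) (x : Var) :
    comp (ext ρ (act (swap κ i j) x)) (swap κ i j) = ext (comp ρ (swap κ i j)) x := by
  refine ext_act fun y => ?_
  by_cases h : y = x
  · subst h; simp
  · simp [act_ext_of_ne _ h, act_ext_of_ne _ fun e => h (swap_injective κ i j e)]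

theorem ext_injective {ρ : Ren} (h : Function.Injective (act ρ)) (x : Var) :
    Function.Injective (act (ext ρ x)) := by
  intro y z e
  by_cases hy : y = x <;> by_cases hz : z = x
  · rw [hy, hz]
  · subst hy; simp [act_ext_of_ne _ hz] at e
  · subst hz; simp [act_ext_of_ne _ hy] at e
  · rw [act_ext_of_ne _ hy, act_ext_of_ne _ hz, shift_inj] at e
    exact h e

end Ren

/-! ## Nameless representation of pre-terms -/

namespace Expr

/-- The nameless representation in an environment. -/
def db : {τ : Cat} → Ren → Expr Empty τ → DExpr τ
  | _, ρ, .var x => .var (act ρ x)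
  | _, ρ, .lam x t => .lam x.kind (t.db (ext ρ x))
  | _, ρ, .bang t => .bang (t.db ρ)
  | _, ρ, .val v => .val (v.db ρ)
  | _, ρ, .cut v x t => .cut (v.db ρ) x.kind (t.db (ext ρ x))
  | _, ρ, .sub m v x t => .sub (ρ .mul m) (v.db ρ) x.kind (t.db (ext ρ x))
  | _, ρ, .der e x t => .der (ρ .exp e) x.kind (t.db (ext ρ x))

variable {τ : Cat}

theorem ren_db (t : Expr Empty τ) (f ρ : Ren) : ren f (t.db ρ) = t.db (comp f ρ) := by
  induction t generalizing f ρ with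
  | hole a => exact a.elim
  | var x => rfl
  | _ => simp_all [db, ren, up_comp_ext]; try rfl

theorem db_congr (t : Expr Empty τ) {ρ σ : Ren} (h : ∀ y ∈ t.fv, act ρ y = act σ y) :
    t.db ρ = t.db σ := by
  have key : ∀ {x : Var} {ρ σ : Ren} {s : PreTerm}, (∀ y ∈ s.fv.erase x, act ρ y = act σ y) →
      ∀ y ∈ s.fv, act (ext ρ x) y = act (ext σ x) y := by
    intro x ρ σ s h y hy
    by_cases e : y = x
    · subst e; simp
    · simp [act_ext_of_ne _ e, h y (Finset.mem_erase.2 ⟨e, hy⟩)]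
  induction t generalizing ρ σ with
  | hole a => exact a.elim
  | var x => simp [db, h x (by simp [fv])]
  | lam x t ih => simp only [db, ih (key h)]
  | bang t ih => simp only [db, ih h]
  | val v ih => simp only [db, ih h]
  | cut v x t ihv iht =>
    simp only [fv, Finset.mem_union] at h
    simp only [db, ihv fun y hy => h y (.inl hy), iht (key fun y hy => h y (.inr hy))]
  | sub m v x t ihv iht =>
    simp only [fv, Finset.mem_union, Finset.mem_insert] at h
    have := congrArg Var.name (h (mv m) (.inl rfl))
    simp only [act] at this
    simp only [db, this, ihv fun y hy => h y (.inr (.inl hy)),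
      iht (key fun y hy => h y (.inr (.inr hy)))]
  | der e x t iht =>
    simp only [fv, Finset.mem_insert] at h
    have := congrArg Var.name (h (ev e) (.inl rfl))
    simp only [act] at this
    simp only [db, this, iht (key fun y hy => h y (.inr hy))]

theorem db_ext_of_notMem {t : Expr Empty τ} {x : Var} (h : x ∉ t.fv) (ρ : Ren) :
    t.db (ext ρ x) = ren (shift x.kind) (t.db ρ) := by
  rw [ren_db]
  exact db_congr t fun y hy => act_ext_of_ne _ (ne_of_mem_of_not_mem hy h)

theorem cnt_db_ne_zero (t : Expr Empty τ) {ρ : Ren} {z : Var} :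
    cnt z (t.db ρ) ≠ 0 ↔ ∃ y ∈ t.fv, act ρ y = z := by
  have key : ∀ {x : Var} {ρ : Ren} {z : Var} {s : PreTerm},
      (∃ y ∈ s.fv, act (ext ρ x) y = act (shift x.kind) z) ↔
        ∃ y, (y ≠ x ∧ y ∈ s.fv) ∧ act ρ y = z := by
    intro x ρ z s
    constructor
    · rintro ⟨y, hy, e⟩
      by_cases hx : y = x
      · subst hx; simp at e
      · exact ⟨y, ⟨hx, hy⟩, by simpa [act_ext_of_ne _ hx] using e⟩
    · rintro ⟨y, ⟨hx, hy⟩, e⟩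
      exact ⟨y, hy, by simp [act_ext_of_ne _ hx, e]⟩
  induction t generalizing ρ z with
  | hole a => exact a.elim
  | var x => simp [db, cnt, fv]
  | lam x t ih => simp only [db, cnt, fv, ih, key, Finset.mem_erase]
  | bang t ih => simp only [db, cnt, fv, ih]
  | val v ih => simp only [db, cnt, fv, ih]
  | cut v x t ihv iht =>
    simp only [db, cnt, fv, Finset.mem_union, Finset.mem_erase, or_and_right, exists_or,
      ← ihv, ← key, ← iht]
    omega
  | sub m v x t ihv iht =>
    simp only [db, cnt, fv, Finset.mem_union, Finset.mem_insert, Finset.mem_erase,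
      or_and_right, exists_or, ← ihv, ← key, ← iht, exists_eq_left, act_mv]
    split_ifs with h <;> simp [h]
    omega
  | der e x t iht =>
    simp only [db, cnt, fv, Finset.mem_insert, Finset.mem_erase,
      or_and_right, exists_or, ← key, ← iht, exists_eq_left, act_ev]
    split_ifs with h <;> simp [h]

/-- The environment in which free variables stand for themselves. -/
abbrev idEnv : Ren := fun _ n => n

theorem mem_fv_iff (t : Expr Empty τ) (x : Var) : x ∈ t.fv ↔ cnt x (t.db idEnv) ≠ 0 := by
  rw [cnt_db_ne_zero]
  exact ⟨fun h => ⟨x, h, rfl⟩, by rintro ⟨y, hy, rfl⟩; exact hy⟩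

theorem db_swap (t : Expr Empty τ) (κ : VKind) (i j : ℕ) (ρ : Ren) :
    (t.swap κ i j).db ρ = t.db (comp ρ (Ren.swap κ i j)) := by
  induction t generalizing ρ with
  | hole a => exact a.elim
  | var x => rfl
  | lam x t ih => simp only [Expr.swap, db, ih, ← act_swap, ext_comp_swap, act_kind]
  | bang t ih => simp only [Expr.swap, db, ih]
  | val t ih => simp only [Expr.swap, db, ih]
  | cut v x t ihv iht =>
    simp only [Expr.swap, db, ihv, iht, ← act_swap, ext_comp_swap, act_kind]
  | sub m v x t ihv iht =>
    simp only [Expr.swap, db, ihv, iht, ← act_swap, ext_comp_swap, act_kind]; rfl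
  | der e x t iht =>
    simp only [Expr.swap, db, iht, ← act_swap, ext_comp_swap, act_kind]; rfl

/-- Both binders send their own name to the innermost index, and the exchange moves no other free
name of `t` because `j` is not free in it. -/
theorem db_rename {t : PreTerm} {κ : VKind} {i j : ℕ} (h : (⟨κ, j⟩ : Var) ∉ t.fv) (ρ : Ren) :
    (t.swap κ i j).db (ext ρ ⟨κ, j⟩) = t.db (ext ρ ⟨κ, i⟩) := by
  rw [db_swap]
  refine db_congr t fun y hy => ?_
  have hj : y ≠ ⟨κ, j⟩ := ne_of_mem_of_not_mem hy h
  by_cases hi : y = ⟨κ, i⟩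
  · subst hi
    rw [act_comp, swap_left, act_ext_self, act_ext_self]
  · rw [act_comp, swap_of_ne hi hj, act_ext_of_ne _ hi, act_ext_of_ne _ hj]

end Expr

open _root_.ESC.Expr

theorem Alpha.db_eq {τ : Cat} {t s : Expr Empty τ} (h : Alpha t s) (ρ : Ren) :
    t.db ρ = s.db ρ := by
  induction h generalizing ρ with
  | refl => rfl
  | symm _ ih => exact (ih ρ).symm
  | trans _ _ ih₁ ih₂ => exact (ih₁ ρ).trans (ih₂ ρ)
  | lam_rename κ i j t h => simp only [db, db_rename h]
  | cut_rename κ i j v t h => simp only [db, db_rename h]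
  | sub_rename κ i j m v t h => simp only [db, db_rename h]
  | der_rename κ i j e t h => simp only [db, db_rename h]
  | _ => simp_all only [db]

theorem Alpha.fv_eq {τ : Cat} {t s : Expr Empty τ} (h : Alpha t s) : t.fv = s.fv := by
  ext x
  rw [mem_fv_iff, mem_fv_iff, h.db_eq]

/-- Corresponding binders are aligned by renaming both to a common fresh name, and injectivity of
the environment recovers the free names from their indices. -/
theorem Alpha.of_db_eq {τ : Cat} {t s : Expr Empty τ} {ρ : Ren}
    (hρ : Function.Injective (act ρ)) (h : t.db ρ = s.db ρ) : Alpha t s := by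
  have var_eq : ∀ {κ : VKind} {n n' : ℕ} {ρ : Ren}, Function.Injective (act ρ) →
      ρ κ n = ρ κ n' → n = n' := by
    intro κ n n' ρ hρ e
    exact congrArg Var.name (@hρ ⟨κ, n⟩ ⟨κ, n'⟩ (by simp [act, e]))
  have key : ∀ {x y : Var} {t s : PreTerm} {d : DExpr .tm} {ρ : Ren},
      Function.Injective (act ρ) → x.kind = y.kind →
      (∀ {t s : PreTerm} {ρ : Ren}, Function.Injective (act ρ) → t.db ρ = d → s.db ρ = d →
        Alpha t s) → t.db (ext ρ x) = d → s.db (ext ρ y) = d →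
      ∃ j, (⟨x.kind, j⟩ : Var) ∉ t.fv ∧ (⟨x.kind, j⟩ : Var) ∉ s.fv ∧
        Alpha (t.swap x.kind x.name j) (s.swap x.kind y.name j) := by
    rintro ⟨κ, x⟩ ⟨κ', y⟩ t s d ρ hρ hk ih ht hs
    obtain rfl : κ = κ' := hk
    obtain ⟨j, hj⟩ := Var.exists_fresh (κ := κ) (t.fv ∪ s.fv)
    rw [Finset.mem_union, not_or] at hj
    exact ⟨j, hj.1, hj.2, ih (ext_injective hρ ⟨κ, j⟩) (by rw [db_rename hj.1, ht])
      (by rw [db_rename hj.2, hs])⟩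
  -- The induction is on the common nameless form: aligning the binders changes both pre-terms, but
  -- not this form.
  generalize hd : t.db ρ = d at h
  replace h := h.symm
  induction d generalizing ρ with
  | var z =>
    cases t with
    | hole a => exact a.elim
    | var x =>
      cases s with
      | hole a => exact a.elim
      | var y =>
        simp only [db, DExpr.var.injEq] at hd h
        rw [hρ (hd.trans h.symm)]
        exact .refl _
      | _ => simp [db] at h
    | _ => simp [db] at hd
  | lam κ d ih =>
    cases t with
    | hole a => exact a.elim
    | lam x t =>
      cases s with
      | hole a => exact a.elim
      | lam y s =>
        simp only [db, DExpr.lam.injEq] at hd h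
        obtain ⟨hx, hd⟩ := hd
        obtain ⟨hy, h⟩ := h
        obtain ⟨j, h1, h2, h3⟩ := key hρ (hx.trans hy.symm) (fun a b c => ih a b c) hd h
        rw [hx] at h1 h2 h3
        obtain ⟨κx, x⟩ := x
        obtain ⟨κy, y⟩ := y
        obtain rfl : κx = κ := hx
        obtain rfl : κy = κx := hy
        exact (Alpha.lam_rename _ _ j _ h1).trans ((Alpha.lam _ h3).trans
          (Alpha.lam_rename _ _ j _ h2).symm)
      | _ => simp [db] at h
    | _ => simp [db] at hd
  | bang d ih =>
    cases t with
    | hole a => exact a.elim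
    | bang t =>
      cases s with
      | hole a => exact a.elim
      | bang s =>
        simp only [db, DExpr.bang.injEq] at hd h
        exact .bang (ih hρ hd h)
      | _ => simp [db] at h
    | _ => simp [db] at hd
  | val d ih =>
    cases t with
    | val t =>
      cases s with
      | val s =>
        simp only [db, DExpr.val.injEq] at hd h
        exact .val (ih hρ hd h)
      | _ => simp [db] at h
    | _ => simp [db] at hd
  | cut dv κ d ihv ih =>
    cases t with
    | cut v x t =>
      cases s with
      | cut w y s =>
        simp only [db, DExpr.cut.injEq] at hd h
        obtain ⟨hv, hx, hd⟩ := hd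
        obtain ⟨hw, hy, h⟩ := h
        obtain ⟨j, h1, h2, h3⟩ := key hρ (hx.trans hy.symm) (fun a b c => ih a b c) hd h
        rw [hx] at h1 h2 h3
        obtain ⟨κx, x⟩ := x
        obtain ⟨κy, y⟩ := y
        obtain rfl : κx = κ := hx
        obtain rfl : κy = κx := hy
        exact (Alpha.cut_rename _ _ j _ _ h1).trans ((Alpha.cut _ (ihv hρ hv hw) h3).trans
          (Alpha.cut_rename _ _ j _ _ h2).symm)
      | _ => simp [db] at h
    | _ => simp [db] at hd
  | sub m dv κ d ihv ih =>
    cases t with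
    | sub m₁ v x t =>
      cases s with
      | sub m₂ w y s =>
        simp only [db, DExpr.sub.injEq] at hd h
        obtain ⟨hm, hv, hx, hd⟩ := hd
        obtain ⟨hm', hw, hy, h⟩ := h
        obtain rfl := var_eq hρ (hm.trans hm'.symm)
        obtain ⟨j, h1, h2, h3⟩ := key hρ (hx.trans hy.symm) (fun a b c => ih a b c) hd h
        rw [hx] at h1 h2 h3
        obtain ⟨κx, x⟩ := x
        obtain ⟨κy, y⟩ := y
        obtain rfl : κx = κ := hx
        obtain rfl : κy = κx := hy
        exact (Alpha.sub_rename _ _ j _ _ _ h1).trans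
          ((Alpha.sub _ _ (ihv hρ hv hw) h3).trans (Alpha.sub_rename _ _ j _ _ _ h2).symm)
      | _ => simp [db] at h
    | _ => simp [db] at hd
  | der e κ d ih =>
    cases t with
    | der e₁ x t =>
      cases s with
      | der e₂ y s =>
        simp only [db, DExpr.der.injEq] at hd h
        obtain ⟨hm, hx, hd⟩ := hd
        obtain ⟨hm', hy, h⟩ := h
        obtain rfl := var_eq hρ (hm.trans hm'.symm)
        obtain ⟨j, h1, h2, h3⟩ := key hρ (hx.trans hy.symm) (fun a b c => ih a b c) hd h
        rw [hx] at h1 h2 h3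
        obtain ⟨κx, x⟩ := x
        obtain ⟨κy, y⟩ := y
        obtain rfl : κx = κ := hx
        obtain rfl : κy = κx := hy
        exact (Alpha.der_rename _ _ j _ _ h1).trans ((Alpha.der _ _ h3).trans
          (Alpha.der_rename _ _ j _ _ h2).symm)
      | _ => simp [db] at h
    | _ => simp [db] at hd

theorem idEnv_injective : Function.Injective (act idEnv) := fun _ _ h => h

/-- The nameless representation of a term. -/
def Term.db (t : Term) : DExpr .tm :=
  Quotient.lift (fun p : PreTerm => Expr.db idEnv p) (fun _ _ h => Alpha.db_eq h idEnv) t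

theorem PreTerm.toTerm_eq_iff {p q : PreTerm} :
    PreTerm.toTerm p = PreTerm.toTerm q ↔ Alpha p q :=
  Quotient.eq (r := alphaSetoid)

theorem Term.db_injective : Function.Injective Term.db := by
  intro t s
  induction t using Quotient.inductionOn with | h p =>
  induction s using Quotient.inductionOn with | h q =>
  exact fun h => PreTerm.toTerm_eq_iff.2 (Alpha.of_db_eq idEnv_injective h)

/-! ## From steps on pre-terms to the labelled transition system -/

/-- Crossing a binder `y` that captures nothing only weakens `t`. The binder `x` stays innermost,
which is why the weakening is lifted once. -/
theorem Expr.db_ext_ext {t : PreTerm} {x y : Var} (h : y ∉ t.fv.erase x) (ρ : Ren) :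
    t.db (ext (ext ρ y) x) = ren (up x.kind (shift y.kind)) (t.db (ext ρ x)) := by
  rw [ren_db]
  refine db_congr t fun z hz => ?_
  by_cases e : z = x
  · subst e; simp
  · have hy : z ≠ y := ne_of_mem_of_not_mem (Finset.mem_erase.2 ⟨e, hz⟩) h
    simp [act_ext_of_ne _ e, act_ext_of_ne _ hy]

/-- The nameless splicing weakens `t` at each binder of the left context. Named plugging leaves `t`
as it is, so the two agree exactly because the left context captures nothing in `t`. -/
theorem Expr.db_splice {x : Var} {v : PreValue} {t : PreTerm} (L : LCtx Empty) (ρ : Ren)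
    (h : Disjoint L.captured (t.fv.erase x)) :
    (L.plug (.cut v x t)).db ρ =
      splice ((L.plug (.val v)).db ρ) x.kind (t.db (ext ρ x)) := by
  induction L generalizing ρ with
  | hole => rfl
  | cut w y L ih =>
    simp only [LCtx.captured, Finset.disjoint_insert_left] at h
    simp only [LCtx.plug, db, splice, ih _ h.2, db_ext_ext h.1]
  | sub m w y L ih =>
    simp only [LCtx.captured, Finset.disjoint_insert_left] at h
    simp only [LCtx.plug, db, splice, ih _ h.2, db_ext_ext h.1]
  | der e y L ih =>
    simp only [LCtx.captured, Finset.disjoint_insert_left] at h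
    simp only [LCtx.plug, db, splice, ih _ h.2, db_ext_ext h.1]

/-! ### Steps between pre-terms read in two environments. -/

/-- Environments that agree on the variables different from `x`. -/
def AgreeOff (x : Var) (ρ σ : Ren) : Prop := ∀ y, y ≠ x → act ρ y = act σ y

/-- Either `x` occurs at most once in `s`, or it has the same value in the environments. -/
def OnceOrAgree {τ : Cat} (x : Var) (ρ σ : Ren) (s : Expr Empty τ) : Prop :=
  cnt (act ρ x) (s.db ρ) ≤ 1 ∨ act ρ x = act σ x

section Agreement

variable {τ : Cat} {x : Var} {ρ σ : Ren}

theorem AgreeOff.db_eq (h : AgreeOff x ρ σ) (s : Expr Empty τ)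
    (hs : cnt (act ρ x) (s.db ρ) = 0 ∨ act ρ x = act σ x) : s.db ρ = s.db σ := by
  refine db_congr s fun y hy => ?_
  by_cases e : y = x
  · subst e
    exact hs.resolve_left ((cnt_db_ne_zero s).2 ⟨y, hy, rfl⟩)
  · exact h y e

theorem AgreeOff.ext (h : AgreeOff x ρ σ) (y : Var) : AgreeOff x (ext ρ y) (ext σ y) := by
  intro z hz
  by_cases e : z = y
  · subst e; simp
  · simp [act_ext_of_ne _ e, h z hz]

theorem OnceOrAgree.ext {y : Var} {s : PreTerm} (hy : x ≠ y)
    (h : cnt (act (shift y.kind) (act ρ x)) (s.db (Ren.ext ρ y)) ≤ 1 ∨ act ρ x = act σ x) :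
    OnceOrAgree x (Ren.ext ρ y) (Ren.ext σ y) s := by
  simpa [OnceOrAgree, act_ext_of_ne _ hy] using h

theorem AgreeOff.name_eq (h : AgreeOff x ρ σ) (κ : VKind) (m : ℕ)
    (hx : (⟨κ, m⟩ : Var) ≠ x ∨ act ρ x = act σ x) : ρ κ m = σ κ m := by
  by_cases e : (⟨κ, m⟩ : Var) = x
  · subst e
    exact congrArg Var.name (hx.resolve_left (by simp))
  · exact congrArg Var.name (h _ e)

end Agreement

theorem request_ext {x y : Var} {v : PreValue} (ρ σ : Ren) (hx : x ≠ y) (hv : y ∉ v.fv) :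
    some (act (ext ρ y) x, v.db (ext σ y)) =
      (some (act ρ x, v.db σ)).map (renReq (shift y.kind)) := by
  simp [renReq, act_ext_of_ne _ hx, db_ext_of_notMem hv]

/-- This turns the clauses of `dfv` at binders into conditions on forbidden sets: `b` is `False`
under abstractions, `True` under cuts, and membership of the acting variable under subtractions and
derelictions. -/
theorem notMem_lift {A : Finset Var} {x : Var} {ρ : Ren} {F : Set Var} {b : Prop}
    (h : ∀ y ∈ A.erase x, act ρ y ∉ F) (hb : x ∈ A → ¬ b) :
    ∀ y ∈ A, act (ext ρ x) y ∉ lift x.kind b F := by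
  intro y hy
  by_cases e : y = x
  · subst e; simpa using hb hy
  · simpa [act_ext_of_ne _ e] using h y (Finset.mem_erase.2 ⟨e, hy⟩)

/-- The source is read in `ρ` and the target in `ρ'`, because a multiplicative step removes the
binder of the cut and so changes the meaning of `x` between the two sides. The parts of `D` off the
path to the hole are the same pre-terms on both sides and must have the same nameless form. This
holds because either `x` means the same in both environments (exponential cuts), or its only
occurrence is the one consumed at the hole (multiplicative cuts). -/
theorem LStep.plug {σ τ : Cat} (D : Ctx Empty σ τ) {x : Var} {v : PreValue}
    {o o' : Expr Empty σ}
    (H : ∀ F ρ ρ', AgreeOff x ρ ρ' → OnceOrAgree x ρ ρ' o →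
      LStep F (some (act ρ x, v.db ρ')) (o.db ρ) (o'.db ρ'))
    {F : Set Var} {ρ ρ' : Ren} (hG : D.Good) (hF : ∀ y ∈ D.dfv, act ρ y ∉ F)
    (hx : x ∉ D.captured) (hv : Disjoint D.captured v.fv) (ha : AgreeOff x ρ ρ')
    (ho : OnceOrAgree x ρ ρ' (D.plug o)) :
    LStep F (some (act ρ x, v.db ρ')) ((D.plug o).db ρ) ((D.plug o').db ρ') := by
  have one : ∀ {F : Set Var} {y : Var} {w : DExpr .val} {τ : Cat} {s s' : DExpr τ},
      LStep F (some (y, w)) s s' → 1 ≤ cnt y s :=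
    fun h => Nat.one_le_iff_ne_zero.2 (h.cnt_request _ _ rfl)
  induction D generalizing F ρ ρ' with
  | hole => exact H F ρ ρ' ha ho
  | lam y C ih =>
    simp only [Ctx.captured, Finset.mem_insert, not_or, Finset.disjoint_insert_left] at hx hv
    refine .lam _ ?_
    rw [← request_ext _ _ hx.1 hv.1]
    exact ih hG (notMem_lift hF fun _ => id) hx.2 hv.2 (ha.ext y) (.ext hx.1 ho)
  | bang C ih => exact .bang (ih hG hF hx hv ha ho)
  | val C ih => exact .val (ih hG hF hx hv ha ho)
  | cutL V y t ih => exact hG.elim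
  | cutR w y C ih =>
    simp only [Ctx.captured, Finset.mem_insert, not_or, Finset.disjoint_insert_left] at hx hv
    simp only [OnceOrAgree, Ctx.plug, db, cnt] at ho
    have h := ih (F := lift y.kind True F) hG.1 (notMem_lift hF fun h => absurd h hG.2)
      hx.2 hv.2 (ha.ext y) (.ext hx.1 (ho.imp_left (by omega)))
    rw [request_ext _ _ hx.1 hv.1] at h
    have h1 := one h
    simp only at h1
    simp only [Ctx.plug, db]
    -- The step inside the body consumes an occurrence of `x`, so in the linear case none is left
    -- for `w`.
    rw [ha.db_eq w (ho.imp_left (by omega))]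
    exact .cut _ _ h
  | subL m V y t ih =>
    simp only [OnceOrAgree, Ctx.plug, db, cnt] at ho
    have h := ih hG (fun z hz => hF z (Finset.mem_insert_of_mem hz)) hx hv ha
      (ho.imp_left (by omega))
    have h1 := one h
    have ht := ha.db_eq (.lam y t) (ho.imp_left (by simp only [db, cnt]; omega))
    simp only [db, DExpr.lam.injEq, true_and] at ht
    -- If `m` were `x`, the head of the subtraction would be a second occurrence.
    have hm : ρ .mul m = ρ' .mul m := ha.name_eq _ _ (ho.imp_left fun h2 e => by
      rw [← e] at h2 h1; simp at h1 h2; omega)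
    simp only [Ctx.plug, db]
    rw [ht, ← hm]
    exact .subL _ _ _ (hF _ (Finset.mem_insert_self _ _)) h
  | subR m w y C ih =>
    simp only [Ctx.captured, Finset.mem_insert, not_or, Finset.disjoint_insert_left] at hx hv
    simp only [OnceOrAgree, Ctx.plug, db, cnt] at ho
    have h := ih (F := lift y.kind (act ρ (mv m) ∈ F) F) hG (by
        simp only [Ctx.dfv] at hF
        split_ifs at hF with hd
        · exact notMem_lift (fun z hz => hF z (Finset.mem_insert_of_mem hz))
            fun _ => hF _ (Finset.mem_insert_self _ _)
        · exact notMem_lift (fun z hz => hF z (Finset.mem_of_mem_erase hz))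
            fun h => absurd h hd)
      hx.2 hv.2 (ha.ext y) (.ext hx.1 (ho.imp_left (by omega)))
    rw [request_ext _ _ hx.1 hv.1] at h
    have h1 := one h
    simp only at h1
    have hm : ρ .mul m = ρ' .mul m := ha.name_eq _ _ (ho.imp_left fun h2 e => by
      rw [← e] at h2 h1; simp at h1 h2; omega)
    simp only [Ctx.plug, db]
    rw [ha.db_eq w (ho.imp_left (by omega)), ← hm]
    exact .subR _ _ _ h
  | der e y C ih =>
    simp only [Ctx.captured, Finset.mem_insert, not_or, Finset.disjoint_insert_left] at hx hv
    simp only [OnceOrAgree, Ctx.plug, db, cnt] at ho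
    have h := ih (F := lift y.kind (act ρ (ev e) ∈ F) F) hG (by
        simp only [Ctx.dfv] at hF
        split_ifs at hF with hd
        · exact notMem_lift (fun z hz => hF z (Finset.mem_insert_of_mem hz))
            fun _ => hF _ (Finset.mem_insert_self _ _)
        · exact notMem_lift (fun z hz => hF z (Finset.mem_of_mem_erase hz))
            fun h => absurd h hd)
      hx.2 hv.2 (ha.ext y) (.ext hx.1 (ho.imp_left (by omega)))
    rw [request_ext _ _ hx.1 hv.1] at h
    have h1 := one h
    simp only at h1
    have hm : ρ .exp e = ρ' .exp e := ha.name_eq _ _ (ho.imp_left fun h2 e => by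
      rw [← e] at h2 h1; simp at h1 h2; omega)
    simp only [Ctx.plug, db]
    rw [← hm]
    exact .der _ _ h

theorem LStep.outer {σ τ : Cat} (C : Ctx Empty .tm τ) {E : Ctx Empty σ .tm} {p q : PreTerm}
    (H : ∀ F ρ, E.Good → (∀ y ∈ E.dfv, act ρ y ∉ F) → Lin (p.db ρ) →
      LStep F none (p.db ρ) (q.db ρ))
    {F : Set Var} {ρ : Ren} (hG : (C.comp E).Good) (hF : ∀ y ∈ (C.comp E).dfv, act ρ y ∉ F)
    (hl : Lin ((C.plug p).db ρ)) :
    LStep F none ((C.plug p).db ρ) ((C.plug q).db ρ) := by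
  induction C generalizing F ρ with
  | hole => exact H F ρ hG hF hl
  | lam y C ih => exact .lam _ (ih hG (notMem_lift hF fun _ => id) hl.1)
  | bang C ih => exact .bang (ih hG hF hl.1)
  | val C ih => exact .val (ih hG hF hl)
  | cutL V y t ih => exact hG.elim
  | cutR w y C ih =>
    exact .cut _ _ (ih hG.1 (notMem_lift hF fun h => absurd h hG.2) hl.2.1)
  | subL m V y t ih =>
    exact .subL _ _ _ (hF _ (Finset.mem_insert_self _ _))
      (ih hG (fun z hz => hF z (Finset.mem_insert_of_mem hz)) hl.1)
  | subR m w y C ih =>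
    refine .subR _ _ _ (ih hG ?_ hl.2.1)
    simp only [Ctx.comp, Ctx.dfv] at hF
    split_ifs at hF with hd
    · exact notMem_lift (fun z hz => hF z (Finset.mem_insert_of_mem hz))
        fun _ => hF _ (Finset.mem_insert_self _ _)
    · exact notMem_lift (fun z hz => hF z (Finset.mem_of_mem_erase hz))
        fun h => absurd h hd
  | der e y C ih =>
    refine .der _ _ (ih hG ?_ hl.1)
    simp only [Ctx.comp, Ctx.dfv] at hF
    split_ifs at hF with hd
    · exact notMem_lift (fun z hz => hF z (Finset.mem_insert_of_mem hz))
        fun _ => hF _ (Finset.mem_insert_self _ _)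
    · exact notMem_lift (fun z hz => hF z (Finset.mem_of_mem_erase hz))
        fun h => absurd h hd

/-- The source body lives under the cut, in `ext ρ (mv m)`, while the target lives outside, in `ρ`.
After weakening, the latter becomes `comp (shift .mul) ρ`, which differs from the former at `m`
only; linearity says that `m` occurs once. -/
theorem LStep.root_mul {σ : Cat} {D : Ctx Empty σ .tm} {m : ℕ} {v : PreValue}
    {o o' : Expr Empty σ}
    (H : ∀ F ρ ρ', AgreeOff (mv m) ρ ρ' → OnceOrAgree (mv m) ρ ρ' o →
      LStep F (some (act ρ (mv m), v.db ρ')) (o.db ρ) (o'.db ρ'))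
    (hm : mv m ∉ D.captured) (hv : Disjoint D.captured v.fv) (F : Set Var) (ρ : Ren)
    (hG : (Ctx.cutR v (mv m) D).Good) (hF : ∀ y ∈ (Ctx.cutR v (mv m) D).dfv, act ρ y ∉ F)
    (hl : Lin ((Expr.cut v (mv m) (D.plug o)).db ρ)) :
    LStep F none ((Expr.cut v (mv m) (D.plug o)).db ρ) ((D.plug o').db ρ) := by
  have h := LStep.plug D H (F := lift .mul True F) (ρ := ext ρ (mv m))
    (ρ' := comp (shift .mul) ρ) hG.1 (notMem_lift hF fun h => absurd h hG.2) hm hv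
    (fun y hy => by rw [act_ext_of_ne _ hy, act_comp])
    (.inl (by rw [act_ext_self]; exact (hl.2.2 rfl).le))
  rw [← ren_db, ← ren_db, act_ext_self] at h
  -- The target has to be presented as a lowered expression without index 0: the weakened target is
  -- one.
  rw [← ren_pred_shift .mul ((D.plug o').db ρ)]
  exact .cutMul _ h (cnt_zero_shift _ _)

theorem cnt_mv_of_isExp {v : PreValue} {ρ : Ren} (hv : v.IsExp) (hl : Lin (v.db ρ)) (m : ℕ) :
    cnt (mv m) (v.db ρ) = 0 := by
  cases v with
  | hole a => exact a.elim
  | var x =>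
    rcases x with ⟨κ, x⟩
    obtain rfl : κ = .exp := hv
    simp [db, cnt, act]
  | lam x t => exact hv.elim
  | bang t => exact hl.2 m

/-- The cut survives, so source and target are read in the same environment and the number of
occurrences is irrelevant. The value is read outside its own cut, hence the need for `e` not to be
free in it. -/
theorem LStep.root_exp {σ : Cat} {D : Ctx Empty σ .tm} {e : ℕ} {v : PreValue}
    {o o' : Expr Empty σ}
    (H : ∀ F ρ ρ', AgreeOff (ev e) ρ ρ' → OnceOrAgree (ev e) ρ ρ' o →
      LStep F (some (act ρ (ev e), v.db ρ')) (o.db ρ) (o'.db ρ'))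
    (he : ev e ∉ D.captured) (hv : Disjoint D.captured v.fv) (hev : ev e ∉ v.fv)
    (hve : v.IsExp) (F : Set Var) (ρ : Ren)
    (hG : (Ctx.cutR v (ev e) D).Good) (hF : ∀ y ∈ (Ctx.cutR v (ev e) D).dfv, act ρ y ∉ F)
    (hl : Lin ((Expr.cut v (ev e) (D.plug o)).db ρ)) :
    LStep F none ((Expr.cut v (ev e) (D.plug o)).db ρ)
      ((Expr.cut v (ev e) (D.plug o')).db ρ) := by
  have h := LStep.plug D H (F := lift .exp True F) (ρ := ext ρ (ev e)) (ρ' := ext ρ (ev e))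
    hG.1 (notMem_lift hF fun h => absurd h hG.2) he hv (fun y hy => rfl) (.inr rfl)
  rw [act_ext_self, db_ext_of_notMem hev] at h
  exact .cutExp _ (cnt_mv_of_isExp hve hl.1) h

theorem LStep.sub_var {F : Set Var} {ρ ρ' : Ren} {m : ℕ} (n : ℕ) {v : PreValue} {y : Var}
    {t : PreTerm} (ha : AgreeOff (mv m) ρ ρ') (ho : OnceOrAgree (mv m) ρ ρ' (.sub m v y t)) :
    LStep F (some (act ρ (mv m), (Expr.var (mv n)).db ρ')) ((Expr.sub m v y t).db ρ)
      ((Expr.sub n v y t).db ρ') := by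
  simp only [OnceOrAgree, db, cnt, act_mv, if_true] at ho
  have ht := ha.db_eq (.lam y t) (ho.imp_left fun h => by simp only [db, cnt, act_mv]; omega)
  simp only [db, DExpr.lam.injEq, true_and] at ht
  simp only [db, ← ht, ← ha.db_eq v (ho.imp_left fun h => by simp only [act_mv]; omega)]
  exact .subVar _ _ _ _ _ _

theorem LStep.sub_lam {F : Set Var} {ρ ρ' : Ren} {m : ℕ} {v : PreValue} {x y : Var}
    {t : PreTerm} {L : LCtx Empty} {v' : PreValue}
    (hd : Disjoint (insert y L.captured) (t.fv.erase x))
    (ha : AgreeOff (mv m) ρ ρ') (ho : OnceOrAgree (mv m) ρ ρ' (.sub m v x t)) :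
    LStep F (some (act ρ (mv m), (Expr.lam y (L.plug (.val v'))).db ρ'))
      ((Expr.sub m v x t).db ρ) ((Expr.cut v y (L.plug (.cut v' x t))).db ρ') := by
  rw [Finset.disjoint_insert_left] at hd
  simp only [OnceOrAgree, db, cnt, act_mv, if_true] at ho
  have ht := ha.db_eq (.lam x t) (ho.imp_left fun h => by simp only [db, cnt, act_mv]; omega)
  simp only [db, DExpr.lam.injEq, true_and] at ht
  simp only [db, db_splice L _ hd.2, db_ext_ext hd.1, ← ht,
    ← ha.db_eq v (ho.imp_left fun h => by simp only [act_mv]; omega)]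
  exact .subLam _ _ _ _ _ _ _

theorem LStep.der_var {F : Set Var} {ρ ρ' : Ren} {e : ℕ} (f : ℕ) {y : Var}
    {t : PreTerm} (ha : AgreeOff (ev e) ρ ρ') (ho : OnceOrAgree (ev e) ρ ρ' (.der e y t)) :
    LStep F (some (act ρ (ev e), (Expr.var (ev f)).db ρ')) ((Expr.der e y t).db ρ)
      ((Expr.der f y t).db ρ') := by
  simp only [OnceOrAgree, db, cnt, act_ev, if_true] at ho
  have ht := ha.db_eq (.lam y t) (ho.imp_left fun h => by simp only [db, cnt, act_ev]; omega)
  simp only [db, DExpr.lam.injEq, true_and] at ht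
  simp only [db, ← ht]
  exact .derVar _ _ _ _ _

theorem LStep.der_bang {F : Set Var} {ρ ρ' : Ren} {e : ℕ} {x : Var}
    {t : PreTerm} {L : LCtx Empty} {v' : PreValue} (hd : Disjoint L.captured (t.fv.erase x))
    (ha : AgreeOff (ev e) ρ ρ') (ho : OnceOrAgree (ev e) ρ ρ' (.der e x t)) :
    LStep F (some (act ρ (ev e), (Expr.bang (L.plug (.val v'))).db ρ'))
      ((Expr.der e x t).db ρ) ((L.plug (.cut v' x t)).db ρ') := by
  simp only [OnceOrAgree, db, cnt, act_ev, if_true] at ho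
  have ht := ha.db_eq (.lam x t) (ho.imp_left fun h => by simp only [db, cnt, act_ev]; omega)
  simp only [db, DExpr.lam.injEq, true_and] at ht
  simp only [db, db_splice L _ hd, ← ht]
  exact .derBang _ _ _ _ _

theorem PreStep.dstep {k : StepKind} {σ : Cat} {P : Ctx Empty σ .tm} {p q : PreTerm}
    (h : PreStep k P p q) (hG : P.Good) (hk : k ≠ .w) (hl : Lin (p.db idEnv)) :
    DStep (p.db idEnv) (q.db idEnv) := by
  cases h with
  | axm1 C D v m _ hm hv =>
    exact LStep.outer C (LStep.root_mul (fun _ _ _ _ _ => .var _ _ _) hm hv) hG (by simp) hl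
  | axm2 C D n m v x t hm hn =>
    exact LStep.outer C (LStep.root_mul (fun _ _ _ => LStep.sub_var n) hm (by simpa [fv]))
      hG (by simp) hl
  | lolli C D y L v' m v x t hm hv hd =>
    exact LStep.outer C (LStep.root_mul (fun _ _ _ => LStep.sub_lam hd) hm hv)
      hG (by simp) hl
  | axe1 C D v e he hm hv hev =>
    exact LStep.outer C (LStep.root_exp (fun _ _ _ _ _ => .var _ _ _) hm hv hev he)
      hG (by simp) hl
  | axe2 C D f e x t hm hn hne =>
    exact LStep.outer C (LStep.root_exp (fun _ _ _ => LStep.der_var f) hm (by simpa [fv])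
      (by simpa [fv] using hne.symm) rfl) hG (by simp) hl
  | bang C D L v e x t hm hv hev hd =>
    exact LStep.outer C (LStep.root_exp (v := .bang (L.plug (.val v)))
      (fun _ _ _ => LStep.der_bang hd) hm hv hev trivial)
      hG (by simp) hl
  | w => exact absurd rfl hk

theorem GoodNonErasingStep.dstep {t s : Term} (h : GoodNonErasingStep t s) (hl : Lin t.db) :
    DStep t.db s.db := by
  obtain ⟨k, σ, P, p, q, rfl, rfl, h, hG, hk⟩ := h
  exact h.dstep hG hk hl

theorem Evaluation.dstep {k : ℕ} {t s : Term} (h : Evaluation GoodNonErasingStep k t s)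
    (hl : Lin t.db) : Evaluation DStep k t.db s.db ∧ Lin s.db := by
  induction k generalizing t with
  | zero => obtain rfl : t = s := h; exact ⟨rfl, hl⟩
  | succ k ih =>
    obtain ⟨u, hu, h⟩ := h
    have hd := hu.dstep hl
    obtain ⟨h1, h2⟩ := ih h (hd.lin hl)
    exact ⟨⟨_, hd, h1⟩, h2⟩

theorem Diverges.dstep {t : Term} (h : Diverges GoodNonErasingStep t) (hl : Lin t.db) :
    Diverges DStep t.db := by
  obtain ⟨f, rfl, hf⟩ := h
  have hlin : ∀ n, Lin (f n).db := fun n => by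
    induction n with
    | zero => exact hl
    | succ n ih => exact ((hf n).dstep ih).lin ih
  exact ⟨fun n => (f n).db, rfl, fun n => (hf n).dstep (hlin n)⟩

theorem clashFree_step {t s : Term} (h : t.ClashFree) (hs : GoodNonErasingStep t s) :
    s.ClashFree := by
  obtain ⟨k, σ, P, p, q, hp, hq, h', -, -⟩ := hs
  exact fun u hu => h u (.head ⟨k, σ, P, p, q, hp, hq, h'⟩ hu)

/-! ## Linearity of proper terms -/

/-- Properness forbids sharing of free multiplicative names between sub-terms. To count indices
instead of names, at most one free name may be sent to `z`; this condition, unlike a condition on a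
single name, passes under binders that shadow. -/
theorem Expr.cnt_mul_le_one {τ : Cat} {t : Expr Empty τ} (ht : Proper t) {ρ : Ren}
    {z : Var} (hz : z.kind = .mul)
    (hρ : ∀ y ∈ t.fv, ∀ y' ∈ t.fv, act ρ y = z → act ρ y' = z → y = y') :
    cnt z (t.db ρ) ≤ 1 := by
  have key : ∀ {x : Var} {ρ : Ren} {z : Var} {s : PreTerm},
      (∀ y ∈ s.fv.erase x, ∀ y' ∈ s.fv.erase x, act ρ y = z → act ρ y' = z → y = y') →
      ∀ y ∈ s.fv, ∀ y' ∈ s.fv, act (ext ρ x) y = act (shift x.kind) z →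
        act (ext ρ x) y' = act (shift x.kind) z → y = y' := by
    intro x ρ z s h y hy y' hy' e e'
    have hx : y ≠ x := by rintro rfl; simp at e
    have hx' : y' ≠ x := by rintro rfl; simp at e'
    rw [act_ext_of_ne _ hx, shift_inj] at e
    rw [act_ext_of_ne _ hx', shift_inj] at e'
    exact h y (Finset.mem_erase.2 ⟨hx, hy⟩) y' (Finset.mem_erase.2 ⟨hx', hy'⟩) e e'
  have body : ∀ {x : Var} {ρ : Ren} {z : Var} {s : PreTerm},
      cnt (act (shift x.kind) z) (s.db (ext ρ x)) ≠ 0 → ∃ y ∈ s.fv.erase x, act ρ y = z := by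
    intro x ρ z s h
    exact (cnt_db_ne_zero (.lam x s)).1 h
  induction t generalizing ρ z with
  | hole a => exact a.elim
  | var x => simp only [db, cnt]; split_ifs <;> simp
  | lam x t ih => exact ih ht.1 hz (key hρ)
  | bang t ih => exact ih ht.1 hz hρ
  | val v ih => exact ih ht hz hρ
  | cut v x t ihv iht =>
    obtain ⟨h1, h2, h3, -⟩ := ht
    simp only [fv, Finset.mem_union] at hρ
    have a := ihv h2 hz fun y hy y' hy' => hρ y (.inl hy) y' (.inl hy')
    have b := iht (ρ := ext ρ x) (z := act (shift x.kind) z) h1 hz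
      (key fun y hy y' hy' => hρ y (.inr hy) y' (.inr hy'))
    simp only [db, cnt]
    by_contra hc
    obtain ⟨y, hy, e⟩ := (cnt_db_ne_zero v (ρ := ρ) (z := z)).1 (by omega)
    obtain ⟨y', hy', e'⟩ := body (x := x) (ρ := ρ) (z := z) (s := t) (by omega)
    obtain rfl := hρ y (.inl hy) y' (.inr hy') e e'
    obtain ⟨k, y⟩ := y
    obtain rfl : k = .mul := by rw [← e] at hz; exact hz
    exact h3 y hy hy'
  | sub m v x t ihv iht =>
    obtain ⟨h1, h2, h3, h4, h5, -⟩ := ht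
    simp only [fv, Finset.mem_union, Finset.mem_insert] at hρ
    have a := ihv h2 hz fun y hy y' hy' => hρ y (.inr (.inl hy)) y' (.inr (.inl hy'))
    have b := iht (ρ := ext ρ x) (z := act (shift x.kind) z) h1 hz
      (key fun y hy y' hy' => hρ y (.inr (.inr hy)) y' (.inr (.inr hy')))
    have hv : cnt z (v.db ρ) = 0 ∨ ∃ y ∈ v.fv, act ρ y = z := by
      rw [← cnt_db_ne_zero]; omega
    have ht : cnt (act (shift x.kind) z) (t.db (ext ρ x)) = 0 ∨
        ∃ y ∈ t.fv.erase x, act ρ y = z := by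
      by_cases h0 : cnt (act (shift x.kind) z) (t.db (ext ρ x)) = 0
      · exact .inl h0
      · exact .inr (body h0)
    have hvt : cnt z (v.db ρ) = 0 ∨ cnt (act (shift x.kind) z) (t.db (ext ρ x)) = 0 := by
      refine hv.imp_right ?_
      rintro ⟨y, hy, e⟩
      refine ht.resolve_right ?_
      rintro ⟨y', hy', e'⟩
      obtain rfl := hρ y (.inr (.inl hy)) y' (.inr (.inr hy')) e e'
      obtain ⟨k, y⟩ := y
      obtain rfl : k = .mul := by rw [← e] at hz; exact hz
      exact h3 y hy hy'
    simp only [db, cnt]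
    split_ifs with hm
    · have hv0 : cnt z (v.db ρ) = 0 := by
        refine hv.resolve_right ?_
        rintro ⟨y, hy, e⟩
        obtain rfl := hρ y (.inr (.inl hy)) (mv m) (.inl rfl) e hm
        exact h4 hy
      have ht0 := ht.resolve_right (by
        rintro ⟨y, hy, e⟩
        obtain rfl := hρ y (.inr (.inr hy)) (mv m) (.inl rfl) e hm
        exact h5 hy)
      omega
    · omega
  | der e x t iht =>
    simp only [fv, Finset.mem_insert] at hρ
    have b := iht (ρ := ext ρ x) (z := act (shift x.kind) z) ht.1 hz
      (key fun y hy y' hy' => hρ y (.inr hy) y' (.inr hy'))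
    have he : ev (ρ .exp e) ≠ z := by rintro rfl; simp at hz
    simp only [db, cnt, he, if_false]
    omega

theorem Expr.lin_of_proper {τ : Cat} {t : Expr Empty τ} (ht : Proper t) (ρ : Ren) :
    Lin (t.db ρ) := by
  have key : ∀ {x : Var} {ρ : Ren} {s : PreTerm}, Proper s → (x.kind = .mul → x ∈ s.fv) →
      x.kind = .mul → cnt ⟨x.kind, 0⟩ (s.db (ext ρ x)) = 1 := by
    intro x ρ s hs hx hk
    have h0 : cnt ⟨x.kind, 0⟩ (s.db (ext ρ x)) ≠ 0 :=
      (cnt_db_ne_zero s).2 ⟨x, hx hk, by simp⟩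
    have hself : ∀ y, act (ext ρ x) y = ⟨x.kind, 0⟩ → y = x := by
      intro y e
      by_contra hy
      simp [act_ext_of_ne _ hy] at e
    have h1 := cnt_mul_le_one hs (ρ := ext ρ x) (z := ⟨x.kind, 0⟩) hk
      fun y _ y' _ e e' => (hself y e).trans (hself y' e').symm
    omega
  induction t generalizing ρ with
  | hole a => exact a.elim
  | var x => trivial
  | lam x t ih => exact ⟨ih ht.1 _, key ht.1 ht.2⟩
  | bang t ih =>
    refine ⟨ih ht.1 _, fun m => ?_⟩
    by_contra h
    obtain ⟨⟨k, y⟩, hy, e⟩ := (cnt_db_ne_zero t).1 h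
    obtain rfl : k = .mul := congrArg Var.kind e
    exact ht.2 y hy
  | val v ih => exact ih ht _
  | cut v x t ihv iht =>
    obtain ⟨h1, h2, -, h4⟩ := ht
    exact ⟨ihv h2 _, iht h1 _, key h1 h4⟩
  | sub m v x t ihv iht =>
    obtain ⟨h1, h2, -, -, -, h4⟩ := ht
    exact ⟨ihv h2 _, iht h1 _, key h1 h4⟩
  | der e x t iht => exact ⟨iht ht.1 _, key ht.1 ht.2⟩

theorem Term.IsProper.lin {t : Term} (h : t.IsProper) : Lin t.db := by
  obtain ⟨p, rfl, hp⟩ := h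
  exact lin_of_proper hp _

/-! ## Fresh renamings -/

theorem Expr.binders_swap {H : Type} {τ : Cat} (t : Expr H τ) (κ : VKind) (i j : ℕ) :
    (t.swap κ i j).binders = t.binders.map (act (Ren.swap κ i j)) := by
  induction t <;> simp_all [Expr.swap, binders, act_swap]

theorem Expr.binders_swap_of_notMem {H : Type} {τ : Cat} {t : Expr H τ} {κ : VKind} {i j : ℕ}
    (hi : ⟨κ, i⟩ ∉ t.binders) (hj : ⟨κ, j⟩ ∉ t.binders) :
    (t.swap κ i j).binders = t.binders := by
  rw [binders_swap]
  refine (List.map_congr_left fun x hx => ?_).trans (List.map_id _)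
  exact swap_of_ne (ne_of_mem_of_not_mem hx hi) (ne_of_mem_of_not_mem hx hj)

theorem Expr.exists_renaming {τ : Cat} (t : Expr Empty τ) (X : Finset Var) :
    ∃ t', Alpha t t' ∧ t'.binders.Nodup ∧ ∀ x ∈ t'.binders, x ∉ X := by
  have key : ∀ (x : Var) (t : PreTerm) (X : Finset Var), (∀ X : Finset Var, ∃ t', Alpha t t' ∧
      t'.binders.Nodup ∧ ∀ x ∈ t'.binders, x ∉ X) → ∃ j t', Alpha t t' ∧
      (⟨x.kind, j⟩ : Var) ∉ t'.fv ∧ (⟨x.kind, j⟩ : Var) ∉ X ∧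
      (⟨x.kind, j⟩ : Var) ∉ (t'.swap x.kind x.name j).binders ∧
      (t'.swap x.kind x.name j).binders.Nodup ∧
      ∀ y ∈ (t'.swap x.kind x.name j).binders, y ∉ X := by
    intro x t X h
    -- Renaming the body away from `x` too ensures that exchanging `x` with the fresh `j` leaves the
    -- binders of the body untouched.
    obtain ⟨t', ha, hn, hX⟩ := h (insert x X)
    obtain ⟨j, hj⟩ := Var.exists_fresh (κ := x.kind) (X ∪ t'.vars)
    simp only [vars, Finset.mem_union, List.mem_toFinset, not_or] at hj
    obtain ⟨h1, h2, h3⟩ := hj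
    refine ⟨j, t', ha, h2, h1, ?_⟩
    rw [binders_swap_of_notMem (fun h => hX _ h (Finset.mem_insert_self _ _)) h3]
    exact ⟨h3, hn, fun y hy h => hX y hy (Finset.mem_insert_of_mem h)⟩
  induction t generalizing X with
  | hole a => exact a.elim
  | var x => exact ⟨_, .refl _, by simp [binders]⟩
  | lam x t ih =>
    obtain ⟨j, t', ha, h1, h2, h3, h4, h5⟩ := key x t X ih
    refine ⟨_, (Alpha.lam x ha).trans (Alpha.lam_rename _ _ j _ h1), ?_⟩
    simp only [binders, List.nodup_cons, List.forall_mem_cons]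
    exact ⟨⟨h3, h4⟩, h2, h5⟩
  | bang t ih =>
    obtain ⟨t', ha, h⟩ := ih X
    exact ⟨_, .bang ha, h⟩
  | val v ih =>
    obtain ⟨v', ha, h⟩ := ih X
    exact ⟨_, .val ha, h⟩
  | cut v x t ihv iht =>
    obtain ⟨v', hav, hv1, hv2⟩ := ihv X
    -- The body also avoids the binders just chosen for the value, so that all the bound names are
    -- distinct.
    obtain ⟨j, t', ha, h1, h2, h3, h4, h5⟩ := key x t (X ∪ v'.binders.toFinset) iht
    simp only [Finset.mem_union, List.mem_toFinset, not_or] at h2 h5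
    refine ⟨_, (Alpha.cut x hav ha).trans (Alpha.cut_rename _ _ j _ _ h1), ?_⟩
    simp only [binders, List.nodup_cons, List.forall_mem_cons, List.mem_append, not_or,
      List.nodup_append']
    exact ⟨⟨⟨h2.2, h3⟩, hv1, h4, fun y hy hy' => (h5 y hy').2 hy⟩, h2.1,
      fun y hy => hy.elim (hv2 y) fun hy => (h5 y hy).1⟩
  | sub m v x t ihv iht =>
    obtain ⟨v', hav, hv1, hv2⟩ := ihv X
    obtain ⟨j, t', ha, h1, h2, h3, h4, h5⟩ := key x t (X ∪ v'.binders.toFinset) iht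
    simp only [Finset.mem_union, List.mem_toFinset, not_or] at h2 h5
    refine ⟨_, (Alpha.sub m x hav ha).trans (Alpha.sub_rename _ _ j _ _ _ h1), ?_⟩
    simp only [binders, List.nodup_cons, List.forall_mem_cons, List.mem_append, not_or,
      List.nodup_append']
    exact ⟨⟨⟨h2.2, h3⟩, hv1, h4, fun y hy hy' => (h5 y hy').2 hy⟩, h2.1,
      fun y hy => hy.elim (hv2 y) fun hy => (h5 y hy).1⟩
  | der e x t ih =>
    obtain ⟨j, t', ha, h1, h2, h3, h4, h5⟩ := key x t X ih
    refine ⟨_, (Alpha.der e x ha).trans (Alpha.der_rename _ _ j _ _ h1), ?_⟩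
    simp only [binders, List.nodup_cons, List.forall_mem_cons]
    exact ⟨⟨h3, h4⟩, h2, h5⟩

theorem exists_freshRenaming {τ : Cat} (X : Finset Var) (t : Expr Empty τ) :
    ∃ t', FreshRenaming X t t' := by
  obtain ⟨t', ha, h1, h2⟩ := t.exists_renaming (X ∪ t.fv)
  simp only [Finset.mem_union, not_or] at h2
  exact ⟨t', ha, ⟨h1, fun x hx => ha.fv_eq ▸ (h2 x hx).2⟩, fun x hx => (h2 x hx).1⟩

theorem exists_init (t : Term) : ∃ Q, SState.Init t Q := by
  induction t using Quotient.inductionOn with | h p =>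
  obtain ⟨p', ha, hw, -⟩ := exists_freshRenaming ∅ p
  exact ⟨_, 0, p', PreTerm.toTerm_eq_iff.2 ha.symm, hw, rfl⟩

/-! ## Binders and contexts -/

section Binders

variable {H : Type} {σ τ : Cat}

/-- The binders around the hole contribute a fixed multiset, whatever is plugged. Multisets forget
the order but keep the repetitions, which is what `Nodup` needs. -/
theorem Ctx.exists_binders (K : Ctx H σ τ) : ∃ B : Multiset Var, (∀ x ∈ K.captured, x ∈ B) ∧
    ∀ r, ((K.plug r).binders : Multiset Var) = B + (r.binders : Multiset Var) := by
  induction K with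
  | hole => exact ⟨0, by simp [captured], fun r => by simp [plug]⟩
  | lam x C ih =>
    obtain ⟨B, h1, h2⟩ := ih
    refine ⟨x ::ₘ B, by simpa [captured] using fun y hy => .inr (h1 y hy), fun r => ?_⟩
    simp [plug, binders, ← Multiset.cons_coe, h2]
  | bang C ih => exact ih
  | val C ih => exact ih
  | cutL V x t ih =>
    obtain ⟨B, h1, h2⟩ := ih
    refine ⟨x ::ₘ (B + t.binders), fun y hy => by simp [h1 y hy], fun r => ?_⟩
    simp only [plug, binders, ← Multiset.cons_coe, ← Multiset.coe_add, h2,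
      Multiset.cons_add]
    rw [add_right_comm]
  | cutR v x C ih =>
    obtain ⟨B, h1, h2⟩ := ih
    refine ⟨x ::ₘ (v.binders + B), by
      simpa [captured] using fun y hy => .inr (.inr (h1 y hy)), fun r => ?_⟩
    simp only [plug, binders, ← Multiset.cons_coe, ← Multiset.coe_add, h2,
      Multiset.cons_add, add_assoc]
  | subL m V x t ih =>
    obtain ⟨B, h1, h2⟩ := ih
    refine ⟨x ::ₘ (B + t.binders), fun y hy => by simp [h1 y hy], fun r => ?_⟩
    simp only [plug, binders, ← Multiset.cons_coe, ← Multiset.coe_add, h2,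
      Multiset.cons_add]
    rw [add_right_comm]
  | subR m v x C ih =>
    obtain ⟨B, h1, h2⟩ := ih
    refine ⟨x ::ₘ (v.binders + B), by
      simpa [captured] using fun y hy => .inr (.inr (h1 y hy)), fun r => ?_⟩
    simp only [plug, binders, ← Multiset.cons_coe, ← Multiset.coe_add, h2,
      Multiset.cons_add, add_assoc]
  | der e x C ih =>
    obtain ⟨B, h1, h2⟩ := ih
    refine ⟨x ::ₘ B, by simpa [captured] using fun y hy => .inr (h1 y hy), fun r => ?_⟩
    simp [plug, binders, ← Multiset.cons_coe, h2]

theorem LCtx.exists_binders (L : LCtx H) : ∃ B : Multiset Var, (∀ x ∈ L.captured, x ∈ B) ∧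
    ∀ r, ((L.plug r).binders : Multiset Var) = B + (r.binders : Multiset Var) := by
  induction L with
  | hole => exact ⟨0, by simp [captured], fun r => by simp [plug]⟩
  | cut v x C ih =>
    obtain ⟨B, h1, h2⟩ := ih
    refine ⟨x ::ₘ (v.binders + B), by
      simpa [captured] using fun y hy => .inr (.inr (h1 y hy)), fun r => ?_⟩
    simp only [plug, binders, ← Multiset.cons_coe, ← Multiset.coe_add, h2,
      Multiset.cons_add, add_assoc]
  | sub m v x C ih =>
    obtain ⟨B, h1, h2⟩ := ih
    refine ⟨x ::ₘ (v.binders + B), by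
      simpa [captured] using fun y hy => .inr (.inr (h1 y hy)), fun r => ?_⟩
    simp only [plug, binders, ← Multiset.cons_coe, ← Multiset.coe_add, h2,
      Multiset.cons_add, add_assoc]
  | der e x C ih =>
    obtain ⟨B, h1, h2⟩ := ih
    refine ⟨x ::ₘ B, by simpa [captured] using fun y hy => .inr (h1 y hy), fun r => ?_⟩
    simp [plug, binders, ← Multiset.cons_coe, h2]

theorem Ctx.mem_fv_plug (K : Ctx H σ τ) {r : Expr H σ} {z : Var} (hz : z ∈ r.fv) :
    z ∈ (K.plug r).fv ∨ z ∈ K.captured := by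
  induction K with
  | hole => exact .inl hz
  | _ => simp_all [plug, captured, fv]; try tauto

theorem WellBound.of_plug {K : Ctx H σ τ} {r : Expr H σ} (h : WellBound (K.plug r)) :
    WellBound r := by
  obtain ⟨B, h1, h2⟩ := K.exists_binders
  obtain ⟨hn, hf⟩ := h
  rw [← Multiset.coe_nodup, h2, Multiset.nodup_add] at hn
  refine ⟨hn.2.1, fun x hx hr => ?_⟩
  have hx' : x ∈ (K.plug r).binders := by
    rw [← Multiset.mem_coe, h2, Multiset.mem_add]; exact .inr hx
  rcases K.mem_fv_plug hr with h | h
  · exact hf x hx' h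
  · exact Multiset.disjoint_left.1 hn.2.2 (h1 x h) hx

/-- In a well-bound expression a bound name is bound only once and is nowhere free, so a redex
satisfies all the side conditions on capture as it stands, without α-renaming. -/
theorem WellBound.redex {K : Ctx H .tm τ} {v : Expr H .val} {x : Var} {D : Ctx H σ .tm}
    {o : Expr H σ} (h : WellBound (K.plug (.cut v x (D.plug o)))) :
    x ∉ D.captured ∧ Disjoint D.captured v.fv ∧ x ∉ v.fv ∧ ∀ y ∈ v.binders, y ∉ o.fv := by
  obtain ⟨hn, hf⟩ := h.of_plug
  obtain ⟨B, h1, h2⟩ := D.exists_binders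
  have hb : ∀ y, y ∈ (D.plug o).binders ↔ y ∈ B ∨ y ∈ o.binders := fun y => by
    rw [← Multiset.mem_coe, h2, Multiset.mem_add, Multiset.mem_coe]
  simp only [binders, List.nodup_cons, List.mem_append, hb, not_or, List.nodup_append',
    List.forall_mem_cons, fv, Finset.mem_union] at hn hf
  obtain ⟨⟨hxv, hxB, hxo⟩, hv, -, hvd⟩ := hn
  refine ⟨fun hx => hxB (h1 x hx), Finset.disjoint_left.2 fun y hy hyv =>
    (hf.2 y (.inr (.inl (h1 y hy)))).1 hyv, hf.1.1, fun y hy hyo => ?_⟩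
  rcases D.mem_fv_plug hyo with hy' | hy'
  · refine (hf.2 y (.inl hy)).2 (Finset.mem_erase.2 ⟨?_, hy'⟩)
    rintro rfl
    exact hxv hy
  · exact hvd hy ((hb y).2 (.inl (h1 y hy')))

/-- A step preserves well-boundness as soon as it creates no free variable and each binder of the
result is either an old one, used at most once, or one of the fresh names `N` of a copy. -/
theorem WellBound.of_le {τ : Cat} {p p' : Expr H τ} (h : WellBound p) (hfv : p'.fv ⊆ p.fv)
    (N : List Var) (hN : N.Nodup) (hd : ∀ x ∈ N, x ∉ p.vars)
    (hle : (p'.binders : Multiset Var) ≤ p.binders + N) : WellBound p' := by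
  simp only [vars, Finset.mem_union, List.mem_toFinset, not_or] at hd
  constructor
  · rw [← Multiset.coe_nodup]
    refine Multiset.nodup_of_le hle (Multiset.nodup_add.2 ⟨h.1, hN, ?_⟩)
    exact Multiset.disjoint_left.2 fun hx hx' => (hd _ hx').2 hx
  · intro x hx hx'
    have := Multiset.mem_of_le hle (Multiset.mem_coe.2 hx)
    rw [Multiset.mem_add] at this
    rcases this with h' | h'
    · exact h.2 x h' (hfv hx')
    · exact (hd x h').1 (hfv hx')

end Binders

theorem Expr.split_plug (t : PreTerm) : t.split.1.plug (.val t.split.2) = t := by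
  -- The category is made a variable so that the induction applies to the whole family; the equation
  -- discards the constructors of values.
  have : ∀ {τ : Cat} (t : Expr Empty τ) (h : τ = .tm),
      t.split.1.plug (.val t.split.2) = h ▸ t := by
    intro τ t h
    induction t with
    | hole | var | lam | bang => cases h
    | val => rfl
    | cut v x t _ ih => simp [split, LCtx.plug, ih rfl]
    | sub m v x t _ ih => simp [split, LCtx.plug, ih rfl]
    | der e x t ih => simp [split, LCtx.plug, ih rfl]
  exact this t rfl

/-- Agreement is required in every environment because the binders of the context change it. This
compares a verbatim copy of a cut value with a renamed one. -/
theorem Expr.db_plug_congr {σ τ : Cat} (K : Ctx Empty σ τ) {r r' : Expr Empty σ}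
    (h : ∀ ρ, r.db ρ = r'.db ρ) (ρ : Ren) : (K.plug r).db ρ = (K.plug r').db ρ := by
  induction K generalizing ρ with
  | hole => exact h ρ
  | _ => simp_all [Ctx.plug, db]

/-! ## Multi-contexts and pools -/

/-- The inclusion of values and terms in terms. -/
def Expr.toTm {H : Type} : {τ : Cat} → Expr H τ → Expr H .tm
  | .val, v => .val v
  | .tm, t => t

section Emb

variable {τ : Cat}

@[simp] theorem Expr.holes_emb (t : Expr Empty τ) : t.emb.holes = [] := by
  induction t with
  | hole a => exact a.elim
  | _ => simp_all [emb, holes]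

@[simp] theorem Expr.fv_emb (t : Expr Empty τ) : t.emb.fv = t.fv := by
  induction t with
  | hole a => exact a.elim
  | _ => simp_all [emb, fv]

@[simp] theorem Expr.binders_emb (t : Expr Empty τ) : t.emb.binders = t.binders := by
  induction t with
  | hole a => exact a.elim
  | _ => simp_all [emb, binders]

theorem Expr.close_emb (t : Expr Empty τ) : t.emb.close = some t := by
  induction t with
  | hole a => exact a.elim
  | _ => simp_all [emb, close]

theorem Expr.emb_injective : Function.Injective (Expr.emb (τ := τ)) := fun t s h => by
  simpa [close_emb] using congrArg Expr.close h

theorem Expr.fill_of_notMem {t : Expr Name τ} {a : Name} (h : a ∉ t.holes) (u : MCtx) :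
    t.fill a u = t.toTm := by
  induction t with
  | hole b =>
    have : b ≠ a := by rintro rfl; simp [holes] at h
    simp [fill, this, toTm]
  | _ => simp_all [fill, toTm, holes, split, LCtx.plug]

end Emb

/-- No occurrence outside the left sub-terms of cuts is in `S` or in the scope of a cut on
a variable of the same name. -/
def Expr.Searched {H : Type} : {τ : Cat} → Set Var → Expr H τ → Prop
  | _, _, .hole _ => True
  | _, S, .var x => x ∉ S
  | _, S, .lam _ t => t.Searched S
  | _, S, .bang t => t.Searched S
  | _, S, .val v => v.Searched S
  | _, S, .cut _ x t => t.Searched (insert x S)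
  | _, S, .sub m v _ t => mv m ∉ S ∧ v.Searched S ∧ t.Searched S
  | _, S, .der e _ t => ev e ∉ S ∧ t.Searched S

theorem Expr.Searched.mono {H : Type} {τ : Cat} {t : Expr H τ} {S S' : Set Var}
    (h : t.Searched S) (hS : S' ⊆ S) : t.Searched S' := by
  induction t generalizing S S' with
  | hole a => trivial
  | var x => exact fun hx => h (hS hx)
  | lam x t ih => exact ih h hS
  | bang t ih => exact ih h hS
  | val v ih => exact ih h hS
  | cut v x t _ ih => exact ih h (Set.insert_subset_insert hS)
  | sub m v x t ihv iht => exact ⟨fun hx => h.1 (hS hx), ihv h.2.1 hS, iht h.2.2 hS⟩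
  | der e x t ih => exact ⟨fun hx => h.1 (hS hx), ih h.2 hS⟩

theorem Expr.Searched.plug {H : Type} {τ : Cat} {K : Ctx H .tm τ} {r r' : Expr H .tm}
    {S : Set Var} (hr : ∀ S, r.Searched S → r'.Searched S) (h : (K.plug r).Searched S) :
    (K.plug r').Searched S := by
  induction K generalizing S with
  | hole => exact hr S h
  | lam x C ih => exact ih h
  | bang C ih => exact ih h
  | val C ih => exact ih h
  | cutL V x t _ => exact h
  | cutR v x C ih => exact ih h
  | subL m V x t ih => exact ⟨h.1, ih h.2.1, h.2.2⟩
  | subR m v x C ih => exact ⟨h.1, h.2.1, ih h.2.2⟩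
  | der e x C ih => exact ⟨h.1, ih h.2⟩

/-! ### The read-back relation. -/

/-- `ReadsBack C J p`: the jobs `J` are those of the holes of `C`, from left to right,
and plugging them in `C` gives `p`. -/
inductive ReadsBack : {τ : Cat} → Expr Name τ → List (Name × PreTerm) → Expr Empty τ →
    Prop where
  | job (a : Name) (t : PreTerm) : ReadsBack (.val (.hole a)) [(a, t)] t
  | valJob (a : Name) (v : PreValue) : ReadsBack (.hole a) [(a, .val v)] v
  | var (x : Var) : ReadsBack (.var x) [] (.var x)
  | lam (x : Var) {t : MCtx} {J : List (Name × PreTerm)} {t' : PreTerm} :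
      ReadsBack t J t' → ReadsBack (.lam x t) J (.lam x t')
  | bang {t : MCtx} {J : List (Name × PreTerm)} {t' : PreTerm} :
      ReadsBack t J t' → ReadsBack (.bang t) J (.bang t')
  | val {v : Expr Name .val} {J : List (Name × PreTerm)} {v' : PreValue} :
      ReadsBack v J v' → ReadsBack (.val v) J (.val v')
  | cut (v : PreValue) (x : Var) {t : MCtx} {J : List (Name × PreTerm)} {t' : PreTerm} :
      ReadsBack t J t' → ReadsBack (.cut v.emb x t) J (.cut v x t')
  | sub (m : ℕ) (x : Var) {v : Expr Name .val} {t : MCtx} {J₁ J₂ : List (Name × PreTerm)}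
      {v' : PreValue} {t' : PreTerm} : ReadsBack v J₁ v' → ReadsBack t J₂ t' →
      ReadsBack (.sub m v x t) (J₁ ++ J₂) (.sub m v' x t')
  | der (e : ℕ) (x : Var) {t : MCtx} {J : List (Name × PreTerm)} {t' : PreTerm} :
      ReadsBack t J t' → ReadsBack (.der e x t) J (.der e x t')

namespace ReadsBack

variable {τ : Cat} {C : Expr Name τ} {J : List (Name × PreTerm)} {p : Expr Empty τ}

theorem emb (t : Expr Empty τ) : ReadsBack t.emb [] t := by
  induction t with
  | hole a => exact a.elim
  | var x => exact .var x
  | lam x t ih => exact .lam x ih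
  | bang t ih => exact .bang ih
  | val v ih => exact .val ih
  | cut v x t _ ih => exact .cut v x ih
  | sub m v x t ihv ih => exact .sub m x ihv ih
  | der e x t ih => exact .der e x ih

theorem holes_eq (h : ReadsBack C J p) : C.holes = J.map Prod.fst := by
  induction h <;> simp_all [holes]

theorem close_eq (h : ReadsBack C J p) (hJ : J = []) : C.close = some p := by
  induction h <;> simp_all [close, close_emb]

theorem mem_fv (h : ReadsBack C J p) {x : Var} (hx : x ∈ p.fv) :
    x ∈ C.fv ∨ ∃ j ∈ J, x ∈ j.2.fv := by
  induction h with
  | job a t => exact .inr ⟨(a, t), by simp, hx⟩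
  | valJob a v => exact .inr ⟨(a, .val v), by simp, hx⟩
  | var => exact .inl hx
  | bang _ ih => exact ih hx
  | val _ ih => exact ih hx
  | lam y _ ih =>
    rw [fv, Finset.mem_erase] at hx ⊢
    exact (ih hx.2).imp_left (.intro hx.1)
  | cut v y _ ih =>
    rw [fv, Finset.mem_union, Finset.mem_erase] at hx ⊢
    rcases hx with hx | hx
    · exact .inl (.inl (by simpa using hx))
    · exact (ih hx.2).imp_left fun h => .inr ⟨hx.1, h⟩
  | sub m y _ _ ihv ihs =>
    rw [fv, Finset.mem_insert, Finset.mem_union, Finset.mem_erase] at hx ⊢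
    rcases hx with hx | hx | hx
    · exact .inl (.inl hx)
    · exact (ihv hx).imp (fun h => .inr (.inl h))
        fun ⟨j, hj, h⟩ => ⟨j, List.mem_append_left _ hj, h⟩
    · exact (ihs hx.2).imp (fun h => .inr (.inr ⟨hx.1, h⟩))
        fun ⟨j, hj, h⟩ => ⟨j, List.mem_append_right _ hj, h⟩
  | der e y _ ih =>
    rw [fv, Finset.mem_insert, Finset.mem_erase] at hx ⊢
    rcases hx with hx | hx
    · exact .inl (.inl hx)
    · exact (ih hx.2).imp_left fun h => .inr ⟨hx.1, h⟩

theorem mem_binders (h : ReadsBack C J p) {x : Var} (hx : x ∈ p.binders) :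
    x ∈ C.binders ∨ ∃ j ∈ J, x ∈ j.2.binders := by
  induction h with
  | job a t => exact .inr ⟨(a, t), by simp, hx⟩
  | valJob a v => exact .inr ⟨(a, .val v), by simp, hx⟩
  | var => exact .inl hx
  | bang _ ih => exact ih hx
  | val _ ih => exact ih hx
  | cut v y _ ih =>
    rw [binders, List.mem_cons, List.mem_append] at hx ⊢
    rcases hx with hx | hx | hx
    · exact .inl (.inl hx)
    · exact .inl (.inr (.inl (by simpa using hx)))
    · exact (ih hx).imp_left fun h => .inr (.inr h)
  | sub m y _ _ ihv ihs =>
    rw [binders, List.mem_cons, List.mem_append] at hx ⊢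
    rcases hx with hx | hx | hx
    · exact .inl (.inl hx)
    · exact (ihv hx).imp (fun h => .inr (.inl h))
        fun ⟨j, hj, h⟩ => ⟨j, List.mem_append_left _ hj, h⟩
    · exact (ihs hx).imp (fun h => .inr (.inr h))
        fun ⟨j, hj, h⟩ => ⟨j, List.mem_append_right _ hj, h⟩
  | lam y _ ih | der e y _ ih =>
    rw [binders, List.mem_cons] at hx ⊢
    rcases hx with hx | hx
    · exact .inl (.inl hx)
    · exact (ih hx).imp_left .inr

theorem binders_subset (h : ReadsBack C J p) {x : Var} (hx : x ∈ C.binders) :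
    x ∈ p.binders := by
  induction h with
  | job | valJob | var => simp [binders] at hx
  | bang _ ih => exact ih hx
  | val _ ih => exact ih hx
  | cut v y _ ih =>
    rw [binders, List.mem_cons, List.mem_append, binders_emb] at hx
    rw [binders, List.mem_cons, List.mem_append]
    exact hx.imp_right (Or.imp_right ih)
  | sub m y _ _ ihv ihs =>
    rw [binders, List.mem_cons, List.mem_append] at hx ⊢
    exact hx.imp_right (Or.imp ihv ihs)
  | lam y _ ih | der e y _ ih =>
    rw [binders, List.mem_cons] at hx ⊢
    exact hx.imp_right ih

/-- What is free in a job is free in the read-back unless a binder around its hole captures it. With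
distinct binders this locates a job relative to the cut that binds its variable. -/
theorem mem_fv_of_job (h : ReadsBack C J p) {j : Name × PreTerm} (hj : j ∈ J) {x : Var}
    (hx : x ∈ j.2.fv) : x ∈ p.fv ∨ x ∈ p.binders := by
  induction h with
  | sub m x _ _ ih₁ ih₂ =>
    simp only [List.mem_append] at hj
    simp only [fv, binders, Finset.mem_insert, Finset.mem_union, Finset.mem_erase,
      List.mem_cons, List.mem_append]
    rcases hj with hj | hj
    · have := ih₁ hj; tauto
    · have := ih₂ hj; tauto
  | _ => simp_all [fv, binders]; try tauto

/-- The job at the left of a subtraction is a value, and whatever is plugged for it during the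
search is still a value. The splitting performed by `Expr.fill` at subtractions is therefore
trivial. -/
theorem val_inv {U : MCtx} {v : PreValue} (h : ReadsBack U J (.val v)) :
    ∃ u, U = .val u ∧ ReadsBack u J v := by
  cases h with
  | job a t => exact ⟨_, rfl, .valJob a v⟩
  | val h => exact ⟨_, rfl, h⟩

/-- The order of the pool is the left-to-right order of the holes, so replacing the first job by
`J'` keeps the two aligned. The path to the hole only crosses cuts whose variables are in the
domain, as these cuts have that hole in their scope; hence it suffices that `U` avoids the domain.
-/
theorem fill (h : ReadsBack C J p) {a : Name} {t : PreTerm} {J₀ J' : List (Name × PreTerm)}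
    (hJ : J = (a, t) :: J₀) (ha : a ∉ J₀.map Prod.fst) {U : MCtx} (hU : ReadsBack U J' t) :
    ReadsBack (C.fill a U) (J' ++ J₀) p.toTm ∧
      ∀ S : Set Var, C.Searched S → U.Searched (S ∪ C.dom) → (C.fill a U).Searched S := by
  induction h generalizing J₀ with
  | job b s =>
    obtain ⟨⟨rfl, rfl⟩, rfl⟩ : (b = a ∧ s = t) ∧ [] = J₀ := by simpa using hJ
    simpa [Expr.fill, toTm, dom] using hU
  | valJob b v =>
    obtain ⟨⟨rfl, rfl⟩, rfl⟩ : (b = a ∧ .val v = t) ∧ [] = J₀ := by simpa using hJ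
    simpa [Expr.fill, toTm, dom] using hU
  | var x => simp at hJ
  | lam x _ ih =>
    obtain ⟨h1, h2⟩ := ih hJ ha
    exact ⟨.val (.lam x h1), h2⟩
  | bang _ ih =>
    obtain ⟨h1, h2⟩ := ih hJ ha
    exact ⟨.val (.bang h1), h2⟩
  | val _ ih => exact ih hJ ha
  | @cut v x s J s' h ih =>
    obtain ⟨h1, h2⟩ := ih hJ ha
    rw [Expr.fill, fill_of_notMem (by simp)]
    refine ⟨.cut v x h1, fun S hS hUS => h2 _ hS (hUS.mono ?_)⟩
    have : dom (.cut v.emb x s) = insert x s.dom :=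
      if_neg (by rw [h.holes_eq, hJ]; simp)
    rw [this, Finset.coe_insert, Set.insert_union, Set.union_insert]
  | @sub m x v s J₁ J₂ v' s' hv hs ihv ihs =>
    rw [Expr.fill]
    rcases J₁ with _ | ⟨j, J₁⟩
    · obtain ⟨h1, h2⟩ := ihs hJ ha
      rw [fill_of_notMem (t := v) (by simp [hv.holes_eq])]
      refine ⟨ReadsBack.sub m x (J₁ := []) (J₂ := J' ++ J₀) hv h1,
        fun S hS hUS => ⟨hS.1, hS.2.1, h2 S hS.2.2 (hUS.mono ?_)⟩⟩
      simp only [dom, Finset.coe_union]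
      exact Set.union_subset_union_right _ Set.subset_union_right
    · obtain ⟨rfl, rfl⟩ : j = (a, t) ∧ J₁ ++ J₂ = J₀ := by simpa using hJ
      rw [List.map_append, List.mem_append, not_or] at ha
      obtain ⟨h1, h2⟩ := ihv rfl ha.1
      obtain ⟨w, hw, h1'⟩ := h1.val_inv
      rw [fill_of_notMem (t := s) (by rw [hs.holes_eq]; exact ha.2), hw, ← List.append_assoc]
      refine ⟨.sub m x h1' hs, fun S hS hUS => ⟨hS.1, ?_, hS.2.2⟩⟩
      rw [hw] at h2
      refine h2 S hS.2.1 (hUS.mono ?_)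
      simp only [dom, Finset.coe_union]
      exact Set.union_subset_union_right _ Set.subset_union_left
  | der e x _ ih =>
    obtain ⟨h1, h2⟩ := ih hJ ha
    exact ⟨.der e x h1, fun S hS hUS => ⟨hS.1, h2 S hS.2 hUS⟩⟩

theorem readBack {C : MCtx} {p : PreTerm} (h : ReadsBack C J p)
    (hn : (J.map Prod.fst).Nodup) :
    (J.foldl (fun C j => C.fill j.1 j.2.emb) C).close = some p := by
  induction J generalizing C with
  | nil => exact h.close_eq rfl
  | cons j J ih =>
    rw [List.map_cons, List.nodup_cons] at hn
    exact ih (h.fill rfl hn.1 (.emb j.2)).1 hn.2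

/-- `Searched` compares names and never removes one from its set, while in `Nrm` the binders other
than cuts hide the outer variable of the same name. The former is thus the stronger condition. -/
theorem nrm (h : ReadsBack C J p) (hJ : J = []) {S T : Set Var} (hS : C.Searched S) {ρ : Ren}
    (hT : ∀ y, act ρ y ∈ T → y ∈ S) : Nrm T (p.db ρ) := by
  have key : ∀ {x : Var} {S T : Set Var} {ρ : Ren}, (∀ y, act ρ y ∈ T → y ∈ S) →
      ∀ y, act (ext ρ x) y ∈ lift x.kind False T → y ∈ S := by
    intro x S T ρ h y
    by_cases e : y = x
    · subst e; simp
    · simpa [act_ext_of_ne _ e] using h y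
  induction h generalizing S T ρ with
  | job | valJob => simp at hJ
  | var x => exact fun h => hS (hT x h)
  | lam x _ ih => exact ih hJ hS (key hT)
  | bang _ ih => exact ih hJ hS hT
  | val _ ih => exact ih hJ hS hT
  | cut v x _ ih =>
    refine ih hJ hS fun y hy => ?_
    by_cases e : y = x
    · exact .inl e
    · exact .inr (hT y (by simpa [act_ext_of_ne _ e] using hy))
  | sub m x _ _ ihv ihs =>
    rw [List.append_eq_nil_iff] at hJ
    exact ⟨fun h => hS.1 (hT (mv m) h), ihv hJ.1 hS.2.1 hT, ihs hJ.2 hS.2.2 (key hT)⟩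
  | der e x _ ih => exact ⟨fun h => hS.1 (hT (ev e) h), ih hJ hS.2 (key hT)⟩

/-- The cut is exhibited twice: in the multi-context, where it enables a principal transition, and
in the read-back, where it would be a clash if the kinds did not match. -/
theorem exists_of_mem_dom (h : ReadsBack C J p) {x : Var} (hx : x ∈ C.dom) :
    ∃ (K : Ctx Name .tm τ) (v : PreValue) (D : MCtx) (K' : Ctx Empty .tm τ) (q : PreTerm),
      C = K.plug (.cut v.emb x D) ∧ p = K'.plug (.cut v x q) := by
  induction h with
  | job | valJob | var => simp [dom] at hx
  | lam y _ ih =>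
    obtain ⟨K, v, D, K', q, rfl, rfl⟩ := ih hx
    exact ⟨.lam y K, v, D, .lam y K', q, rfl, rfl⟩
  | bang _ ih =>
    obtain ⟨K, v, D, K', q, rfl, rfl⟩ := ih hx
    exact ⟨.bang K, v, D, .bang K', q, rfl, rfl⟩
  | val _ ih =>
    obtain ⟨K, v, D, K', q, rfl, rfl⟩ := ih hx
    exact ⟨.val K, v, D, .val K', q, rfl, rfl⟩
  | @cut w y t J t' h ih =>
    simp only [dom] at hx
    split_ifs at hx with h0
    · simp at hx
    · rw [Finset.mem_insert] at hx
      by_cases e : x = y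
      · subst e
        exact ⟨.hole, w, t, .hole, t', rfl, rfl⟩
      · obtain ⟨K, v, D, K', q, rfl, rfl⟩ := ih (hx.resolve_left e)
        exact ⟨.cutR w.emb y K, v, D, .cutR w y K', q, rfl, rfl⟩
  | @sub m y v₁ t₁ _ _ v₁' t₁' _ _ ihv ihs =>
    simp only [dom, Finset.mem_union] at hx
    rcases hx with hx | hx
    · obtain ⟨K, v, D, K', q, rfl, rfl⟩ := ihv hx
      exact ⟨.subL m K y t₁, v, D, .subL m K' y t₁', q, rfl, rfl⟩
    · obtain ⟨K, v, D, K', q, rfl, rfl⟩ := ihs hx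
      exact ⟨.subR m v₁ y K, v, D, .subR m v₁' y K', q, rfl, rfl⟩
  | der e y _ ih =>
    obtain ⟨K, v, D, K', q, rfl, rfl⟩ := ih hx
    exact ⟨.der e y K, v, D, .der e y K', q, rfl, rfl⟩

/-- The context of the first job. -/
theorem exists_focus {σ : Cat} (h : ReadsBack C J p) {a : Name} {w : Expr Empty σ}
    (hw : σ = .val ∨ ∀ v, w.toTm ≠ .val v) {J₀ : List (Name × PreTerm)}
    (hJ : J = (a, w.toTm) :: J₀) :
    ∃ E : Ctx Empty σ τ, p = E.plug w ∧
      (∀ w' : Expr Empty σ, ReadsBack C ((a, w'.toTm) :: J₀) (E.plug w')) ∧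
      ∀ S : Set Var, C.Searched S → E.Good ∧ ∀ y ∈ E.dfv, y ∉ S := by
  induction h generalizing J₀ with
  | job b s =>
    obtain ⟨⟨rfl, rfl⟩, rfl⟩ : (b = a ∧ s = w.toTm) ∧ [] = J₀ := by simpa using hJ
    cases σ with
    | tm => exact ⟨.hole, rfl, fun w' => .job _ _, fun S _ => ⟨trivial, by simp [Ctx.dfv]⟩⟩
    | val =>
      exact ⟨.val .hole, rfl, fun w' => .job _ _, fun S _ => ⟨trivial, by simp [Ctx.dfv]⟩⟩
  | valJob b v =>
    obtain ⟨⟨rfl, hv⟩, rfl⟩ : (b = a ∧ .val v = w.toTm) ∧ [] = J₀ := by simpa using hJ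
    -- A hole in value position only holds values, so the focus on a proper term is impossible here;
    -- `hw` separates the two cases.
    obtain rfl := hw.resolve_right fun h => h v hv.symm
    obtain rfl : v = w := by simpa [toTm] using hv
    exact ⟨.hole, rfl, fun w' => .valJob _ _, fun S _ => ⟨trivial, by simp [Ctx.dfv]⟩⟩
  | var x => simp at hJ
  | lam x _ ih =>
    obtain ⟨E, rfl, h1, h2⟩ := ih hJ
    exact ⟨.lam x E, rfl, fun w' => .lam x (h1 w'), fun S hS =>
      ⟨(h2 S hS).1, fun y hy => (h2 S hS).2 y (Finset.mem_of_mem_erase hy)⟩⟩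
  | bang _ ih =>
    obtain ⟨E, rfl, h1, h2⟩ := ih hJ
    exact ⟨.bang E, rfl, fun w' => .bang (h1 w'), h2⟩
  | val _ ih =>
    obtain ⟨E, rfl, h1, h2⟩ := ih hJ
    exact ⟨.val E, rfl, fun w' => .val (h1 w'), h2⟩
  | cut v x _ ih =>
    obtain ⟨E, rfl, h1, h2⟩ := ih hJ
    refine ⟨.cutR v x E, rfl, fun w' => .cut v x (h1 w'), fun S hS => ?_⟩
    obtain ⟨hG, hd⟩ := h2 _ hS
    exact ⟨⟨hG, fun hx => hd x hx (Set.mem_insert _ _)⟩,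
      fun y hy hyS => hd y (Finset.mem_of_mem_erase hy) (Set.mem_insert_of_mem _ hyS)⟩
  | @sub m x v s J₁ J₂ v' s' hv hs ihv ihs =>
    rcases J₁ with _ | ⟨j, J₁⟩
    · obtain ⟨E, rfl, h1, h2⟩ := ihs hJ
      refine ⟨.subR m v' x E, rfl, fun w' => .sub m x hv (h1 w'), fun S hS => ?_⟩
      obtain ⟨hG, hd⟩ := h2 _ hS.2.2
      refine ⟨hG, fun y hy => ?_⟩
      simp only [Ctx.dfv] at hy
      split_ifs at hy with hx
      · rcases Finset.mem_insert.1 hy with rfl | hy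
        · exact hS.1
        · exact hd y (Finset.mem_of_mem_erase hy)
      · exact hd y hy
    · obtain ⟨rfl, rfl⟩ : j = (a, w.toTm) ∧ J₁ ++ J₂ = J₀ := by simpa using hJ
      obtain ⟨E, rfl, h1, h2⟩ := ihv rfl
      refine ⟨.subL m E x s', rfl, fun w' => .sub m x (h1 w') hs, fun S hS => ?_⟩
      obtain ⟨hG, hd⟩ := h2 _ hS.2.1
      refine ⟨hG, fun y hy => ?_⟩
      rcases Finset.mem_insert.1 hy with rfl | hy
      · exact hS.1
      · exact hd y hy
  | der e x _ ih =>
    obtain ⟨E, rfl, h1, h2⟩ := ih hJ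
    refine ⟨.der e x E, rfl, fun w' => .der e x (h1 w'), fun S hS => ?_⟩
    obtain ⟨hG, hd⟩ := h2 _ hS.2
    refine ⟨hG, fun y hy => ?_⟩
    simp only [Ctx.dfv] at hy
    split_ifs at hy with hx
    · rcases Finset.mem_insert.1 hy with rfl | hy
      · exact hS.1
      · exact hd y (Finset.mem_of_mem_erase hy)
    · exact hd y hy

end ReadsBack

/-! ### Locating the redex of a principal transition. -/

/-- The first job, if it has a free occurrence of a variable that is bound by a cut of the
multi-context and not free in the read-back, is in the scope of that cut. -/
theorem ReadsBack.exists_cut {τ : Cat} {K : Ctx Name .tm τ} {u : Expr Name .val} {x : Var}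
    {D : MCtx} {a : Name} {o : PreTerm} {P : List (Name × PreTerm)} {p : Expr Empty τ}
    (h : ReadsBack (K.plug (.cut u x D)) ((a, o) :: P) p) (hx : x ∈ o.fv) (hxp : x ∉ p.fv)
    (hn : p.binders.Nodup) :
    ∃ (K' : Ctx Empty .tm τ) (v : PreValue) (q : PreTerm) (P₁ P₂ : List (Name × PreTerm)),
      P = P₁ ++ P₂ ∧ u = v.emb ∧ p = K'.plug (.cut v x q) ∧ ReadsBack D ((a, o) :: P₁) q ∧
      (∀ X J' Y, ReadsBack X J' Y → ReadsBack (K.plug X) (J' ++ P₂) (K'.plug Y)) ∧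
      ∀ S : Set Var, (K.plug (.cut u x D)).Searched S →
        ∃ S', (Expr.cut u x D).Searched S' ∧ ∀ {σ : Cat} (E : Ctx Empty σ .tm), E.Good →
          (∀ y ∈ E.dfv, y ∉ S') → (K'.comp E).Good ∧ ∀ y ∈ (K'.comp E).dfv, y ∉ S := by
  have hmem : ∀ {τ : Cat} (K : Ctx Name .tm τ), x ∈ (K.plug (.cut u x D)).binders := by
    intro τ K
    obtain ⟨B, -, h2⟩ := K.exists_binders
    rw [← Multiset.mem_coe, h2, Multiset.mem_add]
    exact .inr (by simp [binders])
  generalize hC : K.plug (.cut u x D) = C at h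
  generalize hJ : (a, o) :: P = J at h
  induction h generalizing P with
  | job b s =>
    cases K <;> simp only [Ctx.plug, reduceCtorEq, Expr.val.injEq] at hC
    rename_i K
    cases K <;> simp [Ctx.plug] at hC
  | valJob b v => cases K <;> simp [Ctx.plug] at hC
  | var y => cases K <;> simp [Ctx.plug] at hC
  | @lam y t J t' ht ih =>
    cases K <;> simp only [Ctx.plug, reduceCtorEq, Expr.lam.injEq] at hC
    rename_i y' K
    obtain ⟨rfl, rfl⟩ := hC
    rw [binders, List.nodup_cons] at hn
    have hxy : x ≠ y' := by rintro rfl; exact hn.1 (ht.binders_subset (hmem K))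
    obtain ⟨K', v, q, P₁, P₂, h1, h2, rfl, h4, h5, h6⟩ :=
      ih (fun h => hxp (by simp [fv, hxy, h])) hn.2 rfl hJ
    refine ⟨.lam y' K', v, q, P₁, P₂, h1, h2, rfl, h4, fun X J' Y h => .lam _ (h5 X J' Y h),
      fun S hS => ?_⟩
    obtain ⟨S', hS', hE⟩ := h6 S hS
    exact ⟨S', hS', fun E hG hd => ⟨(hE E hG hd).1,
      fun z hz => (hE E hG hd).2 z (Finset.mem_of_mem_erase hz)⟩⟩
  | @bang t J t' ht ih =>
    cases K <;> simp only [Ctx.plug, reduceCtorEq, Expr.bang.injEq] at hC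
    rename_i K
    subst hC
    obtain ⟨K', v, q, P₁, P₂, h1, h2, rfl, h4, h5, h6⟩ := ih hxp hn rfl hJ
    exact ⟨.bang K', v, q, P₁, P₂, h1, h2, rfl, h4, fun X J' Y h => .bang (h5 X J' Y h), h6⟩
  | @val t J t' ht ih =>
    cases K <;> simp only [Ctx.plug, reduceCtorEq, Expr.val.injEq] at hC
    rename_i K
    subst hC
    obtain ⟨K', v, q, P₁, P₂, h1, h2, rfl, h4, h5, h6⟩ := ih hxp hn rfl hJ
    exact ⟨.val K', v, q, P₁, P₂, h1, h2, rfl, h4, fun X J' Y h => .val (h5 X J' Y h), h6⟩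
  | @cut w y t J t' ht ih =>
    rw [binders, List.nodup_cons, List.mem_append, not_or, List.nodup_append'] at hn
    obtain ⟨⟨hyw, hyt⟩, -, hnt, hd⟩ := hn
    rw [fv, Finset.mem_union, Finset.mem_erase] at hxp
    cases K <;> simp only [Ctx.plug, reduceCtorEq, Expr.cut.injEq] at hC
    case hole =>
      obtain ⟨rfl, rfl, rfl⟩ := hC
      subst hJ
      refine ⟨.hole, w, t', P, [], by simp, rfl, rfl, ht, fun X J' Y h => by simpa [Ctx.plug] using h,
        fun S hS => ⟨S, hS, fun E hG hd => ⟨hG, hd⟩⟩⟩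
    case cutL K y' s =>
      -- The cut on `x` cannot lie inside the value `w`: the job is in the body, so its `x` would be
      -- free in the read-back or bound a second time.
      exfalso
      obtain ⟨hw, rfl, rfl⟩ := hC
      have hxw : x ∈ w.binders := by
        have := hmem K
        rwa [hw, binders_emb] at this
      have hxy : x ≠ y' := by rintro rfl; exact hyw hxw
      rcases ht.mem_fv_of_job (j := (a, o)) (by simp [← hJ]) hx with h | h
      · exact hxp (.inr ⟨hxy, h⟩)
      · exact hd hxw h
    case cutR w' y' K =>
      obtain ⟨rfl, rfl, rfl⟩ := hC
      have hxt := ht.binders_subset (hmem K)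
      have hxy : x ≠ y' := by rintro rfl; exact hyt hxt
      obtain ⟨K', v, q, P₁, P₂, h1, h2, rfl, h4, h5, h6⟩ :=
        ih (fun h => hxp (.inr ⟨hxy, h⟩)) hnt rfl hJ
      refine ⟨.cutR w y' K', v, q, P₁, P₂, h1, h2, rfl, h4,
        fun X J' Y h => .cut _ _ (h5 X J' Y h), fun S hS => ?_⟩
      obtain ⟨S', hS', hE⟩ := h6 _ hS
      refine ⟨S', hS', fun E hG hd => ?_⟩
      obtain ⟨h7, h8⟩ := hE E hG hd
      exact ⟨⟨h7, fun h => h8 _ h (Set.mem_insert _ _)⟩, fun z hz hzS =>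
        h8 z (Finset.mem_of_mem_erase hz) (Set.mem_insert_of_mem _ hzS)⟩
  | @sub m y w t J₁ J₂ w' t' hw ht ihw iht =>
    rw [binders, List.nodup_cons, List.mem_append, not_or, List.nodup_append'] at hn
    obtain ⟨⟨hyw, hyt⟩, hnw, hnt, hd⟩ := hn
    rw [fv, Finset.mem_insert, Finset.mem_union, Finset.mem_erase, not_or, not_or] at hxp
    obtain ⟨hxm, hxw, hxt⟩ := hxp
    cases K <;> simp only [Ctx.plug, reduceCtorEq, Expr.sub.injEq] at hC
    case subL m' K y' s =>
      obtain ⟨rfl, rfl, rfl, rfl⟩ := hC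
      have hb := hw.binders_subset (hmem K)
      rcases J₁ with _ | ⟨j, J₁⟩
      -- The cut is in the left sub-term, but the first job comes from the right one, outside its
      -- scope; a second binder `x` would be needed.
      · exfalso
        have hxy : x ≠ y' := by rintro rfl; exact hyw hb
        rcases ht.mem_fv_of_job (j := (a, o)) (by rw [List.nil_append] at hJ; simp [← hJ]) hx
          with h | h
        · exact hxt ⟨hxy, h⟩
        · exact hd hb h
      · obtain ⟨rfl, rfl⟩ : (a, o) = j ∧ P = J₁ ++ J₂ := by simpa using hJ
        obtain ⟨K', v, q, P₁, P₂, rfl, h2, rfl, h4, h5, h6⟩ := ihw hxw hnw rfl rfl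
        refine ⟨.subL m' K' y' t', v, q, P₁, P₂ ++ J₂, by simp, h2, rfl, h4,
          fun X J' Y h => ?_, fun S hS => ?_⟩
        · rw [← List.append_assoc]
          exact .sub _ _ (h5 X J' Y h) ht
        · obtain ⟨S', hS', hE⟩ := h6 _ hS.2.1
          refine ⟨S', hS', fun E hG hd => ?_⟩
          obtain ⟨h7, h8⟩ := hE E hG hd
          refine ⟨h7, fun z hz => ?_⟩
          rcases Finset.mem_insert.1 hz with rfl | hz
          · exact hS.1
          · exact h8 z hz
    case subR m' w₀ y' K =>
      obtain ⟨rfl, rfl, rfl, rfl⟩ := hC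
      have hb := ht.binders_subset (hmem K)
      have hxy : x ≠ y' := by rintro rfl; exact hyt hb
      rcases J₁ with _ | ⟨j, J₁⟩
      · obtain ⟨K', v, q, P₁, P₂, rfl, h2, rfl, h4, h5, h6⟩ :=
          iht (fun h => hxt ⟨hxy, h⟩) hnt rfl hJ
        refine ⟨.subR m' w' y' K', v, q, P₁, P₂, rfl, h2, rfl, h4,
          fun X J' Y h => .sub (J₁ := []) _ _ hw (h5 X J' Y h), fun S hS => ?_⟩
        obtain ⟨S', hS', hE⟩ := h6 _ hS.2.2
        refine ⟨S', hS', fun E hG hd => ?_⟩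
        obtain ⟨h7, h8⟩ := hE E hG hd
        refine ⟨h7, fun z hz => ?_⟩
        simp only [Ctx.comp, Ctx.dfv] at hz
        split_ifs at hz with hy
        · rcases Finset.mem_insert.1 hz with rfl | hz
          · exact hS.1
          · exact h8 z (Finset.mem_of_mem_erase hz)
        · exact h8 z hz
      -- The cut is in the right sub-term, but the first job comes from the left one; again `x`
      -- would be free or bound twice.
      · exfalso
        rcases hw.mem_fv_of_job (j := (a, o)) (by
          obtain ⟨rfl, -⟩ : (a, o) = j ∧ P = J₁ ++ J₂ := by simpa using hJ
          simp) hx with h | h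
        · exact hxw h
        · exact hd h hb
  | @der e y t J t' ht ih =>
    cases K <;> simp only [Ctx.plug, reduceCtorEq, Expr.der.injEq] at hC
    rename_i e' y' K
    obtain ⟨rfl, rfl, rfl⟩ := hC
    rw [binders, List.nodup_cons] at hn
    rw [fv, Finset.mem_insert, Finset.mem_erase, not_or] at hxp
    have hxy : x ≠ y' := by rintro rfl; exact hn.1 (ht.binders_subset (hmem K))
    obtain ⟨K', v, q, P₁, P₂, h1, h2, rfl, h4, h5, h6⟩ :=
      ih (fun h => hxp.2 ⟨hxy, h⟩) hn.2 rfl hJ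
    refine ⟨.der e' y' K', v, q, P₁, P₂, h1, h2, rfl, h4,
      fun X J' Y h => .der _ _ (h5 X J' Y h), fun S hS => ?_⟩
    obtain ⟨S', hS', hE⟩ := h6 S hS.2
    refine ⟨S', hS', fun E hG hd => ?_⟩
    obtain ⟨h7, h8⟩ := hE E hG hd
    refine ⟨h7, fun z hz => ?_⟩
    simp only [Ctx.comp, Ctx.dfv] at hz
    split_ifs at hz with hy
    · rcases Finset.mem_insert.1 hz with rfl | hz
      · exact hS.1
      · exact h8 z (Finset.mem_of_mem_erase hz)
    · exact h8 z hz

/-! ## The invariant of SESAME -/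

/-- The pre-term `p` is the read-back of the state `Q`, whose multi-context has been
completely searched. -/
structure SState.Inv (Q : SState) (p : PreTerm) : Prop where
  readsBack : ReadsBack Q.mctx Q.pool p
  wellBound : WellBound p
  nodup : (Q.pool.map Prod.fst).Nodup
  searched : Q.mctx.Searched ∅
  lin : Lin (p.db idEnv)

/-- The redex of a principal transition. -/
theorem ReadsBack.exists_redex {σ : Cat} {K : Ctx Name .tm .tm} {u : Expr Name .val} {x : Var}
    {D : MCtx} {a : Name} {w : Expr Empty σ} {P : List (Name × PreTerm)} {p : PreTerm}
    (hw : σ = .val ∨ ∀ v, w.toTm ≠ .val v) (hx : x ∈ w.toTm.fv)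
    (h : SState.Inv ⟨K.plug (.cut u x D), (a, w.toTm) :: P⟩ p) :
    ∃ (K' : Ctx Empty .tm .tm) (v : PreValue) (E : Ctx Empty σ .tm),
      u = v.emb ∧ p = K'.plug (.cut v x (E.plug w)) ∧ (K'.comp (.cutR v x E)).Good ∧
      (∀ w' : Expr Empty σ,
        ReadsBack (K.plug D) ((a, w'.toTm) :: P) (K'.plug (E.plug w'))) ∧
      ∀ w' : Expr Empty σ, ReadsBack (K.plug (.cut u x D)) ((a, w'.toTm) :: P)
        (K'.plug (.cut v x (E.plug w'))) := by
  have hxp : x ∉ p.fv := by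
    refine h.wellBound.2 x (h.readsBack.binders_subset ?_)
    obtain ⟨B, -, h2⟩ := K.exists_binders
    change x ∈ (K.plug (.cut u x D)).binders
    rw [← Multiset.mem_coe, h2, Multiset.mem_add]
    exact .inr (by simp [binders])
  obtain ⟨K', v, q, P₁, P₂, rfl, rfl, rfl, h4, h5, h6⟩ :=
    h.readsBack.exists_cut hx hxp h.wellBound.1
  obtain ⟨E, rfl, h7, h8⟩ := h4.exists_focus hw rfl
  refine ⟨K', v, E, rfl, rfl, ?_, fun w' => h5 _ _ _ (h7 w'),
    fun w' => h5 _ _ _ (.cut v x (h7 w'))⟩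
  obtain ⟨S', hS', hE⟩ := h6 ∅ h.searched
  obtain ⟨hG, hd⟩ := h8 _ hS'
  exact (hE (.cutR v x E) ⟨hG, fun hx => hd x hx (Set.mem_insert _ _)⟩
    fun y hy hyS => hd y (Finset.mem_of_mem_erase hy) (Set.mem_insert_of_mem _ hyS)).1

theorem SState.mem_vars_pool {Q : SState} {j : Name × PreTerm} (hj : j ∈ Q.pool) {x : Var}
    (hx : x ∈ j.2.vars) : x ∈ Q.vars := by
  refine Finset.mem_union_right _ ?_
  obtain ⟨C, J⟩ := Q
  change j ∈ J at hj
  change x ∈ (J.map fun j => j.2.vars).foldr (· ∪ ·) ∅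
  induction J with
  | nil => simp at hj
  | cons i J ih =>
    simp only [List.map_cons, List.foldr_cons, Finset.mem_union]
    rcases List.mem_cons.1 hj with rfl | hj
    · exact .inl hx
    · exact .inr (ih hj)

theorem SState.Inv.mem_vars {Q : SState} {p : PreTerm} (h : Q.Inv p) {x : Var}
    (hx : x ∈ p.vars) : x ∈ Q.vars := by
  rw [Expr.vars, Finset.mem_union, List.mem_toFinset] at hx
  have hl : ∀ {y}, y ∈ Q.mctx.vars → y ∈ Q.vars := Finset.mem_union_left _
  rcases hx with hx | hx
  · rcases h.readsBack.mem_fv hx with h | ⟨j, hj, h⟩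
    · exact hl (Finset.mem_union_left _ h)
    · exact mem_vars_pool hj (Finset.mem_union_left _ h)
  · rcases h.readsBack.mem_binders hx with h | ⟨j, hj, h⟩
    · exact hl (Finset.mem_union_right _ (by simpa using h))
    · exact mem_vars_pool hj (Finset.mem_union_right _ (by simpa using h))

theorem SState.Inv.readBack {Q : SState} {p : PreTerm} (h : Q.Inv p) :
    Q.readBack = some (PreTerm.toTerm p) := by
  rw [SState.readBack, h.readsBack.readBack h.nodup, Option.map_some]

/-- The invariant after a principal transition. -/
theorem SState.Inv.step {Q Q' : SState} {p q p' : PreTerm} (h : Q.Inv p) {k : StepKind}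
    {σ : Cat} {E : Ctx Empty σ .tm} (hs : PreStep k E p q) (hG : E.Good) (hk : k ≠ .w)
    (hq : Expr.db idEnv q = Expr.db idEnv p')
    (hr : ReadsBack Q'.mctx Q'.pool p') (hpool : Q'.pool.map Prod.fst = Q.pool.map Prod.fst)
    (hsearched : Q'.mctx.Searched ∅) (N : List Var) (hN : N.Nodup)
    (hd : ∀ x ∈ N, x ∉ Q.vars)
    (hle : (p'.binders : Multiset Var) ≤ p.binders + N) :
    ∃ p', GoodNonErasingStep (PreTerm.toTerm p) (PreTerm.toTerm p') ∧ Q'.Inv p' := by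
  have hdb := hs.dstep hG hk h.lin
  rw [hq] at hdb
  refine ⟨p', ⟨k, σ, E, p, q, rfl, Term.db_injective hq, hs, hG, hk⟩, hr, ?_,
    hpool ▸ h.nodup, hsearched, hdb.lin h.lin⟩
  -- That no free variable appears is read off the nameless step, which is insensitive to the names
  -- chosen in the fresh copy.
  refine h.wellBound.of_le (fun x hx => ?_) N hN (fun x hx hxp => hd x hx (h.mem_vars hxp)) hle
  rw [mem_fv_iff] at hx ⊢
  exact fun h0 => hx (LStep.cnt_eq_zero hdb x (by simp) h0)

section BindersLe

variable {H : Type} {σ τ : Cat} (K : Ctx H .tm τ) (v : Expr H .val) (x : Var)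
  (E : Ctx H σ .tm) (o o' : Expr H σ) (N : List Var)

/-- For a consumed cut: the binders of its value may reappear in the contractum because the value
itself is gone, and the binder `x` is dropped, whence an inequality. -/
theorem binders_plug_le_cut
    (h : (o'.binders : Multiset Var) ≤ v.binders + o.binders + N) :
    ((K.plug (E.plug o')).binders : Multiset Var) ≤
      (K.plug (.cut v x (E.plug o))).binders + N := by
  obtain ⟨B, -, hB⟩ := K.exists_binders
  obtain ⟨B', -, hB'⟩ := E.exists_binders
  simp only [hB, hB', binders, ← Multiset.cons_coe, ← Multiset.coe_add,
    ← Multiset.singleton_add]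
  calc _ ≤ B + (B' + (v.binders + o.binders + N)) := by gcongr
    _ ≤ {x} + (B + (B' + (v.binders + o.binders + N))) := Multiset.le_add_left _ _
    _ = _ := by abel

/-- For a cut that stays: its value keeps its binders, so those of a copy have to come from the
fresh names `N`. -/
theorem binders_cut_le_cut (h : (o'.binders : Multiset Var) ≤ o.binders + N) :
    ((K.plug (.cut v x (E.plug o'))).binders : Multiset Var) ≤
      (K.plug (.cut v x (E.plug o))).binders + N := by
  obtain ⟨B, -, hB⟩ := K.exists_binders
  obtain ⟨B', -, hB'⟩ := E.exists_binders
  simp only [hB, hB', binders, ← Multiset.cons_coe, ← Multiset.coe_add,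
    ← Multiset.singleton_add]
  calc _ ≤ B + ({x} + (v.binders + (B' + (o.binders + N)))) := by gcongr
    _ = _ := by abel

end BindersLe

theorem LCtx.mem_binders_of_captured {H : Type} {L : LCtx H} {x : Var} (h : x ∈ L.captured)
    (s : Expr H .tm) : x ∈ (L.plug s).binders := by
  obtain ⟨B, h1, h2⟩ := L.exists_binders
  rw [← Multiset.mem_coe, h2, Multiset.mem_add]
  exact .inl (h1 x h)

/-- In each case `ReadsBack.exists_redex` finds the redex in the read-back, at a good position, and
`WellBound.redex` discharges the side conditions of the root rule. The fresh copies made by the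
exponential transitions change the result up to α only. -/
theorem SState.Inv.principal {Q Q' : SState} {p : PreTerm} (h : Q.Inv p)
    (hs : PrincipalTrans Q Q') :
    ∃ p', GoodNonErasingStep (PreTerm.toTerm p) (PreTerm.toTerm p') ∧ Q'.Inv p' := by
  have hmono : ∀ {u : Expr Name .val} {x : Var} {D : MCtx} (S : Set Var),
      (Expr.cut u x D).Searched S → D.Searched S :=
    fun S hS => Searched.mono (t := _) hS (Set.subset_insert _ _)
  cases hs with
  | axm2 K D n m v x t a P =>
    obtain ⟨K', w, E, hu, rfl, hG, h1, -⟩ :=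
      ReadsBack.exists_redex (w := Expr.sub m v x t) (.inr (by simp [toTm]))
        (by simp [toTm, fv]) h
    obtain rfl : w = .var (mv n) := emb_injective hu.symm
    obtain ⟨f1, f2, f3, f4⟩ := h.wellBound.redex
    exact h.step (.axm2 K' E n m v x t f1 (by simpa [fv] using f2)) hG (by simp) rfl
      (h1 (.sub n v x t)) rfl (h.searched.plug hmono) [] (by simp) (by simp)
      (binders_plug_le_cut _ _ _ _ _ _ _ (by simp [binders]))
  | lolli K D y L v' m v x t a P =>
    obtain ⟨K', w, E, hu, rfl, hG, h1, -⟩ :=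
      ReadsBack.exists_redex (w := Expr.sub m v x t) (.inr (by simp [toTm]))
        (by simp [toTm, fv]) h
    obtain rfl : w = .lam y (L.plug (.val v')) := emb_injective hu.symm
    obtain ⟨f1, f2, f3, f4⟩ := h.wellBound.redex
    refine h.step (.lolli K' E y L v' m v x t f1 f2 ?_) hG (by simp) rfl
      (h1 (.cut v y (L.plug (.cut v' x t)))) rfl (h.searched.plug hmono) [] (by simp) (by simp)
      (binders_plug_le_cut _ _ _ _ _ _ _ (le_of_eq ?_))
    · refine Finset.disjoint_left.2 fun z hz hzt => f4 z ?_ ?_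
      · rw [binders, List.mem_cons]
        exact (Finset.mem_insert.1 hz).imp_right fun h => LCtx.mem_binders_of_captured h _
      · simp only [fv, Finset.mem_insert, Finset.mem_union]
        exact .inr (.inr hzt)
    · obtain ⟨B, -, hB⟩ := L.exists_binders
      simp only [binders, ← Multiset.cons_coe, ← Multiset.coe_add, hB, Multiset.coe_nil,
        ← Multiset.singleton_add]
      abel
  | axe2 K D f e x t a P =>
    obtain ⟨K', w, E, hu, rfl, hG, -, h1⟩ :=
      ReadsBack.exists_redex (w := Expr.der e x t) (.inr (by simp [toTm]))
        (by simp [toTm, fv]) h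
    obtain rfl : w = .var (ev f) := emb_injective hu.symm
    obtain ⟨f1, f2, f3, f4⟩ := h.wellBound.redex
    exact h.step (.axe2 K' E f e x t f1 (by simpa [fv] using f2)
      (by rintro rfl; simp [fv] at f3)) hG (by simp) rfl
      (h1 (.der f x t)) rfl h.searched [] (by simp) (by simp)
      (binders_cut_le_cut _ _ _ _ _ _ _ (by simp [binders]))
  | bang K D s L' v' e x t a P hf =>
    obtain ⟨K', w, E, hu, rfl, hG, -, h1⟩ :=
      ReadsBack.exists_redex (w := Expr.der e x t) (.inr (by simp [toTm]))
        (by simp [toTm, fv]) h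
    obtain rfl : w = .bang s := emb_injective hu.symm
    obtain ⟨f1, f2, f3, f4⟩ := h.wellBound.redex
    obtain ⟨ha, hw, hfr⟩ := hf
    obtain ⟨L, v, rfl⟩ : ∃ (L : LCtx Empty) (v : PreValue), s = L.plug (.val v) :=
      ⟨_, _, s.split_plug.symm⟩
    -- The original and the renamed left context avoid the free variables of `t` for different
    -- reasons: the former by well-boundness of the read-back, the latter by freshness for the whole
    -- state.
    have hL : Disjoint L.captured (t.fv.erase x) :=
      Finset.disjoint_left.2 fun z hz hzt => f4 z (LCtx.mem_binders_of_captured hz _)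
        (by simp only [fv, Finset.mem_insert]; exact .inr hzt)
    have hL' : Disjoint L'.captured (t.fv.erase x) :=
      Finset.disjoint_left.2 fun z hz hzt => hfr z (LCtx.mem_binders_of_captured hz _)
        (SState.mem_vars_pool (List.mem_cons_self ..) (Finset.mem_union_left _
          (by simp only [fv, Finset.mem_insert]; exact .inr hzt)))
    refine h.step (.bang K' E L v e x t f1 f2 f3 hL) hG (by simp) ?_
      (h1 (L'.plug (.cut v' x t))) rfl h.searched (L'.plug (.val v')).binders hw.1 hfr
      (binders_cut_le_cut _ _ _ _ _ _ _ (le_of_eq ?_))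
    -- The root rule pastes the promotion verbatim and the machine pastes a renamed copy; splicing
    -- gives them the same nameless form.
    · refine db_plug_congr _ (fun ρ => ?_) _
      simp only [db, DExpr.cut.injEq, true_and]
      refine db_plug_congr _ (fun ρ => ?_) _
      rw [db_splice _ _ hL, db_splice _ _ hL', ha.db_eq]
    · obtain ⟨B, -, hB⟩ := L'.exists_binders
      simp only [binders, ← Multiset.cons_coe, ← Multiset.coe_add, hB,
        ← Multiset.singleton_add]
      abel
  | axm1 K D v m a P hm =>
    obtain ⟨K', w, E, hu, rfl, hG, h1, -⟩ :=
      ReadsBack.exists_redex (w := Expr.var (mv m)) (.inl rfl) (by simp [toTm, fv]) h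
    obtain rfl : w = v := emb_injective hu.symm
    obtain ⟨f1, f2, f3, f4⟩ := h.wellBound.redex
    exact h.step (.axm1 K' E w m hm f1 f2) hG (by simp) rfl
      (h1 w) rfl (h.searched.plug hmono) [] (by simp) (by simp)
      (binders_plug_le_cut _ _ _ _ _ _ _ (by simp [binders]))
  | axe1 K D v v' e a P he hf =>
    obtain ⟨K', w, E, hu, rfl, hG, -, h1⟩ :=
      ReadsBack.exists_redex (w := Expr.var (ev e)) (.inl rfl) (by simp [toTm, fv]) h
    obtain rfl : w = v := emb_injective hu.symm
    obtain ⟨f1, f2, f3, f4⟩ := h.wellBound.redex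
    obtain ⟨ha, hw, hfr⟩ := hf
    refine h.step (.axe1 K' E w e he f1 f2 f3) hG (by simp) ?_
      (h1 v') rfl h.searched v'.binders hw.1 hfr
      (binders_cut_le_cut _ _ _ _ _ _ _ (by simp [binders]))
    refine db_plug_congr _ (fun ρ => ?_) _
    simp only [db, DExpr.cut.injEq, true_and]
    exact db_plug_congr _ (fun ρ => ha.db_eq ρ) _

/-! ## Search transitions -/

/-- The size of an expression. -/
def Expr.size {H : Type} : {τ : Cat} → Expr H τ → ℕ
  | _, .hole _ => 1
  | _, .var _ => 1
  | _, .lam _ t => t.size + 1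
  | _, .bang t => t.size + 1
  | _, .val v => v.size + 1
  | _, .cut v _ t => v.size + t.size + 1
  | _, .sub _ v _ t => v.size + t.size + 2
  | _, .der _ _ t => t.size + 1

/-- The total size of the jobs. -/
def SState.size (Q : SState) : ℕ := (Q.pool.map fun j => j.2.size).sum

/-- A search transition moves one constructor of the first job into the multi-context, so the
read-back stays literally the same pre-term. The conditions on the domain are what keeps the
enlarged multi-context searched. -/
theorem SState.Inv.search {Q Q' : SState} {p : PreTerm} (h : Q.Inv p)
    (hs : SearchTrans Q Q') : Q'.Inv p ∧ Q'.size < Q.size := by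
  obtain ⟨hr, hw, hn, hS, hl⟩ := h
  have key : ∀ {C : MCtx} {a : Name} {t : PreTerm} {P J' : List (Name × PreTerm)} {U : MCtx},
      ReadsBack C ((a, t) :: P) p → a ∉ P.map Prod.fst → C.Searched ∅ → ReadsBack U J' t →
      U.Searched C.dom → ((J' ++ P).map Prod.fst).Nodup →
      SState.Inv ⟨C.fill a U, J' ++ P⟩ p := by
    intro C a t P J' U h ha hC hU hUS hn
    obtain ⟨h1, h2⟩ := h.fill rfl ha hU
    exact ⟨h1, hw, hn, h2 _ hC (by simpa using hUS), hl⟩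
  cases hs with
  | sea1 C v x t a P =>
    refine ⟨key (J' := [(a, t)]) hr (List.nodup_cons.1 hn).1 hS (.cut v x (.job a t)) trivial hn,
      ?_⟩
    simp only [SState.size, List.map_cons, List.sum_cons, Expr.size]; omega
  | sea2 C m v x t a b P hm hb hba hbP =>
    refine ⟨key (J' := [(b, .val v), (a, t)]) hr (List.nodup_cons.1 hn).1 hS
      (.sub (J₁ := [(b, .val v)]) m x (.valJob b v) (.job a t)) ⟨by simpa using hm, trivial,
        trivial⟩ ?_, ?_⟩
    · exact List.nodup_cons.2 ⟨by simpa [hba] using hbP, hn⟩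
    -- The argument becomes a job through the inclusion `val`, which costs one; this is why
    -- subtractions add 2 to the size.
    · simp only [SState.size, List.map_cons, List.sum_cons, Expr.size]; omega
  | sea3 C e x t a P he =>
    refine ⟨key (J' := [(a, t)]) hr (List.nodup_cons.1 hn).1 hS (.der e x (.job a t))
      ⟨by simpa using he, trivial⟩ hn, ?_⟩
    simp only [SState.size, List.map_cons, List.sum_cons, Expr.size]; omega
  | sea4 C x t a P =>
    refine ⟨key (J' := [(a, t)]) hr (List.nodup_cons.1 hn).1 hS (.val (.lam x (.job a t)))
      trivial hn, ?_⟩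
    simp only [SState.size, List.map_cons, List.sum_cons, Expr.size]; omega
  | sea5 C t a P =>
    refine ⟨key (J' := [(a, t)]) hr (List.nodup_cons.1 hn).1 hS (.val (.bang (.job a t)))
      trivial hn, ?_⟩
    simp only [SState.size, List.map_cons, List.sum_cons, Expr.size]; omega
  | sea6 C x a P hx =>
    refine ⟨key (J' := []) hr (List.nodup_cons.1 hn).1 hS (.val (.var x))
      (by simpa [Searched] using hx)
      (List.nodup_cons.1 hn).2, ?_⟩
    simp only [SState.size, List.map_cons, List.sum_cons, Expr.size]; omega

theorem SState.Init.inv {t : Term} {Q : SState} (h : SState.Init t Q) (hl : Lin t.db) :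
    ∃ p, PreTerm.toTerm p = t ∧ Q.Inv p := by
  obtain ⟨a, p, rfl, hw, rfl⟩ := h
  exact ⟨p, rfl, .job a p, hw, by simp, trivial, hl⟩

/-! ## Final states -/

/-- Every shape of the first job enables a transition: a search one if the head variable is outside
the domain, and otherwise a principal one, because without clashes the value of the cut has the kind
that some rule expects. -/
theorem SState.Inv.pool_eq_nil {Q : SState} {p : PreTerm} (h : Q.Inv p)
    (hc : ¬ (PreTerm.toTerm p).Clashing) (hf : SESAME.Final Q) : Q.pool = [] := by
  have hs : ∀ Q', ¬ SearchTrans Q Q' := fun Q' => hf .search Q'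
  have hp : ∀ Q', ¬ PrincipalTrans Q Q' := fun Q' => hf .principal Q'
  obtain ⟨C, J⟩ := Q
  have cut : ∀ {x}, x ∈ C.dom → ∃ (K : Ctx Name .tm .tm) (v : PreValue) (D : MCtx),
      C = K.plug (.cut v.emb x D) ∧ (x.kind = .mul → ¬ v.IsExp) ∧
        (x.kind = .exp → ¬ v.IsMul) := by
    intro x hx
    obtain ⟨K, v, D, K', q, rfl, rfl⟩ := h.readsBack.exists_of_mem_dom hx
    exact ⟨K, v, D, rfl, fun hk hv => hc ⟨K', v, x, q, rfl, .inr ⟨hv, hk⟩⟩,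
      fun hk hv => hc ⟨K', v, x, q, rfl, .inl ⟨hv, hk⟩⟩⟩
  by_contra hJ
  obtain ⟨⟨a, t⟩, P, rfl⟩ := List.exists_cons_of_ne_nil hJ
  cases t with
  | cut v x t => exact hs _ (.sea1 C v x t a P)
  | sub m v x t =>
    by_cases hm : mv m ∈ C.dom
    · obtain ⟨K, w, D, rfl, hw, -⟩ := cut hm
      cases w with
      | hole b => exact b.elim
      | var y =>
        obtain ⟨k, n⟩ := y
        cases k with
        | mul => exact hp _ (.axm2 K D n m v x t a P)
        | exp => exact hw rfl rfl
      | lam y s =>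
        rw [← s.split_plug] at hp
        exact hp _ (.lolli K D y _ _ m v x t a P)
      | bang s => exact hw rfl trivial
    · obtain ⟨b, hb⟩ := Infinite.exists_notMem_finset
        (C.holes.toFinset ∪ {a} ∪ (P.map Prod.fst).toFinset)
      simp only [Finset.mem_union, Finset.mem_singleton, List.mem_toFinset, not_or] at hb
      exact hs _ (.sea2 C m v x t a b P hm hb.1.1 hb.1.2 hb.2)
  | der e x t =>
    by_cases he : ev e ∈ C.dom
    · obtain ⟨K, w, D, rfl, -, hw⟩ := cut he
      cases w with
      | hole b => exact b.elim
      | var y =>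
        obtain ⟨k, n⟩ := y
        cases k with
        | mul => exact hw rfl rfl
        | exp => exact hp _ (.axe2 K D n e x t a P)
      | lam y s => exact hw rfl trivial
      | bang s =>
        obtain ⟨s', hs'⟩ := exists_freshRenaming (SState.vars
          ⟨K.plug (.cut (Expr.bang s).emb (ev e) D), (a, .der e x t) :: P⟩) s
        rw [← s'.split_plug] at hs'
        exact hp _ (.bang K D s _ _ e x t a P hs')
    · exact hs _ (.sea3 C e x t a P he)
  | val v =>
    cases v with
    | hole b => exact b.elim
    | lam x t => exact hs _ (.sea4 C x t a P)
    | bang t => exact hs _ (.sea5 C t a P)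
    | var x =>
      by_cases hx : x ∈ C.dom
      · obtain ⟨K, w, D, rfl, hw, hw'⟩ := cut hx
        obtain ⟨k, n⟩ := x
        cases k with
        | mul =>
          refine hp _ (.axm1 K D w n a P ?_)
          cases w with
          | hole b => exact b.elim
          | var y =>
            obtain ⟨k, y⟩ := y
            cases k with
            | mul => rfl
            | exp => exact absurd rfl (hw rfl)
          | lam => trivial
          | bang => exact absurd trivial (hw rfl)
        | exp =>
          obtain ⟨w', h'⟩ := exists_freshRenaming (SState.vars
            ⟨K.plug (.cut w.emb (ev n) D), (a, .val (.var (ev n))) :: P⟩) w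
          refine hp _ (.axe1 K D w w' n a P ?_ h')
          cases w with
          | hole b => exact b.elim
          | var y =>
            obtain ⟨k, y⟩ := y
            cases k with
            | exp => rfl
            | mul => exact absurd rfl (hw' rfl)
          | bang => trivial
          | lam => exact absurd trivial (hw' rfl)
      · exact hs _ (.sea6 C x a P hx)

theorem SState.Inv.normal {Q : SState} {p : PreTerm} (h : Q.Inv p)
    (hc : ¬ (PreTerm.toTerm p).Clashing) (hf : SESAME.Final Q) :
    Normal DStep (PreTerm.toTerm p).db :=
  (h.readsBack.nrm (h.pool_eq_nil hc hf) h.searched (T := ∅) (by simp)).normal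

/-! ## SESAME implements the non-erasing good strategy -/

theorem SState.Inv.run {k : ℕ} {Q Q' : SESAME.State} (hr : SESAME.Run k Q Q')
    {p : PreTerm} (h : SState.Inv Q p) : ∃ p', SState.Inv Q' p' ∧
      Evaluation GoodNonErasingStep k (PreTerm.toTerm p) (PreTerm.toTerm p') := by
  induction hr generalizing p with
  | nil Q => exact ⟨p, h, rfl⟩
  | search hs _ ih => exact ih (h.search hs).1
  | principal hs _ ih =>
    obtain ⟨p₁, h1, h2⟩ := h.principal hs
    obtain ⟨p', h3, h4⟩ := ih h2
    exact ⟨p', h3, _, h1, h4⟩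

theorem Evaluation.clashFree {k : ℕ} {t s : Term} (h : Evaluation GoodNonErasingStep k t s)
    (hc : t.ClashFree) : s.ClashFree := by
  induction k generalizing t with
  | zero => obtain rfl : t = s := h; exact hc
  | succ k ih =>
    obtain ⟨u, hu, h⟩ := h
    exact ih h (clashFree_step hc hu)

/-- From every state, search transitions lead either to a final state or to a principal
transition. -/
theorem SState.Inv.exists_search {Q : SState} {p : PreTerm} (h : Q.Inv p) :
    ∃ Q', SESAME.Run 0 Q Q' ∧ Q'.Inv p ∧
      (SESAME.Final Q' ∨ ∃ Q'', PrincipalTrans Q' Q'') := by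
  induction hn : Q.size using Nat.strong_induction_on generalizing Q with
  | _ n ih =>
    by_cases hs : ∃ Q₁, SearchTrans Q Q₁
    · obtain ⟨Q₁, hs⟩ := hs
      obtain ⟨h₁, hlt⟩ := h.search hs
      obtain ⟨Q', hr, h'⟩ := ih _ (hn ▸ hlt) h₁ rfl
      exact ⟨Q', .search hs hr, h'⟩
    · refine ⟨Q, Machine.Run.nil (M := SESAME) Q, h, ?_⟩
      by_cases hp : ∃ Q₁, PrincipalTrans Q Q₁
      · exact .inr hp
      · refine .inl fun k Q₁ ht => ?_
        cases k with
        | principal => exact hp ⟨Q₁, ht⟩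
        | search => exact hs ⟨Q₁, ht⟩

theorem Machine.Run.trans {M : Machine} {k l : ℕ} {Q Q' Q'' : M.State} (h : M.Run k Q Q')
    (h' : M.Run l Q' Q'') : M.Run (k + l) Q Q'' := by
  induction h with
  | nil => simpa using h'
  | search hs _ ih => exact .search hs (ih h')
  | principal hs _ ih =>
    rw [Nat.add_right_comm]
    exact .principal hs (ih h')

/-- Normal terms have normal nameless representations. -/
theorem Term.normal_db {t : Term} (hl : Lin t.db) (hc : t.ClashFree)
    (hn : Normal GoodNonErasingStep t) : Normal DStep t.db := by
  obtain ⟨Q, hQ⟩ := exists_init t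
  -- The machine decides the question: it either reaches a principal transition, hence a good step
  -- of `t`, or a final state, whose read-back, still `t`, is normal in nameless form.
  obtain ⟨p, rfl, hp⟩ := hQ.inv hl
  obtain ⟨Q', -, h', hf | ⟨Q'', hs⟩⟩ := hp.exists_search
  · exact h'.normal (hc _ .refl) hf
  · obtain ⟨p', hs, -⟩ := h'.principal hs
    exact absurd hs (hn _)

/-- The machine chooses its own steps, but random descent makes each of them shorten by one the
distance to the normal form `d`, so after `k` principal transitions it must stop at `d`. -/
theorem SState.Inv.exists_final {k : ℕ} {Q : SState} {p : PreTerm} (h : Q.Inv p)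
    (hc : (PreTerm.toTerm p).ClashFree) {d : DExpr .tm}
    (he : Evaluation DStep k (PreTerm.toTerm p).db d) (hn : Normal DStep d) :
    ∃ Q' p', SESAME.Run k Q Q' ∧ SESAME.Final Q' ∧ Q'.Inv p' ∧ (PreTerm.toTerm p').db = d := by
  induction k generalizing Q p with
  | zero =>
    obtain ⟨Q', hr, h', hf | ⟨Q'', hs⟩⟩ := h.exists_search
    · exact ⟨Q', p, hr, hf, h', he⟩
    · obtain ⟨p', hs, -⟩ := h'.principal hs
      have he' : (PreTerm.toTerm p).db = d := he
      exact absurd (he' ▸ hs.dstep h.lin) (hn _)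
  | succ k ih =>
    obtain ⟨Q', hr, h', hf | ⟨Q'', hs⟩⟩ := h.exists_search
    · obtain ⟨u, hu, -⟩ := he
      exact absurd hu (h'.normal (hc _ .refl) hf u)
    · obtain ⟨p', hs', hp'⟩ := h'.principal hs
      -- The first step of the given evaluation is discarded; the step of the machine takes its
      -- place.
      obtain ⟨k', hk, he'⟩ := he.of_diamond (fun _ _ _ => DStep.diamond) hn (hs'.dstep h.lin)
      obtain rfl : k = k' := by omega
      obtain ⟨Q₁, p₁, hr₁, h₁⟩ := ih hp' (clashFree_step hc hs') he'
      have := hr.trans (Machine.Run.principal hs hr₁)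
      rw [Nat.zero_add] at this
      exact ⟨Q₁, p₁, this, h₁⟩

/-- A successor is chosen for each reachable state, and the choice is iterated; restricting to
reachable states is what keeps a successor available. -/
theorem Machine.exists_infiniteRun {M : Machine} {Q : M.State}
    (h : ∀ k Q', M.Run k Q Q' → ¬ M.Final Q') : ∃ f l, M.InfiniteRun Q f l := by
  have next : ∀ q : {Q' : M.State // ∃ k, M.Run k Q Q'},
      ∃ (a : TransKind) (q' : {Q' : M.State // ∃ k, M.Run k Q Q'}), M.trans a q.1 q'.1 := by
    rintro ⟨Q₁, k, hr⟩
    have := h k Q₁ hr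
    simp only [Machine.Final, not_forall, not_not] at this
    obtain ⟨a, Q₂, ht⟩ := this
    refine ⟨a, ⟨Q₂, ?_⟩, ht⟩
    cases a with
    | principal => exact ⟨_, hr.trans (.principal ht (.nil _))⟩
    | search => exact ⟨_, hr.trans (.search ht (.nil _))⟩
  choose a g hg using next
  let F : ℕ → {Q' : M.State // ∃ k, M.Run k Q Q'} := fun n => g^[n] ⟨Q, 0, .nil Q⟩
  refine ⟨fun n => (F n).1, fun n => a (F n), rfl, fun n => ?_⟩
  have : F (n + 1) = g (F n) := Function.iterate_succ_apply' g n _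
  change M.trans (a (F n)) (F n).1 (F (n + 1)).1
  rw [this]
  exact hg _

theorem SState.Inv.exists_principal {Q : SState} {p : PreTerm} (h : Q.Inv p)
    {f : ℕ → SState} {l : ℕ → TransKind} (hf : SESAME.InfiniteRun Q f l) (N : ℕ) :
    ∃ n, N ≤ n ∧ l n = .principal := by
  by_contra! hN
  have inv : ∀ n, ∃ p, (f n).Inv p := fun n => by
    induction n with
    | zero => exact ⟨p, hf.1 ▸ h⟩
    | succ n ih =>
      obtain ⟨p, hp⟩ := ih
      have ht := hf.2 n
      cases hl : l n with
      | principal =>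
        rw [hl] at ht
        obtain ⟨p', -, hp'⟩ := hp.principal ht
        exact ⟨p', hp'⟩
      | search =>
        rw [hl] at ht
        exact ⟨p, (hp.search ht).1⟩
  -- From `N` on all transitions would be search transitions, each of which decreases the size of
  -- the pool.
  have dec : ∀ i, (f (N + i)).size + i ≤ (f N).size := fun i => by
    induction i with
    | zero => simp
    | succ i ih =>
      obtain ⟨p, hp⟩ := inv (N + i)
      have ht := hf.2 (N + i)
      cases hl : l (N + i) with
      | principal => exact absurd hl (hN _ (Nat.le_add_right _ _))
      | search =>
        rw [hl] at ht
        have := (hp.search ht).2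
        change (f (N + i + 1)).size + (i + 1) ≤ _
        omega
  have := dec ((f N).size + 1)
  omega

end ESC

theorem mainTheorem2 : ESC.BigStepImplementation ESC.SESAME ESC.GoodNonErasingStep := by
  open ESC in
  refine ⟨?_, ?_, ?_⟩
  · intro t ht _ Q' Q k hi hr
    obtain ⟨p, rfl, hp⟩ := SState.Init.inv hi ht.lin
    obtain ⟨p', hp', he⟩ := SState.Inv.run hr hp
    exact ⟨_, hp'.readBack, he⟩
  · intro t ht hc s k he hn
    refine ⟨exists_init t, fun Q' hi => ?_⟩
    obtain ⟨p, rfl, hp⟩ := SState.Init.inv hi ht.lin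
    obtain ⟨hd, hl⟩ := he.dstep ht.lin
    obtain ⟨Q, p', hr, hf, hp', hs⟩ :=
      hp.exists_final hc hd (Term.normal_db hl (he.clashFree hc) hn)
    exact ⟨Q, hr, hf, hp'.readBack.trans (congrArg some (Term.db_injective hs))⟩
  · intro t ht hc Q hi hdiv
    obtain ⟨p, rfl, hp⟩ := SState.Init.inv hi ht.lin
    have hnf : ∀ k Q', SESAME.Run k Q Q' → ¬ SESAME.Final Q' := by
      intro k Q' hr hf
      obtain ⟨p', hp', he⟩ := SState.Inv.run hr hp
      -- A final state would provide a normalizing evaluation, which by random descent excludes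
      -- every infinite one.
      exact (he.dstep ht.lin).1.not_diverges (fun _ _ _ => DExpr.DStep.diamond)
        (hp'.normal (he.clashFree hc _ .refl) hf) (hdiv.dstep ht.lin)
    exact ⟨hnf, Machine.exists_infiniteRun hnf, fun f l h => hp.exists_principal h⟩
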